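/- Let $K$ be a field. A $z$-endomorphism $\varphi=(f,g)$ of the free associative algebra $K\langle x,y,z\rangle$ is the endomorphism $x\mapsto f$, $y\mapsto g$, $z\mapsto z$. It is a $z$-tame automorphism if it lies in the group generated by the $z$-affine automorphisms $(\alpha_{11}x+\alpha_{21}y+\alpha_{31}z+\beta_1,\ \alpha_{12}x+\alpha_{22}y+\alpha_{32}z+\beta_2)$, with $\alpha_{ij},\beta_j\in K$ and $(\alpha_{ij})_{i,j=1,2}$ invertible, and the $z$-triangular automorphisms $(\alpha_1x+p_1(y,z),\alpha_2y+p_2(z))$, with $\alpha_1,\alpha_2\in K^*$, $p_1\in K\langle y,z\rangle$, $p_2\in K[z]$. The bidegree of a monomial $w$ is $(\deg_xw+\deg_yw,\deg_zw)$; bidegrees are ordered lexicographically. Let $H_n$ be the space of polynomials that are homogeneous of degree $n$ in $x,y$ together. For nonzero $f,g$ let $u,v$ be their bihomogeneous components of highest bidegree. Consider the following procedure. Step 0. If $f$ or $g$ lies in $K[z]$, answer "no". Step 1. Otherwise, if $u,v$ both have bidegree $(1,0)$, answer "yes" if they are linearly independent and "no" if they are linearly dependent. Step 2. Otherwise, if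 $\operatorname{bideg}u>(1,0)$ and $\operatorname{bideg}u\ge\operatorname{bideg}v$, with $u\in H_l$, $v\in H_k$, decide whether $l=kd$ for a positive integer $d$ and $u=q(v/\beta,z)$ for some $\beta\in K^*$ and $q=q(y,z)\in K\langle y,z\rangle\cap H_d$. If so, replace $(f,g)$ by $(f-q(g/\beta,z),g)$ and go to Step 0; if not, answer "no". Step 3. Otherwise ($\operatorname{bideg}v>(1,0)$ and $\operatorname{bideg}u<\operatorname{bideg}v$) do the same with the roles of the two coordinates exchanged: if $v=q(u/\alpha,z)$, replace $(f,g)$ by $(f,g-q(f/\alpha,z))$ and go to Step 0; if not, answer "no". Then: (a) The outcome of each pass is uniquely determined (it does not depend on the choice of $\beta$ and $q$), and the procedure always stops. (b) If the answer "yes" is given at $\varphi$, then $\varphi$ is a $z$-tame automorphism, and is the product of a linear automorphism from $GL_2(K)$ in $x,y$ and a translation $(x+p(z),y+r(z))$. If the answer "no" is given at $\varphi$, then $\varphi$ is not a $z$-tame automorphism; if this happens in Step 0 or Step 1, $\varphi$ is not an automorphism at all. A replacement in Step 2 or 3 changes neither $z$-tameness nor non-$z$-tameness. (c) For a word $u_1\cdots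 u_n$ in $x,y$ and $P\in K[t_0,\dots,t_n]$ define $P*(u_1\cdots u_n)$ as the $K$-linear extension of $t_0^{a_0}\cdots t_n^{a_n}*(u_1\cdots u_n)=z^{a_0}u_1z^{a_1}\cdots u_nz^{a_n}$. Every element of $H_n$ can be written uniquely as $\sum_J\lambda_J*J$, over the $2^n$ words $J$ of length $n$ in $x,y$, with $\lambda_J\in K[t_0,\dots,t_n]$ (so $H_n$ is a free $K[t_0,\dots,t_n]$-module on these words), and $K\langle y,z\rangle\cap H_d=K[t_0,\dots,t_d]*y^d$. Let $v=\sum_I\theta_I*I\in H_k$ and $u=\sum_J\lambda_J*J\in H_{kd}$, the sums being over the words $I$, $J$ in $x,y$ of lengths $k$ and $kd$; for $J=J_1\cdots J_d$ with each $J_j$ of length $k$ put $\Theta_J=\prod_{j=1}^d\theta_{J_j}(t_{k(j-1)},\dots,t_{kj})$. For $\beta\in K^*$ and $\omega\in K[t_0,\dots,t_d]$, the equality $u=q(v/\beta,z)$ with $q=\omega*y^d$ holds if and only if $\lambda_J=\beta^{-d}\,\omega(t_0,t_k,t_{2k},\dots,t_{kd})\,\Theta_J$ for all $J$. Consequently,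 if $k,d>0$ and $J_0$ is a word with $\theta_{(J_0)_j}\neq0$ for all $j$, then there is at most one $\omega\in K[t_0,\dots,t_d]$ with $\lambda_{J_0}=\omega(t_0,t_k,\dots,t_{kd})\Theta_{J_0}$; if there is none, then $u$ is not of the form $q(v/\beta,z)$ with $\beta\in K^*$, $q\in K\langle y,z\rangle\cap H_d$; and if there is one, then $u$ is of this form if and only if $\lambda_J=\omega(t_0,t_k,\dots,t_{kd})\Theta_J$ for all $J$. (d) If $K$ is constructive (its elements are named by natural numbers so that equality is decidable and the field operations are computable on names), then one pass of the procedure is a computable function of names of $f,g$ (lists of monomials with names of coefficients), and so is the final answer; hence it is algorithmically decidable whether a $z$-endomorphism $(f,g)$ is a $z$-tame automorphism. -/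

import Mathlib

namespace ZTame

/-! ### The free associative algebra `K⟨x,y,z⟩` and its `z`-endomorphisms -/

/-- The free associative algebra `K⟨x,y,z⟩`; the letters `0, 1, 2` are `x, y, z`. -/
abbrev A (K : Type*) [Field K] : Type _ := FreeAlgebra K (Fin 3)

noncomputable def X (K : Type*) [Field K] : A K := FreeAlgebra.ι K 0

noncomputable def Y (K : Type*) [Field K] : A K := FreeAlgebra.ι K 1

noncomputable def Z (K : Type*) [Field K] : A K := FreeAlgebra.ι K 2

/-- The `z`-endomorphism `φ = (f, g)`, that is `x ↦ f`, `y ↦ g`, `z ↦ z`. -/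
noncomputable def zEnd {K : Type*} [Field K] (φ : A K × A K) : A K →ₐ[K] A K :=
  FreeAlgebra.lift K ![φ.1, φ.2, Z K]

/-- The subalgebra `K[z]` of `K⟨x,y,z⟩`. -/
noncomputable def algZ (K : Type*) [Field K] : Subalgebra K (A K) :=
  Algebra.adjoin K {Z K}

/-- The subalgebra `K⟨y,z⟩` of `K⟨x,y,z⟩`. -/
noncomputable def algYZ (K : Type*) [Field K] : Subalgebra K (A K) :=
  Algebra.adjoin K {Y K, Z K}

/-- `q(p,z)` for `q = q(y,z)`: substitute `p` for `y` and keep `z`.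
It is only used for `q ∈ K⟨y,z⟩`, so that the value given to `x` does not matter. -/
noncomputable def subst {K : Type*} [Field K] (q p : A K) : A K :=
  FreeAlgebra.lift K ![0, p, Z K] q

/-! ### The group of `z`-tame automorphisms -/

/-- `(α₁₁x + α₂₁y + α₃₁z + β₁, α₁₂x + α₂₂y + α₃₂z + β₂)` with `(αᵢⱼ)_{i,j=1,2}` invertible. -/
def IsZAffine {K : Type*} [Field K] (e : A K ≃ₐ[K] A K) : Prop :=
  e (Z K) = Z K ∧ ∃ (α : Matrix (Fin 2) (Fin 2) K) (γ β : Fin 2 → K), IsUnit α.det ∧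
    e (X K) = α 0 0 • X K + α 1 0 • Y K + γ 0 • Z K + algebraMap K (A K) (β 0) ∧
    e (Y K) = α 0 1 • X K + α 1 1 • Y K + γ 1 • Z K + algebraMap K (A K) (β 1)

/-- `(α₁x + p₁(y,z), α₂y + p₂(z))` with `α₁, α₂ ∈ K*`. -/
def IsZTriangular {K : Type*} [Field K] (e : A K ≃ₐ[K] A K) : Prop :=
  e (Z K) = Z K ∧ ∃ (α₁ α₂ : K) (p₁ p₂ : A K), α₁ ≠ 0 ∧ α₂ ≠ 0 ∧ p₁ ∈ algYZ K ∧ p₂ ∈ algZ K ∧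
    e (X K) = α₁ • X K + p₁ ∧ e (Y K) = α₂ • Y K + p₂

/-- The group of `z`-tame automorphisms of `K⟨x,y,z⟩`. -/
def tameGroup (K : Type*) [Field K] : Subgroup (A K ≃ₐ[K] A K) :=
  Subgroup.closure {e | IsZAffine e ∨ IsZTriangular e}

/-- The `z`-endomorphism `φ = (f, g)` is a `z`-tame automorphism. -/
def IsZTame {K : Type*} [Field K] (φ : A K × A K) : Prop :=
  ∃ e ∈ tameGroup K, (e : A K →ₐ[K] A K) = zEnd φ

/-- `φ` is a product of a linear automorphism `(α₁₁x + α₂₁y, α₁₂x + α₂₂y)` from `GL₂(K)` and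
a translation `(x + p(z), y + r(z))`; in a product the right factor is applied first. -/
def IsLinearTimesTranslation {K : Type*} [Field K] (φ : A K × A K) : Prop :=
  ∃ (α : Matrix (Fin 2) (Fin 2) K) (p r : A K), IsUnit α.det ∧ p ∈ algZ K ∧ r ∈ algZ K ∧
    zEnd φ = (zEnd (α 0 0 • X K + α 1 0 • Y K, α 0 1 • X K + α 1 1 • Y K)).comp
      (zEnd (X K + p, Y K + r))

/-! ### Bidegree and leading bihomogeneous components -/

/-- The total degree in `x` and `y` of a monomial. -/
def xyDeg (w : FreeMonoid (Fin 3)) : ℕ := w.toList.count 0 + w.toList.count 1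

/-- The bidegree `(deg_x w + deg_y w, deg_z w)` of a monomial, in `ℕ × ℕ` ordered
lexicographically. -/
def wordBideg (w : FreeMonoid (Fin 3)) : ℕ ×ₗ ℕ := toLex (xyDeg w, w.toList.count 2)

/-- The coefficients of a noncommutative polynomial. -/
noncomputable def coeffs {K : Type*} [Field K] (p : A K) : FreeMonoid (Fin 3) →₀ K :=
  (FreeAlgebra.equivMonoidAlgebraFreeMonoid p).coeff

/-- The bidegree of a nonzero polynomial: the largest bidegree of its monomials
(and `(0,0)` for the zero polynomial). -/
noncomputable def bideg {K : Type*} [Field K] (p : A K) : ℕ ×ₗ ℕ :=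
  (coeffs p).support.sup wordBideg

/-- The leading bihomogeneous component of a polynomial. -/
noncomputable def lead {K : Type*} [Field K] (p : A K) : A K :=
  FreeAlgebra.equivMonoidAlgebraFreeMonoid.symm
    (MonoidAlgebra.ofCoeff ((coeffs p).filter fun w => wordBideg w = bideg p))

/-- The space `H_n` of polynomials that are homogeneous of degree `n` in `x` and `y`. -/
def H (K : Type*) [Field K] (n : ℕ) : Submodule K (A K) where
  carrier := {p | ∀ w, coeffs p w ≠ 0 → xyDeg w = n}
  zero_mem' := by intro w hw; simp [coeffs] at hw
  add_mem' := by
    intro p q hp hq w hw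
    by_cases h : coeffs p w = 0
    · refine hq w fun h' => hw ?_
      simp only [coeffs] at h h' ⊢
      simp [h, h']
    · exact hp w h
  smul_mem' := by
    intro c p hp w hw
    refine hp w fun h => hw ?_
    simp only [coeffs] at h ⊢
    simp [h]

/-! ### The procedure -/

/-- `u = q(v/β, z)` where `u ∈ H_l`, `v ∈ H_k`, `l = kd` with a positive integer `d`,
`β ∈ K*`, and `q(y,z) ∈ K⟨y,z⟩ ∩ H_d`. -/
def Expresses {K : Type*} [Field K] (u v : A K) (β : K) (q : A K) : Prop :=
  β ≠ 0 ∧ ∃ k l d : ℕ, 0 < d ∧ l = k * d ∧ u ∈ H K l ∧ v ∈ H K k ∧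
    q ∈ algYZ K ∧ q ∈ H K d ∧ u = subst q (β⁻¹ • v)

/-- One of `f`, `g` depends on `z` only. -/
def SomeInZ {K : Type*} [Field K] (φ : A K × A K) : Prop :=
  φ.1 ∈ algZ K ∨ φ.2 ∈ algZ K

/-- Both leading components have bidegree `(1,0)`, and none of `f`, `g` depends on `z` only. -/
def BothLinear {K : Type*} [Field K] (φ : A K × A K) : Prop :=
  ¬ SomeInZ φ ∧ bideg φ.1 = toLex (1, 0) ∧ bideg φ.2 = toLex (1, 0)

/-- `bideg u > (1,0)` and `bideg u ≥ bideg v`, and none of `f`, `g` depends on `z` only. -/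
def FirstBig {K : Type*} [Field K] (φ : A K × A K) : Prop :=
  ¬ SomeInZ φ ∧ toLex (1, 0) < bideg φ.1 ∧ bideg φ.2 ≤ bideg φ.1

/-- `bideg v > (1,0)` and `bideg u < bideg v`, and none of `f`, `g` depends on `z` only. -/
def SecondBig {K : Type*} [Field K] (φ : A K × A K) : Prop :=
  ¬ SomeInZ φ ∧ toLex (1, 0) < bideg φ.2 ∧ bideg φ.1 < bideg φ.2

/-- One pass through the steps of the procedure. The outcome is either a final answer
(`true`: a `z`-tame automorphism, `false`: not a `z`-tame automorphism) or a new
`z`-endomorphism to which the procedure is applied next. -/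
inductive Pass {K : Type*} [Field K] (φ : A K × A K) : Bool ⊕ (A K × A K) → Prop
  | step_zero (h : SomeInZ φ) : Pass φ (Sum.inl false)
  | step_one_yes (h : BothLinear φ) (hi : LinearIndependent K ![lead φ.1, lead φ.2]) :
      Pass φ (Sum.inl true)
  | step_one_no (h : BothLinear φ) (hi : ¬ LinearIndependent K ![lead φ.1, lead φ.2]) :
      Pass φ (Sum.inl false)
  | step_two_go (h : FirstBig φ) (β : K) (q : A K)
      (hq : Expresses (lead φ.1) (lead φ.2) β q) :
      Pass φ (Sum.inr (φ.1 - subst q (β⁻¹ • φ.2), φ.2))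
  | step_two_no (h : FirstBig φ)
      (hq : ∀ (β : K) (q : A K), ¬ Expresses (lead φ.1) (lead φ.2) β q) :
      Pass φ (Sum.inl false)
  | step_three_go (h : SecondBig φ) (α : K) (q : A K)
      (hq : Expresses (lead φ.2) (lead φ.1) α q) :
      Pass φ (Sum.inr (φ.1, φ.2 - subst q (α⁻¹ • φ.1)))
  | step_three_no (h : SecondBig φ)
      (hq : ∀ (α : K) (q : A K), ¬ Expresses (lead φ.2) (lead φ.1) α q) :
      Pass φ (Sum.inl false)

/-! ### The `K[t_0,…,t_n]`-module `H_n` -/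

/-- The monomial `z^{a_0} u_1 z^{a_1} u_2 ⋯ u_n z^{a_n}`, where the letter `u_i` is `x` or `y`
according as its index is `0` or `1`. -/
noncomputable def zWord {K : Type*} [Field K] {n : ℕ} (u : Fin n → Fin 2)
    (a : Fin (n + 1) →₀ ℕ) : A K :=
  Z K ^ a 0 *
    (List.ofFn fun i : Fin n => FreeAlgebra.ι K (u i).castSucc * Z K ^ a i.succ).prod

/-- `P ∗ (u_1 ⋯ u_n)` for `P ∈ K[t_0,…,t_n]`: the `K`-linear extension in `P` of
`t_0^{a_0} ⋯ t_n^{a_n} ∗ (u_1 ⋯ u_n) = z^{a_0} u_1 z^{a_1} ⋯ u_n z^{a_n}`. -/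
noncomputable def act {K : Type*} [Field K] {n : ℕ} (P : MvPolynomial (Fin (n + 1)) K)
    (u : Fin n → Fin 2) : A K :=
  ∑ a ∈ P.support, P.coeff a • zWord u a

/-- The element `∑ Θ_u ∗ (u_1 ⋯ u_n)` of `H_n` with coordinates `Θ_u ∈ K[t_0,…,t_n]`, the sum
being over the `2^n` words `u_1 ⋯ u_n` in `x` and `y`. -/
noncomputable def ofCoords {K : Type*} [Field K] {n : ℕ}
    (Θ : (Fin n → Fin 2) → MvPolynomial (Fin (n + 1)) K) : A K :=
  ∑ u, act (Θ u) u

/-- The polynomial `ω ∗ y^d` of `K⟨y,z⟩`. -/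
noncomputable def ofY {K : Type*} [Field K] {d : ℕ} (ω : MvPolynomial (Fin (d + 1)) K) : A K :=
  act ω fun _ => 1

/-- The index `k j + i` of `t_{kj+i}`, for `0 ≤ i ≤ k` and `0 ≤ j < d`. -/
def blockIdx {k d : ℕ} (j : Fin d) (i : Fin (k + 1)) : Fin (k * d + 1) :=
  ⟨k * j + i, by
    have h1 : k * ((j : ℕ) + 1) ≤ k * d := Nat.mul_le_mul_left k j.isLt
    have h2 := i.isLt
    rw [Nat.mul_add] at h1
    omega⟩

/-- The position `k j + i` of the letters of the `j`-th block, for `0 ≤ i < k`, `0 ≤ j < d`. -/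
def blockPos {k d : ℕ} (j : Fin d) (i : Fin k) : Fin (k * d) :=
  ⟨k * j + i, by
    have h1 : k * ((j : ℕ) + 1) ≤ k * d := Nat.mul_le_mul_left k j.isLt
    have h2 := i.isLt
    rw [Nat.mul_add] at h1
    omega⟩

/-- `ω(t_0, t_k, t_{2k}, …, t_{kd})`. -/
noncomputable def spread {K : Type*} [Field K] (k : ℕ) {d : ℕ}
    (ω : MvPolynomial (Fin (d + 1)) K) : MvPolynomial (Fin (k * d + 1)) K :=
  MvPolynomial.rename
    (fun i : Fin (d + 1) => (⟨k * i, Nat.lt_succ_of_le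
      (Nat.mul_le_mul_left k (Nat.le_of_lt_succ i.isLt))⟩ : Fin (k * d + 1))) ω

/-- For a word `J` of length `kd`, cut into `d` words `J_1, …, J_d` of length `k`, the product
`Θ_{J_1}(t_0,…,t_k) Θ_{J_2}(t_k,…,t_{2k}) ⋯ Θ_{J_d}(t_{k(d-1)},…,t_{kd})`. -/
noncomputable def blockProd {K : Type*} [Field K] {k d : ℕ}
    (Θ : (Fin k → Fin 2) → MvPolynomial (Fin (k + 1)) K) (J : Fin (k * d) → Fin 2) :
    MvPolynomial (Fin (k * d + 1)) K :=
  ∏ j : Fin d, MvPolynomial.rename (blockIdx j) (Θ fun i => J (blockPos j i))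

/-! ### Effectiveness -/

/-- A constructive field: the elements are named by natural numbers in such a way that equality
is decidable and the field operations are computable on names. -/
structure Constructivization (K : Type*) [Field K] where
  ν : ℕ → K
  surjective : Function.Surjective ν
  eq_computable : ComputablePred fun p : ℕ × ℕ => ν p.1 = ν p.2
  add_computable : ∃ s : ℕ → ℕ → ℕ, Computable₂ s ∧ ∀ m n, ν (s m n) = ν m + ν n
  mul_computable : ∃ s : ℕ → ℕ → ℕ, Computable₂ s ∧ ∀ m n, ν (s m n) = ν m * ν n
  neg_computable : ∃ s : ℕ → ℕ, Computable s ∧ ∀ n, ν (s n) = -ν n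
  inv_computable : ∃ s : ℕ → ℕ, Computable s ∧ ∀ n, ν (s n) = (ν n)⁻¹

/-- A name of an element of `K⟨x,y,z⟩`: a list of monomials (words in `x, y, z`) with names of
their coefficients. -/
abbrev Code : Type := List (List (Fin 3) × ℕ)

/-- The polynomial with a given name. -/
noncomputable def evalCode {K : Type*} [Field K] (C : Constructivization K) (c : Code) : A K :=
  (c.map fun m => C.ν m.2 • (m.1.map (FreeAlgebra.ι K)).prod).sum

/-- The `z`-endomorphism `(f, g)` given by names of `f` and `g`. -/
noncomputable def evalPair {K : Type*} [Field K] (C : Constructivization K) (c : Code × Code) :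
    A K × A K :=
  (evalCode C c.1, evalCode C c.2)

/-- Perform at most `n` passes, each of which either answers or gives the next datum. -/
def run {α : Type*} (pass : α → Bool ⊕ α) : ℕ → α → Bool ⊕ α
  | 0, a => Sum.inr a
  | n + 1, a => match pass a with
    | Sum.inl b => Sum.inl b
    | Sum.inr a' => run pass n a'

end ZTame

/-! Everything rests on how leading components behave under `q ↦ q(g,z)` for `q ∈ K⟨y,z⟩` and `g ∉
K[z]`. In the coordinates of `H_n` over `K[t_0,…,t_n]`, a product of homogeneous elements is a
product of polynomials whose variable sets overlap in a single `t`. Since polynomial rings are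
domains, substitution into a nonzero homogeneous element of positive degree in `x, y` is injective
(`eq_zero_of_substHom_eq_zero`). Hence the leading component of `q(g,z)` is that of `q` evaluated at
that of `g`, and its bidegree `tau (bideg g) (bideg q)` is strictly monotone in `bideg q`
(`lead_substHom`, `tau_lt_tau`).

It follows that an expression of `lead f` through `lead g` is unique up to rescaling and
bihomogeneous. So a pass has one outcome, and each replacement lowers the bidegree of the component
it changes; pairs of bidegrees are well-ordered lexicographically, which gives termination.

A replacement is composition with an elementary tame automorphism, so it respects tameness. The
answer "yes" is given at pairs of independent linear forms modulo `K[z]`, which are visibly tame.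
For "no" it must be shown that a tame pair is never rejected. Every tame automorphism has a normal
form (`TamePair`): a linear pair, or a linear image of a `GrownPair`, built by alternately adding to
one component a polynomial of bidegree above `(1,0)` in the other. The normal form survives
multiplication by generators and their inverses (`tamePair_of_mem_tameGroup`). The component of a
grown pair changed last has the larger bidegree, and its leading component is a polynomial in the
other leading component, so a reduction applies (`TamePair.not_rejected`).

Effectiveness comes from duality instead of division of polynomials. Either some `q` witnesses `u =
q(v,z)`, or a linear functional vanishes on all `s(v,z)`, `s` a word in `y, z`, but not on `u`. Both
kinds of certificate are finite and checkable for leading components, one always exists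
(`exists_cert`), and unbounded search finds it. -/

namespace ZTame

/-! ### Words as a basis of the free algebra, and subspaces cut out by sets of words. -/

section Words

variable {K : Type*} [Field K]

/-- The monomial of `K⟨x,y,z⟩` given by a word. -/
noncomputable def ofWord (K : Type*) [Field K] : FreeMonoid (Fin 3) →* A K :=
  FreeMonoid.lift (FreeAlgebra.ι K)

@[simp] lemma ofWord_of (i : Fin 3) : ofWord K (FreeMonoid.of i) = FreeAlgebra.ι K i := by
  simp [ofWord]

lemma equiv_ofWord (w : FreeMonoid (Fin 3)) :
    FreeAlgebra.equivMonoidAlgebraFreeMonoid (ofWord K w) = MonoidAlgebra.single w 1 := by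
  have h : (FreeAlgebra.equivMonoidAlgebraFreeMonoid (R := K) (X := Fin 3)).toAlgHom.toMonoidHom.comp
      (ofWord K) = MonoidAlgebra.of K (FreeMonoid (Fin 3)) := by
    apply FreeMonoid.hom_eq
    intro i
    simp [FreeAlgebra.equivMonoidAlgebraFreeMonoid]
  exact DFunLike.congr_fun h w

@[simp] lemma coeffs_ofWord (w : FreeMonoid (Fin 3)) :
    coeffs (ofWord K w) = Finsupp.single w 1 := by
  rw [coeffs, equiv_ofWord]; rfl

@[simp] lemma coeffs_zero : coeffs (0 : A K) = 0 := by simp [coeffs]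

@[simp] lemma coeffs_add (p q : A K) : coeffs (p + q) = coeffs p + coeffs q := by simp [coeffs]

@[simp] lemma coeffs_smul (c : K) (p : A K) : coeffs (c • p) = c • coeffs p := by simp [coeffs]

/-- The coefficients as a linear equivalence. -/
noncomputable def coeffsEquiv (K : Type*) [Field K] : A K ≃ₗ[K] (FreeMonoid (Fin 3) →₀ K) where
  toFun := coeffs
  map_add' := coeffs_add
  map_smul' := coeffs_smul
  invFun f := FreeAlgebra.equivMonoidAlgebraFreeMonoid.symm (MonoidAlgebra.ofCoeff f)
  left_inv p := by simp [coeffs, MonoidAlgebra.ofCoeff_coeff]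
  right_inv f := by simp [coeffs, MonoidAlgebra.coeff_ofCoeff]

@[simp] lemma coeffsEquiv_apply (p : A K) : coeffsEquiv K p = coeffs p := rfl

@[simp] lemma coeffs_sub (p q : A K) : coeffs (p - q) = coeffs p - coeffs q :=
  map_sub (coeffsEquiv K) p q

lemma coeffs_sum {ι : Type*} (s : Finset ι) (f : ι → A K) :
    coeffs (∑ i ∈ s, f i) = ∑ i ∈ s, coeffs (f i) := map_sum (coeffsEquiv K) f s

lemma coeffs_injective : Function.Injective (coeffs : A K → _) := (coeffsEquiv K).injective

lemma ext_coeffs {p q : A K} (h : ∀ w, coeffs p w = coeffs q w) : p = q :=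
  coeffs_injective (Finsupp.ext h)

lemma eq_sum_coeffs (p : A K) : p = (coeffs p).sum fun w c => c • ofWord K w := by
  apply coeffs_injective
  rw [Finsupp.sum, coeffs_sum]
  conv_lhs => rw [← Finsupp.sum_single (coeffs p)]
  simp [Finsupp.sum]

/-- The polynomials all of whose monomials belong to `S`. -/
noncomputable def inWords (K : Type*) [Field K] (S : Set (FreeMonoid (Fin 3))) :
    Submodule K (A K) :=
  (Finsupp.supported K K S).comap (coeffsEquiv K).toLinearMap

lemma mem_inWords {S : Set (FreeMonoid (Fin 3))} {p : A K} :
    p ∈ inWords K S ↔ ∀ w, coeffs p w ≠ 0 → w ∈ S := by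
  simp [inWords, Finsupp.mem_supported, Set.subset_def]

lemma inWords_mono {S T : Set (FreeMonoid (Fin 3))} (h : S ⊆ T) : inWords K S ≤ inWords K T :=
  fun _ hp => mem_inWords.2 fun w hw => h (mem_inWords.1 hp w hw)

lemma ofWord_mem_inWords {S : Set (FreeMonoid (Fin 3))} {w : FreeMonoid (Fin 3)} (h : w ∈ S) :
    ofWord K w ∈ inWords K S := by
  rw [mem_inWords]
  intro v hv
  have : w = v := by
    by_contra h'
    exact hv (by simp [h'])
  rwa [← this]

lemma ofWord_mem_inWords_iff {S : Set (FreeMonoid (Fin 3))} {w : FreeMonoid (Fin 3)} :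
    ofWord K w ∈ inWords K S ↔ w ∈ S :=
  ⟨fun h => mem_inWords.1 h w (by simp), ofWord_mem_inWords⟩

lemma inWords_eq_span (S : Set (FreeMonoid (Fin 3))) :
    inWords K S = Submodule.span K (ofWord K '' S) := by
  apply le_antisymm
  · intro p hp
    rw [eq_sum_coeffs p]
    exact Submodule.sum_mem _ fun w hw => Submodule.smul_mem _ _
      (Submodule.subset_span ⟨w, mem_inWords.1 hp w (Finsupp.mem_support_iff.1 hw), rfl⟩)
  · rw [Submodule.span_le]
    rintro _ ⟨w, hw, rfl⟩
    exact ofWord_mem_inWords hw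

lemma mul_mem_inWords {S T U : Set (FreeMonoid (Fin 3))} (h : ∀ a ∈ S, ∀ b ∈ T, a * b ∈ U)
    {p q : A K} (hp : p ∈ inWords K S) (hq : q ∈ inWords K T) : p * q ∈ inWords K U := by
  rw [inWords_eq_span] at hp hq
  have := Submodule.mul_mem_mul hp hq
  rw [Submodule.span_mul_span] at this
  refine (Submodule.span_le.2 ?_) this
  rintro _ ⟨_, ⟨a, ha, rfl⟩, _, ⟨b, hb, rfl⟩, rfl⟩
  change ofWord K a * ofWord K b ∈ _
  rw [← map_mul]
  exact ofWord_mem_inWords (h a ha b hb)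

/-- Polynomials in the letters of a set `L`. -/
lemma mem_adjoin_letters {L : Set (Fin 3)} {p : A K} :
    p ∈ Algebra.adjoin K (FreeAlgebra.ι K '' L) ↔
      p ∈ inWords K {w | ∀ i ∈ w.toList, i ∈ L} := by
  constructor
  · intro hp
    induction hp using Algebra.adjoin_induction with
    | mem x hx =>
      obtain ⟨i, hi, rfl⟩ := hx
      rw [← ofWord_of]
      exact ofWord_mem_inWords (by simpa using hi)
    | algebraMap r =>
      rw [Algebra.algebraMap_eq_smul_one, ← map_one (ofWord K)]
      exact Submodule.smul_mem _ _ (ofWord_mem_inWords (by simp))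
    | add x y _ _ hx hy => exact Submodule.add_mem _ hx hy
    | mul x y _ _ hx hy =>
      refine mul_mem_inWords ?_ hx hy
      intro a ha b hb i hi
      rw [FreeMonoid.toList_mul, List.mem_append] at hi
      exact hi.elim (ha i) (hb i)
  · intro hp
    rw [inWords_eq_span] at hp
    refine (Submodule.span_le (p := (Algebra.adjoin K (FreeAlgebra.ι K '' L)).toSubmodule)).2 ?_ hp
    rintro _ ⟨w, hw, rfl⟩
    change ofWord K w ∈ Algebra.adjoin K _
    induction w using FreeMonoid.inductionOn' with
    | one => simp
    | of_mul i w ih =>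
      rw [map_mul, ofWord_of]
      refine Subalgebra.mul_mem _ (Algebra.subset_adjoin ⟨i, hw i (by simp), rfl⟩) (ih ?_)
      intro j hj
      exact hw j (by simp [hj])

lemma mem_algZ {p : A K} : p ∈ algZ K ↔ p ∈ inWords K {w | ∀ i ∈ w.toList, i = 2} := by
  have : algZ K = Algebra.adjoin K (FreeAlgebra.ι K '' {2}) := by simp [algZ, Z]
  rw [this, mem_adjoin_letters]; rfl

lemma mem_algYZ {p : A K} : p ∈ algYZ K ↔ p ∈ inWords K {w | ∀ i ∈ w.toList, i ≠ 0} := by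
  have : algYZ K = Algebra.adjoin K (FreeAlgebra.ι K '' {1, 2}) := by
    simp [algYZ, Y, Z, Set.image_pair]
  rw [this, mem_adjoin_letters]
  have h : ∀ i : Fin 3, (i ∈ ({1, 2} : Set (Fin 3))) ↔ i ≠ 0 := by
    intro i; fin_cases i <;> simp
  simp [h]

lemma algZ_le_algYZ : algZ K ≤ algYZ K :=
  Algebra.adjoin_mono (by simp)

lemma Z_mem_algZ : Z K ∈ algZ K := Algebra.subset_adjoin rfl

lemma Y_mem_algYZ : Y K ∈ algYZ K := Algebra.subset_adjoin (by simp)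

lemma Z_mem_algYZ : Z K ∈ algYZ K := Algebra.subset_adjoin (by simp)

lemma X_eq_ofWord : X K = ofWord K (FreeMonoid.of 0) := by simp [X]

lemma Y_eq_ofWord : Y K = ofWord K (FreeMonoid.of 1) := by simp [Y]

lemma Z_eq_ofWord : Z K = ofWord K (FreeMonoid.of 2) := by simp [Z]

end Words

/-! ### Bidegree and leading components. -/

section Bidegree

variable {K : Type*} [Field K]

@[simp] lemma xyDeg_one : xyDeg 1 = 0 := by simp [xyDeg]

@[simp] lemma xyDeg_mul (v w : FreeMonoid (Fin 3)) : xyDeg (v * w) = xyDeg v + xyDeg w := by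
  simp [xyDeg, List.count_append]; ring

@[simp] lemma wordBideg_one : wordBideg 1 = 0 := by simp [wordBideg]

@[simp] lemma wordBideg_mul (v w : FreeMonoid (Fin 3)) :
    wordBideg (v * w) = wordBideg v + wordBideg w := by
  simp [wordBideg, List.count_append, ← toLex_add]

lemma H_eq (n : ℕ) : H K n = inWords K {w | xyDeg w = n} := by
  ext p; rw [mem_inWords]; rfl

/-- The polynomials that are bihomogeneous of bidegree `b`. -/
noncomputable abbrev homB (K : Type*) [Field K] (b : ℕ ×ₗ ℕ) : Submodule K (A K) :=
  inWords K {w | wordBideg w = b}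

/-- The polynomials all of whose monomials have bidegree less than `b`. -/
noncomputable abbrev ltB (K : Type*) [Field K] (b : ℕ ×ₗ ℕ) : Submodule K (A K) :=
  inWords K {w | wordBideg w < b}

lemma le_bideg {p : A K} {w : FreeMonoid (Fin 3)} (h : coeffs p w ≠ 0) : wordBideg w ≤ bideg p :=
  Finset.le_sup (f := wordBideg) (Finsupp.mem_support_iff.2 h)

lemma bideg_le {p : A K} {b : ℕ ×ₗ ℕ} (h : ∀ w, coeffs p w ≠ 0 → wordBideg w ≤ b) :
    bideg p ≤ b :=
  Finset.sup_le fun w hw => h w (Finsupp.mem_support_iff.1 hw)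

lemma coeffs_lead (p : A K) :
    coeffs (lead p) = (coeffs p).filter fun w => wordBideg w = bideg p := by
  simp [lead, coeffs, MonoidAlgebra.coeff_ofCoeff]

lemma coeffs_lead_apply (p : A K) (w : FreeMonoid (Fin 3)) :
    coeffs (lead p) w = if wordBideg w = bideg p then coeffs p w else 0 := by
  rw [coeffs_lead, Finsupp.filter_apply]

lemma lead_mem_homB (p : A K) : lead p ∈ homB K (bideg p) := by
  rw [mem_inWords]
  intro w hw
  by_contra h
  exact hw ((coeffs_lead_apply p w).trans (if_neg h))

lemma sub_lead_mem_ltB (p : A K) : p - lead p ∈ ltB K (bideg p) := by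
  rw [mem_inWords]
  intro w hw
  by_cases h : wordBideg w = bideg p
  · exact absurd (by rw [coeffs_sub, Finsupp.sub_apply, coeffs_lead_apply,
      if_pos h, sub_self]) hw
  · refine lt_of_le_of_ne (le_bideg ?_) h
    rwa [coeffs_sub, Finsupp.sub_apply, coeffs_lead_apply, if_neg h, sub_zero] at hw

lemma exists_coeffs_ne_zero {p : A K} (h : p ≠ 0) : ∃ w, coeffs p w ≠ 0 := by
  by_contra! h'
  exact h (ext_coeffs fun w => by simp [h' w])

lemma exists_wordBideg_eq {p : A K} (h : p ≠ 0) : ∃ w, coeffs p w ≠ 0 ∧ wordBideg w = bideg p := by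
  obtain ⟨v, hv⟩ := exists_coeffs_ne_zero h
  obtain ⟨w, hw, h'⟩ := Finset.exists_mem_eq_sup (coeffs p).support
    ⟨v, Finsupp.mem_support_iff.2 hv⟩ wordBideg
  exact ⟨w, Finsupp.mem_support_iff.1 hw, h'.symm⟩

lemma lead_ne_zero {p : A K} (h : p ≠ 0) : lead p ≠ 0 := by
  obtain ⟨w, hw, hb⟩ := exists_wordBideg_eq h
  intro h0
  have := congrArg (fun q => coeffs q w) h0
  simp only [coeffs_lead_apply, if_pos hb] at this
  exact hw (by simpa using this)

/-- The leading component is determined by a decomposition into a bihomogeneous polynomial and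
lower terms. -/
lemma bideg_lead_of_decomp {p u : A K} {b : ℕ ×ₗ ℕ} (hu : u ∈ homB K b) (hu0 : u ≠ 0)
    (h : p - u ∈ ltB K b) : bideg p = b ∧ lead p = u := by
  have key : ∀ w, wordBideg w = b → coeffs p w = coeffs u w := by
    intro w hw
    by_contra hne
    have := mem_inWords.1 h w (by rw [coeffs_sub, Finsupp.sub_apply]; exact sub_ne_zero.2 hne)
    exact absurd hw this.ne
  have hb : bideg p = b := by
    apply le_antisymm
    · refine bideg_le fun w hw => ?_
      by_cases hw' : coeffs u w = 0
      · have : coeffs (p - u) w ≠ 0 := by simpa [hw'] using hw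
        exact (mem_inWords.1 h w this).le
      · exact (mem_inWords.1 hu w hw').le
    · obtain ⟨w, hw⟩ := exists_coeffs_ne_zero hu0
      have hwb : wordBideg w = b := mem_inWords.1 hu w hw
      rw [← hwb]
      exact le_bideg (by rwa [key w hwb])
  refine ⟨hb, ext_coeffs fun w => ?_⟩
  rw [coeffs_lead_apply, hb]
  by_cases hw : wordBideg w = b
  · rw [if_pos hw, key w hw]
  · rw [if_neg hw]
    by_contra h0
    exact hw (mem_inWords.1 hu w (Ne.symm h0))

lemma lead_of_mem_homB {u : A K} {b : ℕ ×ₗ ℕ} (hu : u ∈ homB K b) (hu0 : u ≠ 0) :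
    bideg u = b ∧ lead u = u :=
  bideg_lead_of_decomp hu hu0 (by simp)

/-- The case `q = 0` is listed separately because the zero polynomial has the default bidegree
`(0,0)`, which need not lie below `bideg p`. -/
lemma bideg_lead_add_of_lt {p q : A K} (hp : p ≠ 0) (h : q = 0 ∨ bideg q < bideg p) :
    bideg (p + q) = bideg p ∧ lead (p + q) = lead p := by
  rcases h with rfl | h
  · simp
  refine bideg_lead_of_decomp (lead_mem_homB p) (lead_ne_zero hp) ?_
  have : p + q - lead p = (p - lead p) + q := by abel
  rw [this]
  refine Submodule.add_mem _ (sub_lead_mem_ltB p) (mem_inWords.2 fun w hw => ?_)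
  exact (le_bideg hw).trans_lt h

lemma bideg_lead_smul {c : K} (hc : c ≠ 0) (p : A K) :
    bideg (c • p) = bideg p ∧ lead (c • p) = c • lead p := by
  by_cases hp : p = 0
  · subst hp
    have : lead (0 : A K) = 0 := by
      refine ext_coeffs fun w => ?_; simp [coeffs_lead_apply]
    simp [this]
  refine bideg_lead_of_decomp (Submodule.smul_mem _ _ (lead_mem_homB p))
    (smul_ne_zero hc (lead_ne_zero hp)) ?_
  rw [← smul_sub]
  exact Submodule.smul_mem _ _ (sub_lead_mem_ltB p)

/-- Positivity of `b` takes care of `p = 0`, whose bidegree is `(0,0)` by default. -/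
lemma bideg_ltB {p : A K} {b : ℕ ×ₗ ℕ} (hb : 0 < b) (h : p ∈ ltB K b) : bideg p < b := by
  by_cases hp : p = 0
  · subst hp
    have : bideg (0 : A K) = 0 := by simp [bideg]; rfl
    rwa [this]
  · obtain ⟨w, hw, h'⟩ := exists_wordBideg_eq hp
    rw [← h']
    exact mem_inWords.1 h w hw

lemma mul_mem_homB {p q : A K} {a b : ℕ ×ₗ ℕ} (hp : p ∈ homB K a) (hq : q ∈ homB K b) :
    p * q ∈ homB K (a + b) :=
  mul_mem_inWords (by rintro v rfl w rfl; simp) hp hq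

lemma xyDeg_eq_zero_iff {w : FreeMonoid (Fin 3)} : xyDeg w = 0 ↔ ∀ i ∈ w.toList, i = 2 := by
  simp only [xyDeg, Nat.add_eq_zero_iff, List.count_eq_zero]
  constructor
  · rintro ⟨h0, h1⟩ i hi
    fin_cases i <;> simp_all
  · intro h
    constructor
    · intro h'; simpa using h _ h'
    · intro h'; simpa using h _ h'

lemma toLex_le_iff {a b c d : ℕ} : toLex (a, b) ≤ toLex (c, d) ↔ a < c ∨ a = c ∧ b ≤ d := by
  simp [Prod.Lex.le_iff]

lemma toLex_lt_iff {a b c d : ℕ} : toLex (a, b) < toLex (c, d) ↔ a < c ∨ a = c ∧ b < d := by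
  simp [Prod.Lex.lt_iff]

/-- Lying below `(1,0)` means having degree zero in `x, y`, whatever the degree in `z`; the default
bidegree of zero is consistent with this. Thus the comparisons in the procedure also encode
membership in `K[z]`. -/
lemma mem_algZ_iff_bideg {p : A K} : p ∈ algZ K ↔ bideg p < toLex (1, 0) := by
  have h1 : ∀ w, (∀ i ∈ FreeMonoid.toList w, i = 2) ↔ wordBideg w < toLex (1, 0) := by
    intro w
    rw [← xyDeg_eq_zero_iff, wordBideg, toLex_lt_iff]; omega
  rw [mem_algZ]
  constructor
  · intro h
    exact bideg_ltB (by decide) (inWords_mono (fun w hw => (h1 w).1 hw) h)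
  · intro h
    refine mem_inWords.2 fun w hw => (h1 w).2 ((le_bideg hw).trans_lt h)

lemma one_zero_le_bideg {p : A K} : p ∉ algZ K ↔ toLex (1, 0) ≤ bideg p := by
  rw [mem_algZ_iff_bideg, not_lt]

lemma ne_zero_of_notMem_algZ {p : A K} (h : p ∉ algZ K) : p ≠ 0 := by
  rintro rfl; exact h (Subalgebra.zero_mem _)

lemma homB_le_H (b : ℕ ×ₗ ℕ) : homB K b ≤ H K (ofLex b).1 := by
  rw [H_eq]
  refine inWords_mono ?_
  rintro w rfl
  rfl

lemma lead_mem_algYZ {q : A K} (h : q ∈ algYZ K) : lead q ∈ algYZ K := by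
  rw [mem_algYZ, mem_inWords] at h ⊢
  intro w hw
  apply h w
  intro h0
  exact hw (by simp [coeffs_lead_apply, h0])

end Bidegree


/-! ### Coordinates of `H_n` over `K[t_0,…,t_n]`, and substitution in coordinates. -/

section Coordinates

variable {K : Type*} [Field K]

open FreeMonoid (of)

/-- The word `u_1 z^{a_1} ⋯ u_n z^{a_n}`. -/
def zTail {n : ℕ} (u : Fin n → Fin 2) (a : Fin n → ℕ) : FreeMonoid (Fin 3) :=
  (List.ofFn fun i : Fin n => of (u i).castSucc * of 2 ^ a i).prod

/-- The word `z^{a_0} u_1 z^{a_1} ⋯ u_n z^{a_n}`. -/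
def zW {n : ℕ} (u : Fin n → Fin 2) (a : Fin (n + 1) → ℕ) : FreeMonoid (Fin 3) :=
  of 2 ^ a 0 * zTail u fun i => a i.succ

lemma zWord_eq_ofWord {n : ℕ} (u : Fin n → Fin 2) (a : Fin (n + 1) →₀ ℕ) :
    zWord u a = ofWord K (zW u a) := by
  simp [zWord, zW, zTail, Z, List.map_ofFn, Function.comp_def, map_list_prod]

lemma zW_succ {n : ℕ} (u : Fin (n + 1) → Fin 2) (a : Fin (n + 2) → ℕ) :
    zW u a = of 2 ^ a 0 * (of (u 0).castSucc * zW (fun i => u i.succ) fun i => a i.succ) := by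
  simp [zW, zTail, List.ofFn_succ, mul_assoc]

/-- A word is read from the left: the initial run of `z`, the first letter other than `z`, and the
remainder are all determined. Iterating this gives the uniqueness of the exponents in
`zW_injective`. -/
lemma pow_mul_of_mul_inj {i j : Fin 3} (hi : i ≠ 2) (hj : j ≠ 2) {r s : FreeMonoid (Fin 3)} :
    ∀ {a b : ℕ}, (of 2 ^ a * (of i * r) : FreeMonoid (Fin 3)) = of 2 ^ b * (of j * s) →
      a = b ∧ i = j ∧ r = s := by
  intro a
  induction a with
  | zero =>
    rintro (_ | b) h
    · have := congrArg FreeMonoid.toList h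
      simpa using this
    · have := congrArg FreeMonoid.toList h
      simp [pow_succ', hi] at this
  | succ a ih =>
    rintro (_ | b) h
    · have := congrArg FreeMonoid.toList h
      simp [pow_succ', hj.symm] at this
    · rw [pow_succ', pow_succ', mul_assoc, mul_assoc] at h
      obtain ⟨h1, h2⟩ := ih (mul_left_cancel h)
      exact ⟨by rw [h1], h2⟩

lemma zW_injective : ∀ {n : ℕ} {u u' : Fin n → Fin 2} {a a' : Fin (n + 1) → ℕ},
    zW u a = zW u' a' → u = u' ∧ a = a' := by
  intro n
  induction n with
  | zero =>
    intro u u' a a' h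
    refine ⟨Subsingleton.elim _ _, funext fun i => ?_⟩
    have := congrArg FreeMonoid.length h
    simp only [zW, zTail, List.ofFn_zero, List.prod_nil, mul_one] at this
    have hl : ∀ m : ℕ, FreeMonoid.length (of (2 : Fin 3) ^ m) = m := by
      intro m
      induction m with
      | zero => simp
      | succ m ih => rw [pow_succ, FreeMonoid.length_mul, ih]; simp
    rw [hl, hl] at this
    obtain rfl : i = 0 := by omega
    exact this
  | succ n ih =>
    intro u u' a a' h
    rw [zW_succ, zW_succ] at h
    have hne : ∀ i : Fin 2, i.castSucc ≠ (2 : Fin 3) := by decide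
    obtain ⟨h0, h1, h2⟩ := pow_mul_of_mul_inj (hne _) (hne _) h
    obtain ⟨h3, h4⟩ := ih h2
    constructor
    · funext i
      refine Fin.cases ?_ (fun j => congrFun h3 j) i
      simpa using h1
    · funext i
      exact Fin.cases h0 (fun j => congrFun h4 j) i

lemma exists_zW_eq (w : FreeMonoid (Fin 3)) : ∀ {n : ℕ}, xyDeg w = n →
    ∃ (u : Fin n → Fin 2) (a : Fin (n + 1) → ℕ), zW u a = w := by
  induction w using FreeMonoid.inductionOn' with
  | one => rintro n rfl; exact ⟨Fin.elim0, fun _ => 0, by simp [zW, zTail]⟩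
  | of_mul i w ih =>
    intro n hn
    rw [xyDeg_mul] at hn
    have hxy : ∀ j : Fin 2, xyDeg (of (j.castSucc : Fin 3)) = 1 := by decide
    have key : ∀ j : Fin 2, i = j.castSucc →
        ∃ (u : Fin n → Fin 2) (a : Fin (n + 1) → ℕ), zW u a = of i * w := by
      rintro j rfl
      rw [hxy] at hn
      obtain ⟨m, rfl⟩ : ∃ m, n = m + 1 := ⟨xyDeg w, by omega⟩
      obtain ⟨u, a, rfl⟩ := ih (n := m) (by omega)
      exact ⟨Fin.cons j u, Fin.cons 0 a, by simp [zW_succ]⟩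
    by_cases h0 : i = 0
    · exact key 0 h0
    by_cases h1 : i = 1
    · exact key 1 h1
    obtain rfl : i = 2 := by omega
    have h2 : xyDeg (of (2 : Fin 3)) = 0 := by decide
    obtain ⟨u, a, rfl⟩ := ih (n := n) (by omega)
    refine ⟨u, Fin.cons (a 0 + 1) fun i => a i.succ, ?_⟩
    simp [zW, pow_succ', mul_assoc]

lemma xyDeg_zTail : ∀ {n : ℕ} (u : Fin n → Fin 2) (a : Fin n → ℕ), xyDeg (zTail u a) = n := by
  have h2 : ∀ m : ℕ, xyDeg (of (2 : Fin 3) ^ m) = 0 := by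
    intro m
    induction m with
    | zero => simp
    | succ m ih => rw [pow_succ, xyDeg_mul, ih]; decide
  have hxy : ∀ j : Fin 2, xyDeg (of (j.castSucc : Fin 3)) = 1 := by decide
  intro n
  induction n with
  | zero => intro u a; simp [zTail]
  | succ n ih =>
    intro u a
    have := ih (fun i => u i.succ) fun i => a i.succ
    rw [zTail] at this
    rw [zTail, List.ofFn_succ, List.prod_cons, xyDeg_mul, this, xyDeg_mul, h2, hxy]
    ring

lemma xyDeg_zW {n : ℕ} (u : Fin n → Fin 2) (a : Fin (n + 1) → ℕ) : xyDeg (zW u a) = n := by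
  have h2 : ∀ m : ℕ, xyDeg (of (2 : Fin 3) ^ m) = 0 := by
    intro m
    induction m with
    | zero => simp
    | succ m ih => rw [pow_succ, xyDeg_mul, ih]; decide
  rw [zW, xyDeg_mul, h2, xyDeg_zTail, zero_add]

lemma zWord_mem_H {n : ℕ} (u : Fin n → Fin 2) (a : Fin (n + 1) →₀ ℕ) :
    (zWord u a : A K) ∈ H K n := by
  rw [zWord_eq_ofWord, H_eq]
  exact ofWord_mem_inWords (xyDeg_zW u a)

lemma coeffs_act {n : ℕ} (P : MvPolynomial (Fin (n + 1)) K) (u u' : Fin n → Fin 2)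
    (a : Fin (n + 1) →₀ ℕ) :
    coeffs (act P u) (zW u' a) = if u = u' then P.coeff a else 0 := by
  classical
  have h : ∀ b : Fin (n + 1) →₀ ℕ, zW u b = zW u' a ↔ u = u' ∧ b = a :=
    fun b => ⟨fun h => ⟨(zW_injective h).1, DFunLike.coe_injective (zW_injective h).2⟩,
      by rintro ⟨rfl, rfl⟩; rfl⟩
  simp only [act, coeffs_sum, coeffs_smul, zWord_eq_ofWord, coeffs_ofWord, Finsupp.coe_finsetSum,
    Finset.sum_apply, Finsupp.smul_apply, Finsupp.single_apply, h]
  by_cases hu : u = u'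
  · simp only [hu, true_and, smul_eq_mul, mul_ite, mul_one, mul_zero, if_true,
      Finset.sum_ite_eq', MvPolynomial.mem_support_iff]
    by_cases h0 : P.coeff a = 0 <;> simp [h0]
  · simp [hu]

lemma act_mem_H {n : ℕ} (P : MvPolynomial (Fin (n + 1)) K) (u : Fin n → Fin 2) :
    act P u ∈ H K n :=
  Submodule.sum_mem _ fun a _ => Submodule.smul_mem _ _ (zWord_mem_H u a)

lemma ofCoords_mem_H {n : ℕ} (Θ : (Fin n → Fin 2) → MvPolynomial (Fin (n + 1)) K) :
    ofCoords Θ ∈ H K n :=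
  Submodule.sum_mem _ fun u _ => act_mem_H _ u

/-- The words of degree `n` in `x, y` are exactly the `zW u a`, so identities in `H_n` can be tested
on the coefficients indexed by `(u, a)`. -/
lemma ext_zW {n : ℕ} {p q : A K} (hp : p ∈ H K n) (hq : q ∈ H K n)
    (h : ∀ (u : Fin n → Fin 2) (a : Fin (n + 1) →₀ ℕ), coeffs p (zW u a) = coeffs q (zW u a)) :
    p = q := by
  refine ext_coeffs fun w => ?_
  by_cases hw : xyDeg w = n
  · obtain ⟨u, a, rfl⟩ := exists_zW_eq w hw
    simpa using h u (Finsupp.equivFunOnFinite.symm a)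
  · have h1 : coeffs p w = 0 := by_contra fun h => hw (hp w h)
    have h2 : coeffs q w = 0 := by_contra fun h => hw (hq w h)
    rw [h1, h2]

lemma act_add {n : ℕ} (P Q : MvPolynomial (Fin (n + 1)) K) (u : Fin n → Fin 2) :
    act (P + Q) u = act P u + act Q u := by
  refine ext_zW (act_mem_H _ u) (Submodule.add_mem _ (act_mem_H _ u) (act_mem_H _ u)) ?_
  intro u' a
  rw [coeffs_add, Finsupp.add_apply, coeffs_act, coeffs_act, coeffs_act]
  split_ifs <;> simp

lemma act_monomial {n : ℕ} (a : Fin (n + 1) →₀ ℕ) (c : K) (u : Fin n → Fin 2) :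
    act (MvPolynomial.monomial a c) u = c • zWord u a := by
  classical
  refine ext_zW (act_mem_H _ u) (Submodule.smul_mem _ _ (zWord_mem_H u a)) ?_
  intro u' b
  have h : zW u a = zW u' b ↔ u = u' ∧ a = b :=
    ⟨fun h => ⟨(zW_injective h).1, DFunLike.coe_injective (zW_injective h).2⟩,
      by rintro ⟨rfl, rfl⟩; rfl⟩
  rw [coeffs_act, coeffs_smul, zWord_eq_ofWord, coeffs_ofWord, Finsupp.smul_apply,
    Finsupp.single_apply, MvPolynomial.coeff_monomial]
  simp only [h]
  by_cases h1 : u = u' <;> by_cases h2 : a = b <;> simp [h1, h2]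

lemma act_C_mul {n : ℕ} (c : K) (P : MvPolynomial (Fin (n + 1)) K) (u : Fin n → Fin 2) :
    act (MvPolynomial.C c * P) u = c • act P u := by
  refine ext_zW (act_mem_H _ u) (Submodule.smul_mem _ _ (act_mem_H _ u)) ?_
  intro u' a
  rw [coeffs_smul, Finsupp.smul_apply, coeffs_act, coeffs_act, MvPolynomial.coeff_C_mul]
  split_ifs <;> simp

lemma act_zero {n : ℕ} (u : Fin n → Fin 2) : act (0 : MvPolynomial (Fin (n + 1)) K) u = 0 := by
  simp [act]

lemma coeffs_ofCoords {n : ℕ} (Θ : (Fin n → Fin 2) → MvPolynomial (Fin (n + 1)) K)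
    (u : Fin n → Fin 2) (a : Fin (n + 1) →₀ ℕ) :
    coeffs (ofCoords Θ) (zW u a) = (Θ u).coeff a := by
  rw [ofCoords, coeffs_sum, Finsupp.finsetSum_apply]
  simp_rw [coeffs_act]
  simp

lemma ofCoords_injective (n : ℕ) : Function.Injective
    (ofCoords : ((Fin n → Fin 2) → MvPolynomial (Fin (n + 1)) K) → A K) := by
  intro Θ Θ' h
  funext u
  ext a
  rw [← coeffs_ofCoords, h, coeffs_ofCoords]

lemma range_ofCoords (n : ℕ) : Set.range
    (ofCoords : ((Fin n → Fin 2) → MvPolynomial (Fin (n + 1)) K) → A K) = H K n := by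
  apply Set.Subset.antisymm
  · rintro _ ⟨Θ, rfl⟩
    exact ofCoords_mem_H Θ
  · intro p hp
    -- As the range of a linear map, the set of all `ofCoords Θ` is a subspace, so it suffices to
    -- reach each single word.
    let L : ((Fin n → Fin 2) → MvPolynomial (Fin (n + 1)) K) →ₗ[K] A K :=
      { toFun := ofCoords
        map_add' := fun Θ Θ' => by simp [ofCoords, act_add, Finset.sum_add_distrib]
        map_smul' := fun c Θ => by
          simp [ofCoords, MvPolynomial.smul_eq_C_mul, act_C_mul, Finset.smul_sum] }
    change p ∈ LinearMap.range L
    rw [SetLike.mem_coe, H_eq, inWords_eq_span] at hp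
    refine Submodule.span_le.2 ?_ hp
    rintro _ ⟨w, hw, rfl⟩
    obtain ⟨u, a, rfl⟩ := exists_zW_eq w hw
    refine ⟨Pi.single u (MvPolynomial.monomial (Finsupp.equivFunOnFinite.symm a) 1), ?_⟩
    change ofCoords _ = _
    rw [ofCoords, Finset.sum_eq_single u]
    · simp [act_monomial, zWord_eq_ofWord]
    · intro v _ hv
      simp [hv, act_zero]
    · simp

lemma zTail_const_mem_iff {n : ℕ} (u : Fin n → Fin 2) (a : Fin (n + 1) → ℕ) :
    (∀ i ∈ (zW u a).toList, i ≠ 0) ↔ u = fun _ => 1 := by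
  induction n with
  | zero =>
    refine ⟨fun _ => Subsingleton.elim _ _, fun _ i hi => ?_⟩
    simp only [zW, zTail, List.ofFn_zero, List.prod_nil, mul_one] at hi
    have : ∀ m : ℕ, i ∈ FreeMonoid.toList (of (2 : Fin 3) ^ m) → i = 2 := by
      intro m
      induction m with
      | zero => simp
      | succ m ih => rw [pow_succ]; simp; tauto
    rw [this _ hi]; decide
  | succ n ih =>
    have h2 : ∀ m : ℕ, ∀ i ∈ FreeMonoid.toList (of (2 : Fin 3) ^ m), i ≠ 0 := by
      intro m
      induction m with
      | zero => simp
      | succ m ih =>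
        intro i hi
        rw [pow_succ, FreeMonoid.toList_mul, List.mem_append] at hi
        rcases hi with hi | hi
        · exact ih i hi
        · simp at hi; rw [hi]; decide
    have h01 : ∀ j : Fin 2, j.castSucc ≠ (0 : Fin 3) ↔ j = 1 := by decide
    rw [zW_succ]
    simp only [FreeMonoid.toList_mul, List.mem_append, FreeMonoid.toList_of, List.mem_singleton]
    have := ih (fun i => u i.succ) fun i => a i.succ
    constructor
    · intro h
      have hu := this.1 fun i hi => h i (Or.inr (Or.inr hi))
      funext i
      exact Fin.cases ((h01 _).1 (h _ (Or.inr (Or.inl rfl)))) (fun j => congrFun hu j) i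
    · rintro rfl i (hi | rfl | hi)
      · exact h2 _ i hi
      · exact (by decide : (1 : Fin 2).castSucc ≠ (0 : Fin 3))
      · exact this.2 rfl i hi

/-- A word avoids `x` exactly when all its letters other than `z` are `y`, so an element of `K⟨y,z⟩`
has only one coordinate that can be nonzero. -/
lemma range_ofY (d : ℕ) : Set.range (ofY : MvPolynomial (Fin (d + 1)) K → A K)
      = {q | q ∈ algYZ K ∧ q ∈ H K d} := by
  apply Set.Subset.antisymm
  · rintro _ ⟨ω, rfl⟩
    refine ⟨?_, act_mem_H _ _⟩
    refine Subalgebra.sum_mem _ fun a _ => Subalgebra.smul_mem _ ?_ _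
    rw [mem_algYZ, zWord_eq_ofWord]
    exact ofWord_mem_inWords ((zTail_const_mem_iff _ _).2 rfl)
  · rintro q ⟨hq, hd⟩
    have hd' := hd
    rw [← SetLike.mem_coe, ← range_ofCoords] at hd'
    obtain ⟨Θ, rfl⟩ := hd'
    refine ⟨Θ fun _ => 1, ?_⟩
    rw [ofCoords, Finset.sum_eq_single fun _ => 1]
    · rfl
    · intro u _ hu
      have : Θ u = 0 := by
        ext a
        rw [← coeffs_ofCoords, MvPolynomial.coeff_zero]
        by_contra h0
        rw [mem_algYZ, mem_inWords] at hq
        exact hu ((zTail_const_mem_iff _ _).1 (hq _ h0))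
      rw [this, act_zero]
    · simp

lemma zW_mul_pow {n : ℕ} (u : Fin n → Fin 2) (a : Fin (n + 1) → ℕ) (m : ℕ) :
    zW u a * of 2 ^ m = zW u (a + Pi.single (Fin.last n) m) := by
  cases n with
  | zero => simp [zW, zTail, pow_add]
  | succ n =>
    simp only [zW, zTail, List.ofFn_succ', List.concat_eq_append, List.prod_append,
      List.prod_singleton, Pi.add_apply, mul_assoc, Fin.succ_last, Pi.single_eq_same, pow_add]
    simp

lemma zW_mul_zTail {n k : ℕ} (u : Fin n → Fin 2) (w : Fin k → Fin 2) (a : Fin (n + 1) → ℕ)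
    (b : Fin k → ℕ) (c : Fin (n + k + 1) → ℕ)
    (ha : ∀ i : Fin (n + 1), c (Fin.castLE (by omega) i) = a i)
    (hb : ∀ j : Fin k, c (Fin.natAdd n j).succ = b j) :
    zW u a * zTail w b = zW (Fin.append u w) c := by
  have h : zTail (Fin.append u w) (fun i => c i.succ) = zTail u (fun i => a i.succ) * zTail w b := by
    rw [zTail, List.ofFn_add, List.prod_append]
    simp only [Fin.append_right, hb]
    congr 1
    rw [zTail]
    congr 2
    funext i
    rw [show Fin.append u w (Fin.castLE _ i) = u i from Fin.append_left u w i, ← ha]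
    rfl
  rw [zW, zW, h, ← ha 0, mul_assoc]; rfl

/-- The index of the variables of the left factor in a product. -/
def leftIdx (n k : ℕ) : Fin (n + 1) → Fin (n + k + 1) := Fin.castLE (by omega)

/-- The index of the variables of the right factor in a product. -/
def rightIdx (n k : ℕ) : Fin (k + 1) → Fin (n + k + 1) := fun i => ⟨n + i, by omega⟩

lemma leftIdx_injective (n k : ℕ) : Function.Injective (leftIdx n k) := fun i j h => by
  simpa [leftIdx] using h

lemma rightIdx_injective (n k : ℕ) : Function.Injective (rightIdx n k) := fun i j h => by
  simpa [rightIdx, Fin.ext_iff] using h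

/-- On concatenation the last run of `z` on the left merges with the first run on the right, and
their exponents add. This is why `leftIdx` and `rightIdx` overlap in precisely the index `n`. -/
lemma zWord_mul_zWord {n k : ℕ} (u : Fin n → Fin 2) (w : Fin k → Fin 2)
    (a : Fin (n + 1) →₀ ℕ) (b : Fin (k + 1) →₀ ℕ) :
    (zWord u a * zWord w b : A K) = zWord (Fin.append u w)
      (a.mapDomain (leftIdx n k) + b.mapDomain (rightIdx n k)) := by
  simp only [zWord_eq_ofWord, ← map_mul]
  congr 1
  rw [zW.eq_def w, ← mul_assoc, zW_mul_pow]
  apply zW_mul_zTail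
  · intro i
    rw [Finsupp.add_apply, Pi.add_apply]
    congr 1
    · exact Finsupp.mapDomain_apply (leftIdx_injective n k) a i
    · by_cases hi : i = Fin.last n
      · subst hi
        rw [Pi.single_eq_same]
        exact Finsupp.mapDomain_apply (rightIdx_injective n k) b 0
      · rw [Pi.single_eq_of_ne hi]
        apply Finsupp.mapDomain_of_notMem_range
        rintro ⟨j, hj⟩
        simp only [rightIdx, Fin.ext_iff, Fin.val_castLE, Fin.val_last] at hj hi
        omega
  · intro j
    rw [Finsupp.add_apply, Finsupp.mapDomain_of_notMem_range, zero_add]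
    · exact Finsupp.mapDomain_apply (rightIdx_injective n k) b j.succ
    · rintro ⟨i, hi⟩
      simp only [leftIdx, Fin.ext_iff, Fin.val_castLE, Fin.val_succ, Fin.val_natAdd] at hi
      omega

lemma act_mul_act {n k : ℕ} (P : MvPolynomial (Fin (n + 1)) K) (Q : MvPolynomial (Fin (k + 1)) K)
    (u : Fin n → Fin 2) (w : Fin k → Fin 2) :
    act P u * act Q w = act (MvPolynomial.rename (leftIdx n k) P *
      MvPolynomial.rename (rightIdx n k) Q) (Fin.append u w) := by
  induction P using MvPolynomial.induction_on' with
  | add P P' hP hP' => rw [act_add, add_mul, hP, hP', map_add, add_mul, act_add]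
  | monomial a c =>
    induction Q using MvPolynomial.induction_on' with
    | add Q Q' hQ hQ' => rw [act_add, mul_add, hQ, hQ', map_add, mul_add, act_add]
    | monomial b e =>
      rw [MvPolynomial.rename_monomial, MvPolynomial.rename_monomial, MvPolynomial.monomial_mul,
        act_monomial, act_monomial, act_monomial, smul_mul_smul_comm, zWord_mul_zWord]

lemma act_mul_Z_pow {n : ℕ} (P : MvPolynomial (Fin (n + 1)) K) (u : Fin n → Fin 2) (m : ℕ) :
    act P u * Z K ^ m = act (P * MvPolynomial.X (Fin.last n) ^ m) u := by
  induction P using MvPolynomial.induction_on' with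
  | add P P' hP hP' => rw [act_add, add_mul, hP, hP', add_mul, act_add]
  | monomial a c =>
    rw [MvPolynomial.X_pow_eq_monomial, MvPolynomial.monomial_mul, act_monomial, act_monomial,
      mul_one, smul_mul_assoc, zWord_eq_ofWord, zWord_eq_ofWord, Z_eq_ofWord, ← map_pow, ← map_mul,
      zW_mul_pow]
    congr 3
    funext i
    simp [Finsupp.single_apply, Pi.single_apply, eq_comm]

/-- Each word of length `n + k` splits in one way into a left and a right part, so no two summands
of the product meet in the same coordinate. Noncommutative multiplication thus becomes
multiplication in a polynomial ring. -/
lemma ofCoords_mul {n k : ℕ} (Λ : (Fin n → Fin 2) → MvPolynomial (Fin (n + 1)) K)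
    (Θ : (Fin k → Fin 2) → MvPolynomial (Fin (k + 1)) K) :
    ofCoords Λ * ofCoords Θ = ofCoords fun J : Fin (n + k) → Fin 2 =>
      MvPolynomial.rename (leftIdx n k) (Λ fun i => J (Fin.castAdd k i)) *
        MvPolynomial.rename (rightIdx n k) (Θ fun i => J (Fin.natAdd n i)) := by
  simp only [ofCoords, Finset.sum_mul_sum, act_mul_act]
  rw [← Finset.sum_product', Finset.univ_product_univ]
  refine Fintype.sum_equiv (Fin.appendEquiv n k) _ _ ?_
  rintro ⟨u, w⟩
  simp [Fin.appendEquiv]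

lemma ofCoords_mul_Z_pow {n : ℕ} (Λ : (Fin n → Fin 2) → MvPolynomial (Fin (n + 1)) K) (m : ℕ) :
    ofCoords Λ * Z K ^ m = ofCoords fun J => Λ J * MvPolynomial.X (Fin.last n) ^ m := by
  simp only [ofCoords, Finset.sum_mul, act_mul_Z_pow]

/-- The substitution `q ↦ q(p,z)` as a homomorphism. -/
noncomputable def substHom (p : A K) : A K →ₐ[K] A K := FreeAlgebra.lift K ![0, p, Z K]

lemma subst_eq (q p : A K) : subst q p = substHom p q := rfl

@[simp] lemma substHom_X (p : A K) : substHom p (X K) = 0 := by simp [substHom, X]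

@[simp] lemma substHom_Y (p : A K) : substHom p (Y K) = p := by simp [substHom, Y]

@[simp] lemma substHom_Z (p : A K) : substHom p (Z K) = Z K := by
  conv_lhs => rw [Z]
  simp [substHom]

lemma substHom_zWord {d : ℕ} (a : Fin (d + 1) →₀ ℕ) (v : A K) :
    substHom v (zWord (fun _ : Fin d => 1) a) =
      Z K ^ a 0 * (List.ofFn fun i : Fin d => v * Z K ^ a i.succ).prod := by
  have : FreeAlgebra.ι K ((1 : Fin 2).castSucc) = Y K := rfl
  simp only [zWord, map_mul, map_pow, substHom_Z, map_list_prod, List.map_ofFn,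
    Function.comp_def, this, substHom_Y]

/-- The index `k i` of `t_{ki}`. -/
def spreadIdx (k : ℕ) {d : ℕ} (i : Fin (d + 1)) : Fin (k * d + 1) :=
  ⟨k * i, Nat.lt_succ_of_le (Nat.mul_le_mul_left k (Nat.le_of_lt_succ i.isLt))⟩

lemma spread_eq (k : ℕ) {d : ℕ} (ω : MvPolynomial (Fin (d + 1)) K) :
    spread k ω = MvPolynomial.rename (spreadIdx k) ω := rfl

/-- Induction on `d`, appending a block on the right. The powers of `z` inserted between blocks sit
at positions divisible by `k`, which produces the variables `t_{ki}`. -/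
lemma ofCoords_block_monomial {k : ℕ} (Θ : (Fin k → Fin 2) → MvPolynomial (Fin (k + 1)) K) :
    ∀ {d : ℕ} (a : Fin (d + 1) → ℕ),
      Z K ^ a 0 * (List.ofFn fun i : Fin d => ofCoords Θ * Z K ^ a i.succ).prod =
        ofCoords fun J : Fin (k * d) → Fin 2 =>
          (∏ i, MvPolynomial.X (spreadIdx k i) ^ a i) * blockProd Θ J := by
  intro d
  induction d with
  | zero =>
    intro a
    have h1 : (1 : A K) = ofCoords (n := k * 0) fun _ => 1 := by
      rw [ofCoords]
      simp only [Nat.mul_zero]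
      rw [Fintype.sum_unique, ← MvPolynomial.C_1, ← MvPolynomial.monomial_zero', act_monomial]
      simp [zWord]
    rw [List.ofFn_zero, List.prod_nil, mul_one, ← one_mul (Z K ^ a 0), h1, ofCoords_mul_Z_pow]
    congr 1
    funext J
    simp only [one_mul, Fin.prod_univ_castSucc, blockProd, Finset.univ_eq_empty, Finset.prod_empty,
      mul_one]
    rfl
  | succ d ih =>
    intro a
    rw [List.ofFn_succ', List.concat_eq_append, List.prod_append, List.prod_singleton,
      ← mul_assoc, ← mul_assoc]
    have := ih fun i => a i.castSucc
    simp only [Fin.castSucc_zero, Fin.succ_castSucc] at this ⊢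
    rw [this]
    -- Since `k * (d + 1)` unfolds to `k * d + k`, the product formula applies without casts and the
    -- index identities below hold by `rfl`.
    refine ((congrArg (· * _) (ofCoords_mul _ Θ)).trans (ofCoords_mul_Z_pow _ _)).trans ?_
    refine congrArg (ofCoords (n := k * d + k)) (funext fun J => ?_)
    rw [Fin.prod_univ_castSucc (n := d + 1), blockProd, blockProd,
      Fin.prod_univ_castSucc fun j : Fin (d + 1) =>
        MvPolynomial.rename (blockIdx j) (Θ fun i => J (blockPos j i))]
    simp only [map_mul, map_prod, map_pow, MvPolynomial.rename_X, MvPolynomial.rename_rename]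
    have e1 : ∀ i : Fin (d + 1), leftIdx (k * d) k (spreadIdx k i) = spreadIdx k i.castSucc :=
      fun i => rfl
    have e2 : (Fin.last (k * d + k)) = spreadIdx k (Fin.last (d + 1)) := rfl
    have e3 : ∀ i : Fin d, leftIdx (k * d) k ∘ blockIdx i = blockIdx i.castSucc := fun i => rfl
    have e4 : rightIdx (k * d) k = blockIdx (Fin.last d) := rfl
    have e5 : ∀ (i : Fin d) (j : Fin k), (Fin.castAdd k (blockPos i j) : Fin (k * d + k)) =
      blockPos i.castSucc j := fun i j => rfl
    have e6 : ∀ (j : Fin k), (Fin.natAdd (k * d) j : Fin (k * d + k)) =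
      blockPos (Fin.last d) j := fun j => rfl
    simp only [e1, e2, e3, e4, e5, e6, Fin.succ_last]
    ring

lemma ofY_add {d : ℕ} (ω ω' : MvPolynomial (Fin (d + 1)) K) :
    ofY (ω + ω') = ofY ω + ofY ω' := act_add _ _ _

lemma ofCoords_add {n : ℕ} (Θ Θ' : (Fin n → Fin 2) → MvPolynomial (Fin (n + 1)) K) :
    ofCoords (fun J => Θ J + Θ' J) = ofCoords Θ + ofCoords Θ' := by
  simp [ofCoords, act_add, Finset.sum_add_distrib]

lemma ofCoords_C_mul {n : ℕ} (c : K) (Θ : (Fin n → Fin 2) → MvPolynomial (Fin (n + 1)) K) :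
    ofCoords (fun J => MvPolynomial.C c * Θ J) = c • ofCoords Θ := by
  simp [ofCoords, act_C_mul, Finset.smul_sum]

lemma subst_ofY {k d : ℕ} (Θ : (Fin k → Fin 2) → MvPolynomial (Fin (k + 1)) K)
    (ω : MvPolynomial (Fin (d + 1)) K) :
    subst (ofY ω) (ofCoords Θ) = ofCoords fun J => spread k ω * blockProd Θ J := by
  rw [subst_eq]
  induction ω using MvPolynomial.induction_on' with
  | add ω ω' h h' =>
    rw [ofY_add, map_add, h, h', ← ofCoords_add]
    simp only [spread_eq, map_add, add_mul]
  | monomial a c =>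
    rw [ofY, act_monomial, map_smul, substHom_zWord, ofCoords_block_monomial, ← ofCoords_C_mul]
    congr 1
    funext J
    rw [spread_eq, MvPolynomial.monomial_eq, Finsupp.prod_fintype _ _ (by simp)]
    simp [mul_assoc]

lemma blockProd_C_mul {k d : ℕ} (c : K) (Θ : (Fin k → Fin 2) → MvPolynomial (Fin (k + 1)) K)
    (J : Fin (k * d) → Fin 2) :
    blockProd (fun I => MvPolynomial.C c * Θ I) J = MvPolynomial.C (c ^ d) * blockProd Θ J := by
  simp [blockProd, Finset.prod_mul_distrib]

lemma subst_ofY_smul {k d : ℕ} (Θ : (Fin k → Fin 2) → MvPolynomial (Fin (k + 1)) K)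
    (ω : MvPolynomial (Fin (d + 1)) K) (c : K) :
    subst (ofY ω) (c • ofCoords Θ) =
      ofCoords fun J => MvPolynomial.C (c ^ d) * spread k ω * blockProd Θ J := by
  rw [← ofCoords_C_mul, subst_ofY]
  congr 1
  funext J
  rw [blockProd_C_mul]; ring

theorem ofCoords_eq_subst_iff (k d : ℕ) (Θ : (Fin k → Fin 2) → MvPolynomial (Fin (k + 1)) K)
    (Λ : (Fin (k * d) → Fin 2) → MvPolynomial (Fin (k * d + 1)) K)
    (ω : MvPolynomial (Fin (d + 1)) K) (β : K) :
    ofCoords Λ = subst (ofY ω) (β⁻¹ • ofCoords Θ) ↔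
      ∀ J, Λ J = MvPolynomial.C (β⁻¹ ^ d) * spread k ω * blockProd Θ J := by
  rw [subst_ofY_smul, (ofCoords_injective _).eq_iff, funext_iff]

lemma spread_injective {k : ℕ} (hk : 0 < k) (d : ℕ) :
    Function.Injective (spread k : MvPolynomial (Fin (d + 1)) K → _) :=
  MvPolynomial.rename_injective _ fun i j h => by
    have := congrArg Fin.val h
    exact Fin.ext (Nat.eq_of_mul_eq_mul_left hk this)

lemma blockProd_ne_zero {k d : ℕ} {Θ : (Fin k → Fin 2) → MvPolynomial (Fin (k + 1)) K}
    {J : Fin (k * d) → Fin 2} (h : ∀ j : Fin d, Θ (fun i => J (blockPos j i)) ≠ 0) :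
    blockProd Θ J ≠ 0 := by
  rw [blockProd, Finset.prod_ne_zero_iff]
  intro j _ h0
  refine h j (MvPolynomial.rename_injective (blockIdx j) ?_ (h0.trans (map_zero _).symm))
  intro i i' hi
  simpa [blockIdx, Fin.ext_iff] using hi

/-- The factor `blockProd Θ J₀` is a product of injectively renamed nonzero polynomials and can be
cancelled in the domain; then `spread k` is injective because `i ↦ k * i` is, for `k > 0`. -/
theorem omega_unique {k d : ℕ} {Θ : (Fin k → Fin 2) → MvPolynomial (Fin (k + 1)) K}
    {J₀ : Fin (k * d) → Fin 2} (hk : 0 < k)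
    (hJ : ∀ j : Fin d, Θ (fun i => J₀ (blockPos j i)) ≠ 0) {ω ω' : MvPolynomial (Fin (d + 1)) K}
    (h : spread k ω * blockProd Θ J₀ = spread k ω' * blockProd Θ J₀) : ω = ω' :=
  spread_injective hk d (mul_right_cancel₀ (blockProd_ne_zero hJ) h)

/-- The scalar `β` contributes only the constant `β⁻¹ ^ d`, which can be absorbed into `ω`;
conversely `β = 1` is enough. -/
theorem exists_spread_of_subst {k d : ℕ} {Θ : (Fin k → Fin 2) → MvPolynomial (Fin (k + 1)) K}
    {Λ : (Fin (k * d) → Fin 2) → MvPolynomial (Fin (k * d + 1)) K} :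
    (∃ (β : K) (q : A K), β ≠ 0 ∧ q ∈ algYZ K ∧ q ∈ H K d ∧
      ofCoords Λ = subst q (β⁻¹ • ofCoords Θ)) ↔
    ∃ ω : MvPolynomial (Fin (d + 1)) K, ∀ J, Λ J = spread k ω * blockProd Θ J := by
  constructor
  · rintro ⟨β, q, -, hq, hd, h⟩
    obtain ⟨ω, rfl⟩ : q ∈ Set.range (ofY : MvPolynomial (Fin (d + 1)) K → A K) := by
      rw [range_ofY]; exact ⟨hq, hd⟩
    rw [ofCoords_eq_subst_iff] at h
    refine ⟨MvPolynomial.C (β⁻¹ ^ d) * ω, fun J => ?_⟩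
    rw [h J, spread_eq, spread_eq, map_mul, MvPolynomial.rename_C]
  · rintro ⟨ω, h⟩
    have hω : ofY ω ∈ {q | q ∈ algYZ K ∧ q ∈ H K d} := by
      rw [← range_ofY]; exact ⟨ω, rfl⟩
    refine ⟨1, ofY ω, one_ne_zero, hω.1, hω.2, ?_⟩
    rw [ofCoords_eq_subst_iff]
    intro J
    simp [h J]

/-- Substitution into a homogeneous polynomial of positive degree in `x, y` is injective. -/
lemma eq_zero_of_substHom_eq_zero {k d : ℕ} (hk : 0 < k) {v q : A K} (hv : v ∈ H K k) (hv0 : v ≠ 0)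
    (hq : q ∈ algYZ K) (hd : q ∈ H K d) (h : substHom v q = 0) : q = 0 := by
  rw [← SetLike.mem_coe, ← range_ofCoords] at hv
  obtain ⟨Θ, rfl⟩ := hv
  obtain ⟨ω, rfl⟩ : q ∈ Set.range (ofY : MvPolynomial (Fin (d + 1)) K → A K) := by
    rw [range_ofY]; exact ⟨hq, hd⟩
  obtain ⟨I, hI⟩ : ∃ I, Θ I ≠ 0 := by
    by_contra! h0
    exact hv0 (by simp [ofCoords, h0, act_zero])
  -- The word `I` repeated `d` times: all its blocks equal `I`, so all factors of `blockProd Θ J`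
  -- are nonzero.
  let J : Fin (k * d) → Fin 2 := fun i => I ⟨i % k, Nat.mod_lt _ hk⟩
  have hJ : ∀ j : Fin d, (fun i => J (blockPos j i)) = I := by
    intro j
    funext i
    simp only [J, blockPos]
    congr 1
    ext
    simp [Nat.mod_eq_of_lt i.isLt]
  have h1 := subst_ofY Θ ω
  have h2 : ofCoords (fun J => spread k (0 : MvPolynomial (Fin (d + 1)) K) * blockProd Θ J) = 0 := by
    simp [spread_eq, ofCoords, act_zero]
  rw [subst_eq, h, ← h2] at h1
  have h3 := congrFun (ofCoords_injective _ h1) J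
  have : (0 : MvPolynomial (Fin (d + 1)) K) = ω :=
    omega_unique (Θ := Θ) (J₀ := J) hk (fun j => by rw [hJ]; exact hI) h3
  rw [← this, ofY, act_zero]

end Coordinates


/-! ### Leading components under substitution. -/

section Substitution

variable {K : Type*} [Field K]

/-- The bidegree of `s(g,z)` for `g` of bidegree `b` and a word `s` in `y, z` of bidegree `c`. -/
def tau (b c : ℕ ×ₗ ℕ) : ℕ ×ₗ ℕ :=
  toLex ((ofLex b).1 * (ofLex c).1, (ofLex c).2 + (ofLex c).1 * (ofLex b).2)

lemma tau_add (b c c' : ℕ ×ₗ ℕ) : tau b (c + c') = tau b c + tau b c' := by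
  rw [tau, tau, tau, ← toLex_add]
  simp only [ofLex_add, Prod.fst_add, Prod.snd_add, Prod.mk_add_mk]
  congr 2 <;> ring

/-- With a positive degree in `x, y` for `b`, multiplication by it is strictly monotone. If the
first entries of `c` and `c'` agree, both second entries are shifted by the same amount and the
degree in `z` decides. -/
lemma tau_lt_tau {b c c' : ℕ ×ₗ ℕ} (hb : toLex (1, 0) ≤ b) (h : c < c') : tau b c < tau b c' := by
  obtain ⟨⟨k, e⟩, rfl⟩ := toLex.surjective b
  obtain ⟨⟨d, m⟩, rfl⟩ := toLex.surjective c
  obtain ⟨⟨d', m'⟩, rfl⟩ := toLex.surjective c'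
  rw [toLex_le_iff] at hb
  have hk : 0 < k := by omega
  rw [toLex_lt_iff] at h
  simp only [tau, ofLex_toLex, toLex_lt_iff]
  rcases h with h | ⟨rfl, h⟩
  · exact Or.inl (Nat.mul_lt_mul_of_pos_left h hk)
  · exact Or.inr ⟨rfl, by omega⟩

@[simp] lemma tau_one_zero (b : ℕ ×ₗ ℕ) : tau b (toLex (1, 0)) = b := by
  obtain ⟨⟨k, e⟩, rfl⟩ := toLex.surjective b
  simp [tau]

@[simp] lemma one_zero_tau (c : ℕ ×ₗ ℕ) : tau (toLex (1, 0)) c = c := by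
  obtain ⟨⟨k, e⟩, rfl⟩ := toLex.surjective c
  simp [tau]

@[simp] lemma tau_zero (b : ℕ ×ₗ ℕ) : tau b 0 = 0 := by
  obtain ⟨⟨k, e⟩, rfl⟩ := toLex.surjective b
  have : (0 : ℕ ×ₗ ℕ) = toLex (0, 0) := rfl
  simp [tau, this]

lemma wordBideg_Y : wordBideg (FreeMonoid.of 1) = toLex (1, 0) := by decide

lemma wordBideg_Z : wordBideg (FreeMonoid.of 2) = toLex (0, 1) := by decide

lemma tau_zero_one (b : ℕ ×ₗ ℕ) : tau b (toLex (0, 1)) = toLex (0, 1) := by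
  simp [tau]

lemma map_mem_of_words {S : Set (FreeMonoid (Fin 3))} {M : Submodule K (A K)} (L : A K →ₗ[K] A K)
    {q : A K} (hq : q ∈ algYZ K) (hS : q ∈ inWords K S)
    (h : ∀ s ∈ S, (∀ i ∈ s.toList, i ≠ 0) → L (ofWord K s) ∈ M) : L q ∈ M := by
  rw [mem_algYZ, mem_inWords] at hq
  rw [mem_inWords] at hS
  rw [eq_sum_coeffs q, Finsupp.sum, map_sum]
  refine Submodule.sum_mem _ fun s hs => ?_
  rw [Finsupp.mem_support_iff] at hs
  rw [map_smul]
  exact Submodule.smul_mem _ _ (h s (hS s hs) (hq s hs))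

/-- Bidegree is additive on products of words, so replacing each occurrence of `g` by its leading
component changes only terms of lower bidegree. -/
lemma substHom_lead_word (g : A K) (s : FreeMonoid (Fin 3)) (hs : ∀ i ∈ s.toList, i ≠ 0) :
    substHom (lead g) (ofWord K s) ∈ homB K (tau (bideg g) (wordBideg s)) ∧
    substHom g (ofWord K s) - substHom (lead g) (ofWord K s) ∈
      ltB K (tau (bideg g) (wordBideg s)) := by
  induction s using FreeMonoid.inductionOn' with
  | one =>
    rw [map_one, map_one, map_one, sub_self, wordBideg_one, tau_zero]
    refine ⟨?_, Submodule.zero_mem _⟩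
    rw [← map_one (ofWord K)]
    exact ofWord_mem_inWords wordBideg_one
  | of_mul i s ih =>
    obtain ⟨h1, h2⟩ := ih fun j hj => hs j (by simp [hj])
    have hi : i ≠ 0 := hs i (by simp)
    rw [map_mul, map_mul, map_mul, wordBideg_mul, tau_add, ofWord_of]
    by_cases hi1 : i = 1
    · subst hi1
      change substHom (lead g) (Y K) * _ ∈ _ ∧ substHom g (Y K) * _ - substHom (lead g) (Y K) * _ ∈ _
      rw [substHom_Y, substHom_Y, wordBideg_Y, tau_one_zero]
      refine ⟨mul_mem_homB (lead_mem_homB g) h1, ?_⟩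
      -- Telescoping `a b - a' b' = a (b - b') + (a - a') b'`; each summand has one factor of
      -- strictly lower bidegree.
      have e : g * substHom g (ofWord K s) - lead g * substHom (lead g) (ofWord K s) =
          g * (substHom g (ofWord K s) - substHom (lead g) (ofWord K s)) +
            (g - lead g) * substHom (lead g) (ofWord K s) := by noncomm_ring
      rw [e]
      refine Submodule.add_mem _ ?_ ?_
      · refine mul_mem_inWords (S := {w | wordBideg w ≤ bideg g}) ?_
          (mem_inWords.2 fun w hw => le_bideg hw) h2
        intro a ha b hb
        simp only [Set.mem_ofPred_eq, wordBideg_mul] at *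
        exact add_lt_add_of_le_of_lt ha hb
      · refine mul_mem_inWords ?_ (sub_lead_mem_ltB g) h1
        intro a ha b hb
        simp only [Set.mem_ofPred_eq, wordBideg_mul] at *
        exact add_lt_add_of_lt_of_le ha hb.le
    · obtain rfl : i = 2 := by omega
      change substHom (lead g) (Z K) * _ ∈ _ ∧ substHom g (Z K) * _ - substHom (lead g) (Z K) * _ ∈ _
      rw [substHom_Z, substHom_Z, wordBideg_Z, tau_zero_one, ← mul_sub, Z_eq_ofWord]
      refine ⟨mul_mem_homB (ofWord_mem_inWords wordBideg_Z) h1, ?_⟩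
      refine mul_mem_inWords (S := {w | wordBideg w = toLex (0, 1)}) ?_
        (ofWord_mem_inWords wordBideg_Z) h2
      intro a ha b hb
      simp only [Set.mem_ofPred_eq, wordBideg_mul] at *
      rw [ha]
      exact add_lt_add_of_le_of_lt le_rfl hb

lemma substHom_lead_mem_homB {g q : A K} {c : ℕ ×ₗ ℕ} (hq : q ∈ algYZ K) (hc : q ∈ homB K c) :
    substHom (lead g) q ∈ homB K (tau (bideg g) c) :=
  map_mem_of_words (substHom (lead g)).toLinearMap hq hc (by
    rintro s rfl hs0
    exact (substHom_lead_word g s hs0).1)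

lemma substHom_sub_mem_ltB {g q : A K} {c : ℕ ×ₗ ℕ} (hq : q ∈ algYZ K) (hc : q ∈ homB K c) :
    substHom g q - substHom (lead g) q ∈ ltB K (tau (bideg g) c) :=
  map_mem_of_words ((substHom g).toLinearMap - (substHom (lead g)).toLinearMap) hq hc (by
    rintro s rfl hs0
    exact (substHom_lead_word g s hs0).2)

lemma substHom_mem_ltB {g q : A K} {c : ℕ ×ₗ ℕ} (hg : g ∉ algZ K) (hq : q ∈ algYZ K)
    (hc : q ∈ ltB K c) : substHom g q ∈ ltB K (tau (bideg g) c) :=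
  map_mem_of_words (substHom g).toLinearMap hq hc (by
    intro s hs hs0
    obtain ⟨h1, h2⟩ := substHom_lead_word g s hs0
    have hlt := tau_lt_tau (one_zero_le_bideg.1 hg) hs
    have : substHom g (ofWord K s) = (substHom g (ofWord K s) - substHom (lead g) (ofWord K s)) +
      substHom (lead g) (ofWord K s) := by abel
    change substHom g (ofWord K s) ∈ _
    rw [this]
    exact Submodule.add_mem _ (inWords_mono (fun w hw => lt_trans hw hlt) h2)
      (inWords_mono (fun w hw => (show wordBideg w = _ from hw).trans_lt hlt) h1))

lemma bideg_lead {g : A K} (hg : g ≠ 0) : bideg (lead g) = bideg g :=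
  (lead_of_mem_homB (lead_mem_homB g) (lead_ne_zero hg)).1

lemma lead_lead {g : A K} (hg : g ≠ 0) : lead (lead g) = lead g :=
  (lead_of_mem_homB (lead_mem_homB g) (lead_ne_zero hg)).2

lemma lead_notMem_algZ {g : A K} (hg : g ∉ algZ K) : lead g ∉ algZ K := by
  rw [one_zero_le_bideg, bideg_lead (ne_zero_of_notMem_algZ hg)]
  exact one_zero_le_bideg.1 hg

lemma fst_bideg_pos {g : A K} (hg : g ∉ algZ K) : 0 < (ofLex (bideg g)).1 := by
  have h := one_zero_le_bideg.1 hg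
  obtain ⟨⟨k, e⟩, hb⟩ := toLex.surjective (bideg g)
  rw [← hb] at h ⊢
  rw [toLex_le_iff] at h
  simp only [ofLex_toLex]
  omega

/-- Leading component of a substitution. -/
theorem lead_substHom {g q : A K} (hg : g ∉ algZ K) (hq : q ∈ algYZ K) (hq0 : q ≠ 0) :
    bideg (substHom g q) = tau (bideg g) (bideg q) ∧
      lead (substHom g q) = substHom (lead g) (lead q) := by
  have hlq := lead_mem_algYZ hq
  refine bideg_lead_of_decomp (substHom_lead_mem_homB hlq (lead_mem_homB q)) ?_ ?_
  -- The candidate leading term does not vanish: `lead q` is homogeneous, and substitution of the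
  -- homogeneous `lead g` is injective on such elements.
  · intro h
    exact lead_ne_zero hq0 (eq_zero_of_substHom_eq_zero (fst_bideg_pos hg)
      (homB_le_H _ (lead_mem_homB g)) (lead_ne_zero (ne_zero_of_notMem_algZ hg)) hlq
      (homB_le_H _ (lead_mem_homB q)) h)
  · have : substHom g q - substHom (lead g) (lead q) =
        substHom g (q - lead q) + (substHom g (lead q) - substHom (lead g) (lead q)) := by
      rw [map_sub]; abel
    rw [this]
    exact Submodule.add_mem _
      (substHom_mem_ltB hg (Subalgebra.sub_mem _ hq hlq) (sub_lead_mem_ltB q))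
      (substHom_sub_mem_ltB hlq (lead_mem_homB q))

/-- A nonzero difference would have a nonzero leading component after substitution. In other words,
`g` and `z` generate a free algebra of rank two whenever `g ∉ K[z]`. -/
lemma substHom_injOn {g q q' : A K} (hg : g ∉ algZ K) (hq : q ∈ algYZ K) (hq' : q' ∈ algYZ K)
    (h : substHom g q = substHom g q') : q = q' := by
  by_contra hne
  have h0 : q - q' ≠ 0 := sub_ne_zero.2 hne
  have h1 := (lead_substHom hg (Subalgebra.sub_mem _ hq hq') h0).2
  rw [map_sub, h, sub_self] at h1
  have h2 : substHom (lead g) (lead (q - q')) = 0 := by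
    rw [← h1]; exact ext_coeffs fun w => by simp [coeffs_lead_apply]
  exact lead_ne_zero h0 (eq_zero_of_substHom_eq_zero (fst_bideg_pos hg)
      (homB_le_H _ (lead_mem_homB g)) (lead_ne_zero (ne_zero_of_notMem_algZ hg))
      (lead_mem_algYZ (Subalgebra.sub_mem _ hq hq')) (homB_le_H _ (lead_mem_homB _)) h2)

lemma substHom_of_mem_algZ (g : A K) {p : A K} (hp : p ∈ algZ K) : substHom g p = p := by
  induction hp using Algebra.adjoin_induction with
  | mem x hx => rw [Set.mem_singleton_iff.1 hx, substHom_Z]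
  | algebraMap r => simp
  | add x y _ _ hx hy => rw [map_add, hx, hy]
  | mul x y _ _ hx hy => rw [map_mul, hx, hy]

lemma substHom_substHom (p q r : A K) : substHom p (substHom q r) = substHom (substHom p q) r := by
  have : (substHom p).comp (substHom q) = substHom (substHom p q) := by
    apply FreeAlgebra.hom_ext
    funext i
    fin_cases i
    · change substHom p (substHom q (X K)) = substHom _ (X K)
      simp
    · change substHom p (substHom q (Y K)) = substHom _ (Y K)
      simp
    · change substHom p (substHom q (Z K)) = substHom _ (Z K)
      simp
  exact DFunLike.congr_fun this r

lemma substHom_mem_algYZ {p q : A K} (hp : p ∈ algYZ K) (hq : q ∈ algYZ K) :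
    substHom p q ∈ algYZ K := by
  induction hq using Algebra.adjoin_induction with
  | mem x hx =>
    rcases hx with rfl | rfl
    · rwa [substHom_Y]
    · rw [substHom_Z]; exact Z_mem_algYZ
  | algebraMap r => rw [AlgHom.commutes]; exact Subalgebra.algebraMap_mem _ _
  | add x y _ _ hx hy => rw [map_add]; exact Subalgebra.add_mem _ hx hy
  | mul x y _ _ hx hy => rw [map_mul]; exact Subalgebra.mul_mem _ hx hy

lemma substHom_smul (c : K) (p q : A K) :
    substHom (c • p) q = substHom p (substHom (c • Y K) q) := by
  rw [substHom_substHom, map_smul, substHom_Y]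

/-- An expression of the leading component of `f` through that of `g` is automatically
bihomogeneous. -/
lemma lead_eq_substHom {f g q : A K} (hf : f ∉ algZ K) (hg : g ∉ algZ K) (hq : q ∈ algYZ K)
    (h : lead f = substHom (lead g) q) : q ≠ 0 ∧ lead q = q ∧
      bideg f = tau (bideg g) (bideg q) ∧ lead (substHom g q) = lead f ∧
        bideg (substHom g q) = bideg f := by
  have hf0 := ne_zero_of_notMem_algZ hf
  have hg0 := ne_zero_of_notMem_algZ hg
  have hq0 : q ≠ 0 := by
    rintro rfl
    exact lead_ne_zero hf0 (by rw [h, map_zero])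
  have h1 := lead_substHom (lead_notMem_algZ hg) hq hq0
  rw [← h, lead_lead hf0, lead_lead hg0, bideg_lead hf0, bideg_lead hg0] at h1
  -- Substituting `lead g` gives `lead f` for both `lead q` and `q`, so injectivity identifies them.
  have h2 : lead q = q := substHom_injOn (lead_notMem_algZ hg) (lead_mem_algYZ hq) hq
    (h1.2.symm.trans h)
  have h3 := lead_substHom hg hq hq0
  exact ⟨hq0, h2, h1.1, by rw [h3.2, h1.2], by rw [h3.1, h1.1]⟩

/-- Taking `q'(y,z) = q(y/β, z)` removes the scalar, so later arguments need only the case `β = 1`.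
-/
lemma Expresses.exists_reduced {u v q : A K} {β : K} (h : Expresses u v β q) :
    ∃ q' ∈ algYZ K, u = substHom v q' ∧ ∀ p, subst q (β⁻¹ • p) = substHom p q' := by
  obtain ⟨-, k, l, d, -, -, -, -, hq, -, hu⟩ := h
  have hs : ∀ p, subst q (β⁻¹ • p) = substHom p (substHom (β⁻¹ • Y K) q) :=
    fun p => by rw [subst_eq, substHom_smul]
  exact ⟨_, substHom_mem_algYZ (Subalgebra.smul_mem _ Y_mem_algYZ _) hq, by rw [hu, hs], hs⟩

/-- The degree conditions in `Expresses` come for free: `q` is automatically bihomogeneous, and its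
degree in `x, y` is positive because that of `lead f` is. -/
lemma expresses_of_substHom {f g q : A K} (hf : f ∉ algZ K) (hg : g ∉ algZ K) (hq : q ∈ algYZ K)
    (h : lead f = substHom (lead g) q) : Expresses (lead f) (lead g) 1 q := by
  obtain ⟨-, hq1, hb, -⟩ := lead_eq_substHom hf hg hq h
  have hbl : (ofLex (bideg f)).1 = (ofLex (bideg g)).1 * (ofLex (bideg q)).1 := by rw [hb]; rfl
  refine ⟨one_ne_zero, _, _, _, ?_, hbl, homB_le_H _ (lead_mem_homB f),
    homB_le_H _ (lead_mem_homB g), hq, ?_, ?_⟩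
  · have := fst_bideg_pos hf
    rw [hbl] at this
    exact Nat.pos_of_mul_pos_left this
  · have := homB_le_H _ (lead_mem_homB q)
    rwa [hq1] at this
  · rw [inv_one, one_smul, subst_eq, h]

/-- After absorbing the scalars, both expressions are preimages of the same element under an
injective substitution. -/
lemma expresses_unique {g u : A K} {β β' : K} {q q' : A K} (hg : g ∉ algZ K)
    (h : Expresses u (lead g) β q) (h' : Expresses u (lead g) β' q') (p : A K) :
    subst q (β⁻¹ • p) = subst q' (β'⁻¹ • p) := by
  obtain ⟨r, hr, h1, h2⟩ := h.exists_reduced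
  obtain ⟨r', hr', h1', h2'⟩ := h'.exists_reduced
  rw [h2, h2', substHom_injOn (lead_notMem_algZ hg) hr hr' (h1.symm.trans h1')]

/-- The two leading components coincide and cancel. If the difference is zero, the strict inequality
still holds because `f ∉ K[z]` forces a positive bidegree. -/
lemma bideg_sub_lt {f g q : A K} {β : K} (hf : f ∉ algZ K) (hg : g ∉ algZ K)
    (h : Expresses (lead f) (lead g) β q) : bideg (f - subst q (β⁻¹ • g)) < bideg f := by
  obtain ⟨r, hr, h1, h2⟩ := h.exists_reduced
  rw [h2]
  obtain ⟨-, -, -, h3, h4⟩ := lead_eq_substHom hf hg hr h1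
  have hpos : (0 : ℕ ×ₗ ℕ) < bideg f := lt_of_lt_of_le (by decide) (one_zero_le_bideg.1 hf)
  refine bideg_ltB hpos ?_
  have : f - substHom g r = (f - lead f) - (substHom g r - lead (substHom g r)) := by
    rw [h3]; abel
  rw [this]
  refine Submodule.sub_mem _ (sub_lead_mem_ltB f) ?_
  rw [← h4]
  exact sub_lead_mem_ltB _

end Substitution

/-! ### Uniqueness of the outcome of a pass, and termination. -/

section Procedure

variable {K : Type*} [Field K]

lemma not_someInZ {φ : A K × A K} : ¬ SomeInZ φ ↔ φ.1 ∉ algZ K ∧ φ.2 ∉ algZ K := not_or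

lemma trichotomy {φ : A K × A K} (h : ¬ SomeInZ φ) : BothLinear φ ∨ FirstBig φ ∨ SecondBig φ := by
  obtain ⟨h1, h2⟩ := not_someInZ.1 h
  rw [one_zero_le_bideg] at h1 h2
  rcases lt_or_ge (bideg φ.1) (bideg φ.2) with hlt | hge
  · exact Or.inr (Or.inr ⟨h, h1.trans_lt hlt, hlt⟩)
  · rcases h1.eq_or_lt with h1 | h1
    · exact Or.inl ⟨h, h1.symm, le_antisymm (hge.trans_eq h1.symm) h2⟩
    · exact Or.inr (Or.inl ⟨h, h1, hge⟩)

lemma BothLinear.not_firstBig {φ : A K × A K} (h : BothLinear φ) : ¬ FirstBig φ :=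
  fun h' => h'.2.1.ne h.2.1.symm

lemma BothLinear.not_secondBig {φ : A K × A K} (h : BothLinear φ) : ¬ SecondBig φ :=
  fun h' => h'.2.1.ne h.2.2.symm

lemma FirstBig.not_secondBig {φ : A K × A K} (h : FirstBig φ) : ¬ SecondBig φ :=
  fun h' => h.2.2.not_gt h'.2.2

lemma exists_pass (φ : A K × A K) : ∃ o, Pass φ o := by
  by_cases h0 : SomeInZ φ
  · exact ⟨_, .step_zero h0⟩
  rcases trichotomy h0 with h | h | h
  · by_cases hi : LinearIndependent K ![lead φ.1, lead φ.2]
    · exact ⟨_, .step_one_yes h hi⟩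
    · exact ⟨_, .step_one_no h hi⟩
  · by_cases he : ∃ (β : K) (q : A K), Expresses (lead φ.1) (lead φ.2) β q
    · obtain ⟨β, q, hq⟩ := he
      exact ⟨_, .step_two_go h β q hq⟩
    · push Not at he
      exact ⟨_, .step_two_no h he⟩
  · by_cases he : ∃ (α : K) (q : A K), Expresses (lead φ.2) (lead φ.1) α q
    · obtain ⟨β, q, hq⟩ := he
      exact ⟨_, .step_three_go h β q hq⟩
    · push Not at he
      exact ⟨_, .step_three_no h he⟩

/-- The guards of the steps exclude each other, apart from rejections, which all give the same
outcome. The only freedom is the choice of `q` and the scalar in a replacement, settled by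
`expresses_unique`. -/
lemma Pass.unique {φ : A K × A K} {o o' : Bool ⊕ (A K × A K)} (h : Pass φ o) (h' : Pass φ o') :
    o = o' := by
  cases h with
  | step_zero h =>
    cases h' with
    | step_zero => rfl
    | step_one_yes h' => exact absurd h h'.1
    | step_one_no h' => rfl
    | step_two_go h' => exact absurd h h'.1
    | step_two_no h' => rfl
    | step_three_go h' => exact absurd h h'.1
    | step_three_no h' => rfl
  | step_one_yes h hi =>
    cases h' with
    | step_zero h' => exact absurd h' h.1
    | step_one_yes => rfl
    | step_one_no _ hi' => exact absurd hi hi'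
    | step_two_go h' => exact absurd h' h.not_firstBig
    | step_two_no h' => exact absurd h' h.not_firstBig
    | step_three_go h' => exact absurd h' h.not_secondBig
    | step_three_no h' => exact absurd h' h.not_secondBig
  | step_one_no h hi =>
    cases h' with
    | step_zero h' => rfl
    | step_one_yes _ hi' => exact absurd hi' hi
    | step_one_no => rfl
    | step_two_go h' => exact absurd h' h.not_firstBig
    | step_two_no h' => rfl
    | step_three_go h' => exact absurd h' h.not_secondBig
    | step_three_no h' => rfl
  | step_two_go h β q hq =>
    cases h' with
    | step_zero h' => exact absurd h' h.1
    | step_one_yes h' => exact absurd h h'.not_firstBig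
    | step_one_no h' => exact absurd h h'.not_firstBig
    | step_two_go _ β' q' hq' =>
      rw [expresses_unique (not_someInZ.1 h.1).2 hq hq']
    | step_two_no _ hn => exact absurd hq (hn _ _)
    | step_three_go h' => exact absurd h' h.not_secondBig
    | step_three_no h' => exact absurd h' h.not_secondBig
  | step_two_no h hn =>
    cases h' with
    | step_zero h' => rfl
    | step_one_yes h' => exact absurd h h'.not_firstBig
    | step_one_no h' => rfl
    | step_two_go _ β' q' hq' => exact absurd hq' (hn _ _)
    | step_two_no _ hn => rfl
    | step_three_go h' => exact absurd h' h.not_secondBig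
    | step_three_no h' => rfl
  | step_three_go h β q hq =>
    cases h' with
    | step_zero h' => exact absurd h' h.1
    | step_one_yes h' => exact absurd h h'.not_secondBig
    | step_one_no h' => exact absurd h h'.not_secondBig
    | step_two_go h' => exact absurd h h'.not_secondBig
    | step_two_no h' => exact absurd h h'.not_secondBig
    | step_three_go _ β' q' hq' =>
      rw [expresses_unique (not_someInZ.1 h.1).1 hq hq']
    | step_three_no _ hn => exact absurd hq (hn _ _)
  | step_three_no h hn =>
    cases h' with
    | step_zero h' => rfl
    | step_one_yes h' => exact absurd h h'.not_secondBig
    | step_one_no h' => rfl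
    | step_two_go h' => exact absurd h h'.not_secondBig
    | step_two_no h' => rfl
    | step_three_go _ β' q' hq' => exact absurd hq' (hn _ _)
    | step_three_no _ hn => rfl

theorem existsUnique_pass (φ : A K × A K) : ∃! o, Pass φ o := by
  obtain ⟨o, ho⟩ := exists_pass φ
  exact ⟨o, ho, fun o' ho' => ho'.unique ho⟩

/-- The measure is the pair of bidegrees in lexicographic order: Step 2 lowers the first entry,
while Step 3 keeps the first and lowers the second. -/
theorem pass_wellFounded : WellFounded fun φ' φ : A K × A K => Pass φ (Sum.inr φ') := by
  refine Subrelation.wf (r := InvImage (Prod.Lex (· < ·) (· < ·))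
    fun φ : A K × A K => (bideg φ.1, bideg φ.2)) ?_
    (InvImage.wf _ (WellFounded.prod_lex wellFounded_lt wellFounded_lt))
  intro φ' φ h
  cases h with
  | step_two_go h β q hq =>
    obtain ⟨h1, h2⟩ := not_someInZ.1 h.1
    exact Prod.Lex.left _ _ (bideg_sub_lt h1 h2 hq)
  | step_three_go h β q hq =>
    obtain ⟨h1, h2⟩ := not_someInZ.1 h.1
    exact Prod.Lex.right _ (bideg_sub_lt h2 h1 hq)

end Procedure


/-! ### Pairs of independent linear forms modulo `K[z]`. -/

section LinearPairs

variable {K : Type*} [Field K]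

lemma coeffs_linear_zero (a b : K) : coeffs (a • X K + b • Y K) (FreeMonoid.of 0) = a := by
  rw [X_eq_ofWord, Y_eq_ofWord, coeffs_add, coeffs_smul, coeffs_smul, coeffs_ofWord, coeffs_ofWord]
  simp [FreeMonoid.of_injective.eq_iff]

lemma coeffs_linear_one (a b : K) : coeffs (a • X K + b • Y K) (FreeMonoid.of 1) = b := by
  rw [X_eq_ofWord, Y_eq_ofWord, coeffs_add, coeffs_smul, coeffs_smul, coeffs_ofWord, coeffs_ofWord]
  simp [FreeMonoid.of_injective.eq_iff]

lemma linear_mem_homB (a b : K) : a • X K + b • Y K ∈ homB K (toLex (1, 0)) := by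
  rw [X_eq_ofWord, Y_eq_ofWord]
  exact Submodule.add_mem _ (Submodule.smul_mem _ _ (ofWord_mem_inWords (by decide)))
    (Submodule.smul_mem _ _ (ofWord_mem_inWords (by decide)))

lemma linear_eq_zero_iff {a b : K} : a • X K + b • Y K = 0 ↔ a = 0 ∧ b = 0 := by
  constructor
  · intro h
    have h0 := coeffs_linear_zero a b
    have h1 := coeffs_linear_one a b
    rw [h] at h0 h1
    exact ⟨by simpa using h0.symm, by simpa using h1.symm⟩
  · rintro ⟨rfl, rfl⟩; simp

lemma mem_algZ_iff_ltB {p : A K} : p ∈ algZ K ↔ p ∈ ltB K (toLex (1, 0)) := by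
  rw [mem_algZ_iff_bideg]
  refine ⟨fun h => mem_inWords.2 fun w hw => (le_bideg hw).trans_lt h, bideg_ltB (by decide)⟩

lemma bideg_lead_linear {p : A K} {a b : K} (h : p - (a • X K + b • Y K) ∈ algZ K)
    (hab : ¬ (a = 0 ∧ b = 0)) : bideg p = toLex (1, 0) ∧ lead p = a • X K + b • Y K :=
  bideg_lead_of_decomp (linear_mem_homB a b) (fun h0 => hab (linear_eq_zero_iff.1 h0))
    (mem_algZ_iff_ltB.1 h)

lemma word_of_bideg_one_zero {w : FreeMonoid (Fin 3)} (h : wordBideg w = toLex (1, 0)) :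
    w = FreeMonoid.of 0 ∨ w = FreeMonoid.of 1 := by
  have hx : xyDeg w = 1 := congrArg (fun t => (ofLex t).1) h
  have hz : w.toList.count 2 = 0 := congrArg (fun t => (ofLex t).2) h
  obtain ⟨u, a, rfl⟩ := exists_zW_eq w hx
  rw [zW_succ] at hz ⊢
  have hc : ∀ m : ℕ, (FreeMonoid.toList (FreeMonoid.of (2 : Fin 3) ^ m)).count 2 = m := by
    intro m
    induction m with
    | zero => simp
    | succ m ih => rw [pow_succ, FreeMonoid.toList_mul, List.count_append, ih]; simp
  simp only [zW, zTail, List.ofFn_zero, List.prod_nil, mul_one, FreeMonoid.toList_mul,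
    List.count_append, hc] at hz ⊢
  obtain ⟨h1, h2, h3⟩ : a 0 = 0 ∧ _ ∧ a (Fin.succ 0) = 0 := by
    refine ⟨by omega, trivial, by omega⟩
  rw [h1, h3]
  have : ∀ j : Fin 2, j = 0 ∨ j = 1 := by decide
  rcases this (u 0) with h | h <;> rw [h] <;> simp

lemma exists_linear_of_bideg {p : A K} (h : bideg p = toLex (1, 0)) :
    ∃ a b : K, lead p = a • X K + b • Y K ∧ p - (a • X K + b • Y K) ∈ algZ K := by
  have key : lead p = coeffs (lead p) (FreeMonoid.of 0) • X K +
      coeffs (lead p) (FreeMonoid.of 1) • Y K := by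
    refine ext_coeffs fun w => ?_
    by_cases hw : wordBideg w = toLex (1, 0)
    · rcases word_of_bideg_one_zero hw with rfl | rfl
      · rw [coeffs_linear_zero]
      · rw [coeffs_linear_one]
    · have h1 : coeffs (lead p) w = 0 := by
        rw [coeffs_lead_apply, h, if_neg hw]
      rw [h1]
      by_contra h0
      exact hw (mem_inWords.1 (linear_mem_homB _ _) w (Ne.symm h0))
  refine ⟨_, _, key, ?_⟩
  rw [← key, mem_algZ_iff_ltB, ← h]
  exact sub_lead_mem_ltB p

lemma linearIndependent_linear {a b c d : K} :
    LinearIndependent K ![a • X K + b • Y K, c • X K + d • Y K] ↔ a * d - b * c ≠ 0 := by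
  have hcomb : ∀ s t : K, s • (a • X K + b • Y K) + t • (c • X K + d • Y K) =
      (s * a + t * c) • X K + (s * b + t * d) • Y K := fun s t => by module
  rw [LinearIndependent.pair_iff]
  constructor
  · intro h h0
    -- If the determinant vanishes, `(d, -b)` and `(c, -a)` are linear relations; independence then
    -- gives `a = b = 0`, so the first form would be zero.
    obtain ⟨h1, h2⟩ := h d (-b) (by
      rw [hcomb, linear_eq_zero_iff]
      exact ⟨by linear_combination h0, by ring⟩)
    obtain ⟨h3, h4⟩ := h c (-a) (by
      rw [hcomb, linear_eq_zero_iff]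
      exact ⟨by ring, by linear_combination -h0⟩)
    rw [neg_eq_zero] at h2 h4
    have := h 1 0 (by simp [h2, h4])
    exact one_ne_zero this.1
  · intro h0 s t h
    rw [hcomb, linear_eq_zero_iff] at h
    obtain ⟨h1, h2⟩ := h
    constructor
    · refine (mul_eq_zero.1 (?_ : s * (a * d - b * c) = 0)).resolve_right h0
      linear_combination d * h1 - c * h2
    · refine (mul_eq_zero.1 (?_ : t * (a * d - b * c) = 0)).resolve_right h0
      linear_combination a * h2 - b * h1

/-- A pair of polynomials that are, up to elements of `K[z]`, independent linear forms
in `x` and `y`. -/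
def LinearPair (f g : A K) : Prop :=
  ∃ a b c d : K, a * d - b * c ≠ 0 ∧ f - (a • X K + b • Y K) ∈ algZ K ∧
    g - (c • X K + d • Y K) ∈ algZ K

lemma BothLinear.linearPair {φ : A K × A K} (h : BothLinear φ)
    (hi : LinearIndependent K ![lead φ.1, lead φ.2]) : LinearPair φ.1 φ.2 := by
  obtain ⟨a, b, h1, h2⟩ := exists_linear_of_bideg h.2.1
  obtain ⟨c, d, h3, h4⟩ := exists_linear_of_bideg h.2.2
  rw [h1, h3, linearIndependent_linear] at hi
  exact ⟨a, b, c, d, hi, h2, h4⟩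

lemma LinearPair.pass {f g : A K} (h : LinearPair f g) : Pass (f, g) (Sum.inl true) := by
  obtain ⟨a, b, c, d, h0, h1, h2⟩ := h
  obtain ⟨h3, h4⟩ := bideg_lead_linear h1 (by rintro ⟨rfl, rfl⟩; simp at h0)
  obtain ⟨h5, h6⟩ := bideg_lead_linear h2 (by rintro ⟨rfl, rfl⟩; simp at h0)
  refine .step_one_yes ⟨not_someInZ.2 ⟨?_, ?_⟩, h3, h5⟩ ?_
  · rw [one_zero_le_bideg, h3]
  · rw [one_zero_le_bideg, h5]
  · rw [h4, h6, linearIndependent_linear]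
    exact h0

lemma LinearPair.notMem {f g : A K} (h : LinearPair f g) :
    f ∉ algZ K ∧ g ∉ algZ K ∧ bideg f = bideg g := by
  obtain ⟨a, b, c, d, h0, h1, h2⟩ := h
  obtain ⟨h3, h4⟩ := bideg_lead_linear h1 (by rintro ⟨rfl, rfl⟩; simp at h0)
  obtain ⟨h5, h6⟩ := bideg_lead_linear h2 (by rintro ⟨rfl, rfl⟩; simp at h0)
  rw [one_zero_le_bideg, one_zero_le_bideg, h3, h5]
  exact ⟨le_rfl, le_rfl, rfl⟩

lemma LinearPair.linear {f g : A K} (h : LinearPair f g) {a b c d : K} (h0 : a * d - b * c ≠ 0) :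
    LinearPair (a • f + b • g) (c • f + d • g) := by
  obtain ⟨a', b', c', d', h0', h1, h2⟩ := h
  refine ⟨a * a' + b * c', a * b' + b * d', c * a' + d * c', c * b' + d * d', ?_, ?_, ?_⟩
  · have : (a * a' + b * c') * (c * b' + d * d') - (a * b' + b * d') * (c * a' + d * c') =
      (a * d - b * c) * (a' * d' - b' * c') := by ring
    rw [this]
    exact mul_ne_zero h0 h0'
  · have := Subalgebra.add_mem _ (Subalgebra.smul_mem _ h1 a) (Subalgebra.smul_mem _ h2 b)
    convert this using 1
    module
  · have := Subalgebra.add_mem _ (Subalgebra.smul_mem _ h1 c) (Subalgebra.smul_mem _ h2 d)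
    convert this using 1
    module

lemma LinearPair.translate {f g p r : A K} (h : LinearPair f g) (hp : p ∈ algZ K)
    (hr : r ∈ algZ K) : LinearPair (f + p) (g + r) := by
  obtain ⟨a, b, c, d, h0, h1, h2⟩ := h
  refine ⟨a, b, c, d, h0, ?_, ?_⟩
  · rw [add_sub_right_comm]; exact Subalgebra.add_mem _ h1 hp
  · rw [add_sub_right_comm]; exact Subalgebra.add_mem _ h2 hr

end LinearPairs

/-! ### Non-automorphisms, and elementary moves that preserve tameness. -/

section Automorphisms

variable {K : Type*} [Field K]

@[simp] lemma zEnd_X (φ : A K × A K) : zEnd φ (X K) = φ.1 := by simp [zEnd, X]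

@[simp] lemma zEnd_Y (φ : A K × A K) : zEnd φ (Y K) = φ.2 := by simp [zEnd, Y]

@[simp] lemma zEnd_Z (φ : A K × A K) : zEnd φ (Z K) = Z K := by
  conv_lhs => rw [Z]
  simp [zEnd]

lemma algHom_ext_XYZ {F G : A K →ₐ[K] A K} (hX : F (X K) = G (X K)) (hY : F (Y K) = G (Y K))
    (hZ : F (Z K) = G (Z K)) : F = G := by
  apply FreeAlgebra.hom_ext
  funext i
  fin_cases i
  · exact hX
  · exact hY
  · exact hZ

lemma algHom_eq_zEnd {F : A K →ₐ[K] A K} (hZ : F (Z K) = Z K) : F = zEnd (F (X K), F (Y K)) :=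
  algHom_ext_XYZ (by simp) (by simp) (by simp [hZ])

lemma zEnd_of_mem_algZ (φ : A K × A K) {p : A K} (hp : p ∈ algZ K) : zEnd φ p = p := by
  induction hp using Algebra.adjoin_induction with
  | mem x hx => rw [Set.mem_singleton_iff.1 hx, zEnd_Z]
  | algebraMap r => simp
  | add x y _ _ hx hy => rw [map_add, hx, hy]
  | mul x y _ _ hx hy => rw [map_mul, hx, hy]

lemma zEnd_of_mem_algYZ (φ : A K × A K) {p : A K} (hp : p ∈ algYZ K) :
    zEnd φ p = substHom φ.2 p := by
  induction hp using Algebra.adjoin_induction with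
  | mem x hx =>
    rcases hx with rfl | rfl
    · simp
    · simp
  | algebraMap r => simp
  | add x y _ _ hx hy => rw [map_add, map_add, hx, hy]
  | mul x y _ _ hx hy => rw [map_mul, map_mul, hx, hy]

lemma X_notMem_algZ : X K ∉ algZ K := by
  rw [mem_algZ, X_eq_ofWord, ofWord_mem_inWords_iff]
  intro h
  simpa using h 0 (by simp)

lemma Y_notMem_algZ : Y K ∉ algZ K := by
  rw [mem_algZ, Y_eq_ofWord, ofWord_mem_inWords_iff]
  intro h
  simpa using h 1 (by simp)

/-- A `z`-endomorphism fixes `K[z]`, so a component `f ∈ K[z]` has the same image as `x`; similarly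
for `y`. -/
lemma not_injective_of_someInZ {φ : A K × A K} (h : SomeInZ φ) :
    ¬ Function.Injective (zEnd φ) := by
  intro hinj
  rcases h with h | h
  · have : X K = φ.1 := hinj (by rw [zEnd_X, zEnd_of_mem_algZ φ h])
    exact X_notMem_algZ (this ▸ h)
  · have : Y K = φ.2 := hinj (by rw [zEnd_Y, zEnd_of_mem_algZ φ h])
    exact Y_notMem_algZ (this ▸ h)

/-- A relation between the leading components gives `s f + t g ∈ K[z]`; this element is fixed and is
also the image of `s x + t y`. -/
lemma not_injective_of_dependent {φ : A K × A K} (h : BothLinear φ)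
    (hi : ¬ LinearIndependent K ![lead φ.1, lead φ.2]) : ¬ Function.Injective (zEnd φ) := by
  intro hinj
  rw [LinearIndependent.pair_iff] at hi
  push Not at hi
  obtain ⟨s, t, h0, hst⟩ := hi
  have hr : s • φ.1 + t • φ.2 ∈ algZ K := by
    have h1 := Subalgebra.smul_mem _ (mem_algZ_iff_ltB.2 (h.2.1 ▸ sub_lead_mem_ltB φ.1)) s
    have h2 := Subalgebra.smul_mem _ (mem_algZ_iff_ltB.2 (h.2.2 ▸ sub_lead_mem_ltB φ.2)) t
    convert Subalgebra.add_mem _ h1 h2 using 1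
    rw [smul_sub, smul_sub, sub_add_sub_comm, h0, sub_zero]
  have heq : s • X K + t • Y K = s • φ.1 + t • φ.2 := hinj (by
    rw [zEnd_of_mem_algZ φ hr]; simp)
  rw [← heq] at hr
  by_cases h1 : s = 0 ∧ t = 0
  · exact hst h1.1 h1.2
  · have := (bideg_lead_linear (p := s • X K + t • Y K) (a := s) (b := t)
      (by rw [sub_self]; exact Subalgebra.zero_mem _) h1).1
    rw [mem_algZ_iff_bideg, this] at hr
    exact lt_irrefl _ hr

theorem not_bijective_of_rejected {φ : A K × A K}
    (h : SomeInZ φ ∨ (BothLinear φ ∧ ¬ LinearIndependent K ![lead φ.1, lead φ.2])) :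
    ¬ Function.Bijective (zEnd φ) := fun hb =>
  h.elim (fun h => not_injective_of_someInZ h hb.1)
    fun h => not_injective_of_dependent h.1 h.2 hb.1

/-- The automorphism given by two mutually inverse `z`-endomorphisms. -/
noncomputable def zEquiv (φ ψ : A K × A K) (h1 : zEnd φ ψ.1 = X K) (h2 : zEnd φ ψ.2 = Y K)
    (h3 : zEnd ψ φ.1 = X K) (h4 : zEnd ψ φ.2 = Y K) : A K ≃ₐ[K] A K :=
  AlgEquiv.ofAlgHom (zEnd φ) (zEnd ψ)
    (algHom_ext_XYZ (by simp [h1]) (by simp [h2]) (by simp))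
    (algHom_ext_XYZ (by simp [h3]) (by simp [h4]) (by simp))

/-- Multiplying by `e` on the right substitutes the pair `φ` into the formulas for `e`. Linear,
translating and elementary changes of a pair all arise in this way. -/
lemma IsZTame.comp {φ : A K × A K} (h : IsZTame φ) {e : A K ≃ₐ[K] A K} (he : e ∈ tameGroup K)
    (hZ : e (Z K) = Z K) : IsZTame (zEnd φ (e (X K)), zEnd φ (e (Y K))) := by
  obtain ⟨e', he', h'⟩ := h
  refine ⟨e' * e, Subgroup.mul_mem _ he' he, ?_⟩
  have h'' : ∀ p, e' p = zEnd φ p := fun p => DFunLike.congr_fun h' p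
  apply algHom_ext_XYZ
  · simpa using h'' _
  · simpa using h'' _
  · change e' (e (Z K)) = _
    rw [hZ, h'']; simp

lemma isZTame_id : IsZTame (X K, Y K) :=
  ⟨1, Subgroup.one_mem _, algHom_ext_XYZ (by simp) (by simp) (by simp)⟩

lemma IsZTame.linear {f g : A K} (h : IsZTame (f, g)) {a b c d : K} (h0 : a * d - b * c ≠ 0) :
    IsZTame (a • f + b • g, c • f + d • g) := by
  -- `D` is the inverse determinant, so the second pair passed to `zEquiv` is Cramer's formula for
  -- the inverse.
  obtain ⟨D, hD⟩ : ∃ D, (a * d - b * c) * D = 1 := ⟨_, mul_inv_cancel₀ h0⟩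
  let e : A K ≃ₐ[K] A K := zEquiv (a • X K + b • Y K, c • X K + d • Y K)
    ((D * d) • X K - (D * b) • Y K, (D * a) • Y K - (D * c) • X K)
    (by
      simp only [map_sub, map_smul, zEnd_X, zEnd_Y]
      match_scalars <;> first | ring1 | linear_combination hD)
    (by
      simp only [map_sub, map_smul, zEnd_X, zEnd_Y]
      match_scalars <;> first | ring1 | linear_combination hD)
    (by
      simp only [map_add, map_smul, zEnd_X, zEnd_Y]
      match_scalars <;> first | ring1 | linear_combination hD)
    (by
      simp only [map_add, map_smul, zEnd_X, zEnd_Y]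
      match_scalars <;> first | ring1 | linear_combination hD)
  have hZ : e (Z K) = Z K := zEnd_Z _
  have he : e ∈ tameGroup K := by
    -- In `IsZAffine` the coefficients of the image of `x` form the first column, hence the
    -- transposed matrix.
    refine Subgroup.subset_closure (Or.inl ⟨hZ, !![a, c; b, d], 0, 0, ?_, ?_, ?_⟩)
    · rw [Matrix.det_fin_two_of, isUnit_iff_ne_zero]
      convert h0 using 1
      ring
    · change zEnd _ _ = _
      simp
    · change zEnd _ _ = _
      simp
  have := h.comp he hZ
  have hX : zEnd (f, g) (e (X K)) = a • f + b • g := by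
    change zEnd _ (zEnd _ _) = _
    simp
  have hY : zEnd (f, g) (e (Y K)) = c • f + d • g := by
    change zEnd _ (zEnd _ _) = _
    simp
  rwa [hX, hY] at this

lemma IsZTame.translate {f g p r : A K} (h : IsZTame (f, g)) (hp : p ∈ algZ K) (hr : r ∈ algZ K) :
    IsZTame (f + p, g + r) := by
  let e : A K ≃ₐ[K] A K := zEquiv (X K + p, Y K + r) (X K - p, Y K - r)
    (by simp [zEnd_of_mem_algZ _ hp]) (by simp [zEnd_of_mem_algZ _ hr])
    (by simp [zEnd_of_mem_algZ _ hp]) (by simp [zEnd_of_mem_algZ _ hr])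
  have hZ : e (Z K) = Z K := zEnd_Z _
  have he : e ∈ tameGroup K := by
    refine Subgroup.subset_closure (Or.inr ⟨hZ, 1, 1, p, r, one_ne_zero, one_ne_zero,
      algZ_le_algYZ hp, hr, ?_, ?_⟩)
    · change zEnd _ _ = _
      simp
    · change zEnd _ _ = _
      simp
  have := h.comp he hZ
  have hX : zEnd (f, g) (e (X K)) = f + p := by
    change zEnd _ (zEnd _ _) = _
    simp [zEnd_of_mem_algZ _ hp]
  have hY : zEnd (f, g) (e (Y K)) = g + r := by
    change zEnd _ (zEnd _ _) = _
    simp [zEnd_of_mem_algZ _ hr]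
  rwa [hX, hY] at this

lemma IsZTame.elementary {f g p : A K} (h : IsZTame (f, g)) (hp : p ∈ algYZ K) :
    IsZTame (f + substHom g p, g) := by
  -- `substHom (Y K)` kills `x`, so it is the identity only on `K⟨y,z⟩`; this is seen by comparison
  -- with the identity `z`-endomorphism.
  have hpY : substHom (Y K) p = p := by
    have : zEnd (X K, Y K) = AlgHom.id K (A K) := algHom_ext_XYZ (by simp) (by simp) (by simp)
    rw [← zEnd_of_mem_algYZ (X K, Y K) hp, this, AlgHom.id_apply]
  let e : A K ≃ₐ[K] A K := zEquiv (X K + p, Y K) (X K - p, Y K)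
    (by simp [zEnd_of_mem_algYZ _ hp, hpY]) (by simp)
    (by simp [zEnd_of_mem_algYZ _ hp, hpY]) (by simp)
  have hZ : e (Z K) = Z K := zEnd_Z _
  have he : e ∈ tameGroup K := by
    refine Subgroup.subset_closure (Or.inr ⟨hZ, 1, 1, p, 0, one_ne_zero, one_ne_zero,
      hp, Subalgebra.zero_mem _, ?_, ?_⟩)
    · change zEnd _ _ = _
      simp
    · change zEnd _ _ = _
      simp
  have := h.comp he hZ
  have hX : zEnd (f, g) (e (X K)) = f + substHom g p := by
    change zEnd _ (zEnd _ _) = _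
    simp [zEnd_of_mem_algYZ _ hp]
  have hY : zEnd (f, g) (e (Y K)) = g := by
    change zEnd _ (zEnd _ _) = _
    simp
  rwa [hX, hY] at this

lemma IsZTame.swap {f g : A K} (h : IsZTame (f, g)) : IsZTame (g, f) := by
  have := h.linear (a := 0) (b := 1) (c := 1) (d := 0) (by simp)
  simpa using this

lemma isZTame_sub_iff {f g p : A K} (hp : p ∈ algYZ K) :
    IsZTame (f, g) ↔ IsZTame (f - substHom g p, g) := by
  constructor
  · intro h
    have := h.elementary (Subalgebra.neg_mem _ hp)
    rwa [map_neg, ← sub_eq_add_neg] at this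
  · intro h
    have := h.elementary hp
    rwa [sub_add_cancel] at this

theorem isZTame_iff_of_pass {φ φ' : A K × A K} (h : Pass φ (Sum.inr φ')) :
    IsZTame φ ↔ IsZTame φ' := by
  cases h with
  | step_two_go h β q hq =>
    obtain ⟨r, hr, -, h2⟩ := hq.exists_reduced
    rw [h2]
    exact isZTame_sub_iff hr
  | step_three_go h β q hq =>
    obtain ⟨r, hr, -, h2⟩ := hq.exists_reduced
    rw [h2]
    exact ⟨fun h => ((isZTame_sub_iff hr).1 h.swap).swap,
      fun h => ((isZTame_sub_iff hr).2 h.swap).swap⟩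

lemma LinearPair.isZTame {f g : A K} (h : LinearPair f g) : IsZTame (f, g) := by
  obtain ⟨a, b, c, d, h0, h1, h2⟩ := h
  have := (isZTame_id.linear h0).translate h1 h2
  simpa using this

lemma LinearPair.isLinearTimesTranslation {f g : A K} (h : LinearPair f g) :
    IsLinearTimesTranslation (f, g) := by
  obtain ⟨a, b, c, d, h0, h1, h2⟩ := h
  refine ⟨!![a, c; b, d], _, _, ?_, h1, h2, ?_⟩
  · rw [Matrix.det_fin_two_of, isUnit_iff_ne_zero]
    convert h0 using 1
    ring
  · apply algHom_ext_XYZ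
    · rw [AlgHom.comp_apply, zEnd_X, zEnd_X, map_add, zEnd_of_mem_algZ _ h1]
      simp
    · rw [AlgHom.comp_apply, zEnd_Y, zEnd_Y, map_add, zEnd_of_mem_algZ _ h2]
      simp
    · simp

theorem pass_true {φ : A K × A K} (h : Pass φ (Sum.inl true)) :
    IsZTame φ ∧ IsLinearTimesTranslation φ := by
  cases h with
  | step_one_yes h hi =>
    have := h.linearPair hi
    exact ⟨this.isZTame, this.isLinearTimesTranslation⟩

end Automorphisms

/-! ### A normal form for tame automorphisms; tame pairs are never rejected. -/

section TamePairs

variable {K : Type*} [Field K]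

/-- Pairs `(f, g)` obtained from a pair of linear forms by alternately adding
to one component a polynomial in the other one of bidegree larger than `(1,0)`; the first component
is the one changed last. -/
inductive GrownPair : A K → A K → Prop
  | start {h g p : A K} (hl : LinearPair h g) (hp : p ∈ algYZ K) (hb : toLex (1, 0) < bideg p) :
      GrownPair (h + substHom g p) g
  | step {h g p : A K} (hl : GrownPair g h) (hp : p ∈ algYZ K) (hb : toLex (1, 0) < bideg p) :
      GrownPair (h + substHom g p) g

/-- Since `bideg p > (1,0)`, strict monotonicity of `tau` puts `p(g,z)` above `g`, hence above `h`,
and it alone determines the leading component. -/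
lemma bideg_lead_add_substHom {h g p : A K} (hg : g ∉ algZ K) (hle : bideg h ≤ bideg g)
    (hp : p ∈ algYZ K) (hb : toLex (1, 0) < bideg p) :
    bideg g < bideg (h + substHom g p) ∧
      lead (h + substHom g p) = substHom (lead g) (lead p) := by
  have hp0 : p ≠ 0 := by
    rintro rfl
    have : bideg (0 : A K) = 0 := by simp [bideg]; rfl
    rw [this] at hb
    exact absurd hb (by decide)
  obtain ⟨h1, h2⟩ := lead_substHom hg hp hp0
  have h3 := tau_lt_tau (one_zero_le_bideg.1 hg) hb
  rw [tau_one_zero, ← h1] at h3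
  have h4 : substHom g p ≠ 0 := by
    intro h0
    exact hp0 (substHom_injOn hg hp (Subalgebra.zero_mem _) (by rw [h0, map_zero]))
  obtain ⟨h5, h6⟩ := bideg_lead_add_of_lt h4 (Or.inr (hle.trans_lt h3))
  rw [add_comm, h5, h6, h2]
  exact ⟨h3, rfl⟩

/-- Each step raises the changed component above the other one, which is the hypothesis needed for
the next step with the roles exchanged. The last clause is what makes a reduction of the procedure
applicable. -/
lemma GrownPair.properties {f g : A K} (h : GrownPair f g) :
    f ∉ algZ K ∧ g ∉ algZ K ∧ bideg g < bideg f ∧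
      ∃ p ∈ algYZ K, lead f = substHom (lead g) p := by
  induction h with
  | start hl hp hb =>
    obtain ⟨h1, h2, h3⟩ := hl.notMem
    obtain ⟨h4, h5⟩ := bideg_lead_add_substHom h2 h3.le hp hb
    refine ⟨?_, h2, h4, _, lead_mem_algYZ hp, h5⟩
    rw [one_zero_le_bideg] at h2 ⊢
    exact h2.trans h4.le
  | step _ hp hb ih =>
    obtain ⟨h1, h2, h3, -⟩ := ih
    obtain ⟨h4, h5⟩ := bideg_lead_add_substHom h1 h3.le hp hb
    refine ⟨?_, h1, h4, _, lead_mem_algYZ hp, h5⟩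
    rw [one_zero_le_bideg] at h1 ⊢
    exact h1.trans h4.le

/-- If `g` is replaced by `b g + r`, the summand `a p(g,z) + c g` must be rewritten as a polynomial
in the new component. The rewritten polynomial still has bidegree above `(1,0)`, so the growth
condition persists. -/
lemma bideg_affine_change {p r : A K} {a b c : K} (ha : a ≠ 0) (hb : b ≠ 0) (hp : p ∈ algYZ K)
    (hr : r ∈ algZ K) (h : toLex (1, 0) < bideg p) :
    substHom (b⁻¹ • Y K - b⁻¹ • r) (a • p + c • Y K) ∈ algYZ K ∧
      toLex (1, 0) < bideg (substHom (b⁻¹ • Y K - b⁻¹ • r) (a • p + c • Y K)) := by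
  have hlin : ∀ b : K, b ≠ 0 → bideg (b • Y K) = toLex (1, 0) := fun b hb =>
    (bideg_lead_linear (a := 0) (b := b) (by simp) (by simp [hb])).1
  have hg1 : bideg (b⁻¹ • Y K - b⁻¹ • r) = toLex (1, 0) :=
    (bideg_lead_linear (a := 0) (b := b⁻¹) (by
      simpa using Subalgebra.smul_mem _ hr b⁻¹) (by simp [hb])).1
  have hg : b⁻¹ • Y K - b⁻¹ • r ∉ algZ K := by rw [one_zero_le_bideg, hg1]
  have hgm : b⁻¹ • Y K - b⁻¹ • r ∈ algYZ K := Subalgebra.sub_mem _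
    (Subalgebra.smul_mem _ Y_mem_algYZ _) (Subalgebra.smul_mem _ (algZ_le_algYZ hr) _)
  have hp0 : p ≠ 0 := ne_zero_of_notMem_algZ (one_zero_le_bideg.2 h.le)
  have hq : bideg (a • p + c • Y K) = bideg p := by
    rw [← (bideg_lead_smul ha p).1]
    refine (bideg_lead_add_of_lt (smul_ne_zero ha hp0) ?_).1
    by_cases hc : c = 0
    · left; simp [hc]
    · right; rwa [hlin c hc, (bideg_lead_smul ha p).1]
  have hqm : a • p + c • Y K ∈ algYZ K := Subalgebra.add_mem _ (Subalgebra.smul_mem _ hp _)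
    (Subalgebra.smul_mem _ Y_mem_algYZ _)
  refine ⟨substHom_mem_algYZ hgm hqm, ?_⟩
  have hq0 : a • p + c • Y K ≠ 0 :=
    ne_zero_of_notMem_algZ (one_zero_le_bideg.2 (by rw [hq]; exact h.le))
  rw [(lead_substHom hg hqm hq0).1, hg1, one_zero_tau, hq]
  exact h

lemma substHom_affine_change {g p r : A K} {a b c : K} (hb : b ≠ 0) (hr : r ∈ algZ K) :
    substHom (b • g + r) (substHom (b⁻¹ • Y K - b⁻¹ • r) (a • p + c • Y K)) =
      a • substHom g p + c • g := by
  rw [substHom_substHom, map_sub, map_smul, map_smul, substHom_Y, substHom_of_mem_algZ _ hr,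
    smul_add, smul_smul, inv_mul_cancel₀ hb, one_smul, add_sub_cancel_right, map_add, map_smul,
    map_smul, substHom_Y]

/-- An affine change that is triangular with respect to the order of growth can be pushed down the
construction: the multiple `c g` is absorbed into the last polynomial, and what remains is a
diagonal change with translation one level lower. -/
lemma GrownPair.affine {f g : A K} (h : GrownPair f g) : ∀ {a b c : K} {p r : A K},
    a ≠ 0 → b ≠ 0 → p ∈ algZ K → r ∈ algZ K → GrownPair (a • f + c • g + p) (b • g + r) := by
  induction h with
  | @start h g q hl hq hd =>
    intro a b c p r ha hb hp hr
    obtain ⟨h1, h2⟩ := bideg_affine_change (c := c) ha hb hq hr hd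
    have hl' := (hl.linear (a := a) (b := 0) (c := 0) (d := b) (by simp [ha, hb])).translate hp hr
    rw [zero_smul, zero_smul, add_zero, zero_add] at hl'
    convert GrownPair.start hl' h1 h2 using 1
    rw [substHom_affine_change hb hr]
    module
  | @step h g q hl hq hd ih =>
    intro a b c p r ha hb hp hr
    obtain ⟨h1, h2⟩ := bideg_affine_change (c := c) ha hb hq hr hd
    -- The earlier grown pair has the components in the opposite order, so scalars and translations
    -- are interchanged; no multiple has to be added there.
    have hl' := ih (a := b) (b := a) (c := 0) (p := r) (r := p) hb ha hr hp
    rw [zero_smul, add_zero] at hl'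
    convert GrownPair.step hl' h1 h2 using 1
    rw [substHom_affine_change hb hr]
    module

/-- Linear pairs, and grown pairs up to a linear change. -/
def TamePair (f g : A K) : Prop :=
  LinearPair f g ∨ ∃ s t : A K, GrownPair s t ∧ ∃ a b c d : K, a * d - b * c ≠ 0 ∧
    f = a • s + b • t ∧ g = c • s + d • t

lemma GrownPair.tamePair {f g : A K} (h : GrownPair f g) : TamePair f g :=
  Or.inr ⟨f, g, h, 1, 0, 0, 1, by simp, by simp, by simp⟩

lemma TamePair.linear {f g : A K} (h : TamePair f g) {a b c d : K} (h0 : a * d - b * c ≠ 0) :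
    TamePair (a • f + b • g) (c • f + d • g) := by
  rcases h with h | ⟨s, t, hst, a', b', c', d', h0', rfl, rfl⟩
  · exact Or.inl (h.linear h0)
  · refine Or.inr ⟨s, t, hst, a * a' + b * c', a * b' + b * d', c * a' + d * c', c * b' + d * d',
      ?_, by module, by module⟩
    have : (a * a' + b * c') * (c * b' + d * d') - (a * b' + b * d') * (c * a' + d * c') =
      (a * d - b * c) * (a' * d' - b' * c') := by ring
    rw [this]
    exact mul_ne_zero h0 h0'

lemma TamePair.swap {f g : A K} (h : TamePair f g) : TamePair g f := by
  simpa using h.linear (a := 0) (b := 1) (c := 1) (d := 0) (by simp)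

lemma TamePair.translate {f g p r : A K} (h : TamePair f g) (hp : p ∈ algZ K) (hr : r ∈ algZ K) :
    TamePair (f + p) (g + r) := by
  rcases h with h | ⟨s, t, hst, a, b, c, d, h0, rfl, rfl⟩
  · exact Or.inl (h.translate hp hr)
  · obtain ⟨D, hD⟩ : ∃ D, (a * d - b * c) * D = 1 := ⟨_, mul_inv_cancel₀ h0⟩
    -- The translation is the inverse matrix applied to `(p, r)`, so that the linear change
    -- afterwards turns it back into `(p, r)`.
    have hst' := hst.affine (a := 1) (b := 1) (c := 0) one_ne_zero one_ne_zero
      (p := (D * d) • p - (D * b) • r) (r := (D * a) • r - (D * c) • p)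
      (Subalgebra.sub_mem _ (Subalgebra.smul_mem _ hp _) (Subalgebra.smul_mem _ hr _))
      (Subalgebra.sub_mem _ (Subalgebra.smul_mem _ hr _) (Subalgebra.smul_mem _ hp _))
    refine Or.inr ⟨_, _, hst', a, b, c, d, h0, ?_, ?_⟩
    · match_scalars <;> first | ring1 | linear_combination -hD
    · match_scalars <;> first | ring1 | linear_combination -hD

lemma exists_affine_of_bideg_le {p : A K} (hp : p ∈ algYZ K) (h : ¬ toLex (1, 0) < bideg p) :
    ∃ c : K, ∃ r ∈ algZ K, p = c • Y K + r := by
  rcases (not_lt.1 h).lt_or_eq with h | h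
  · exact ⟨0, p, mem_algZ_iff_bideg.2 h, by simp⟩
  · obtain ⟨a, b, h1, h2⟩ := exists_linear_of_bideg h
    -- An element of `K⟨y,z⟩` contains no `x`.
    have ha : a = 0 := by
      by_contra ha
      have := lead_mem_algYZ hp
      rw [mem_algYZ, mem_inWords] at this
      refine this (FreeMonoid.of 0) ?_ 0 (by simp) rfl
      rwa [h1, coeffs_linear_zero]
    subst ha
    rw [zero_smul, zero_add] at h2
    exact ⟨b, _, h2, by abel⟩

/-- A polynomial of bidegree at most `(1,0)` only contributes an affine change. -/
lemma TamePair.elementary_of_bideg_le {f g p : A K} (h : TamePair f g) (hp : p ∈ algYZ K)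
    (hb : ¬ toLex (1, 0) < bideg p) : TamePair (f + substHom g p) g := by
  obtain ⟨c, r, hr, rfl⟩ := exists_affine_of_bideg_le hp hb
  have := (h.linear (a := 1) (b := c) (c := 0) (d := 1) (by simp)).translate hr
    (Subalgebra.zero_mem _)
  convert this using 1
  · rw [map_add, map_smul, substHom_Y, substHom_of_mem_algZ _ hr]; module
  · module

/-- A second change of the same component merges with the last one into `q + p`. If this sum drops
to bidegree at most `(1,0)`, the last step has degenerated to an affine change of the earlier pair.
-/
lemma GrownPair.elementary_fst {f g p : A K} (h : GrownPair f g) (hp : p ∈ algYZ K) :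
    TamePair (f + substHom g p) g := by
  have key : ∀ {h g q : A K}, TamePair h g → q ∈ algYZ K →
      (∀ q ∈ algYZ K, toLex (1, 0) < bideg q → GrownPair (h + substHom g q) g) →
      TamePair (h + substHom g q + substHom g p) g := by
    intro h g q hT hq hG
    have hqp := Subalgebra.add_mem _ hq hp
    rw [add_assoc, ← map_add]
    by_cases hb : toLex (1, 0) < bideg (q + p)
    · exact (hG _ hqp hb).tamePair
    · exact hT.elementary_of_bideg_le hqp hb
  cases h with
  | start hl hq hd => exact key (Or.inl hl) hq fun q hq hb => GrownPair.start hl hq hb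
  | step hl hq hd => exact key hl.tamePair.swap hq fun q hq hb => GrownPair.step hl hq hb

lemma GrownPair.elementary_snd {f g p : A K} (h : GrownPair f g) (hp : p ∈ algYZ K) :
    TamePair (g + substHom f p) f := by
  by_cases hb : toLex (1, 0) < bideg p
  · exact (GrownPair.step h hp hb).tamePair
  · exact h.tamePair.swap.elementary_of_bideg_le hp hb

/-- If `c = 0`, the added polynomial depends on `t` only and merges with the last step of growth. If
`c ≠ 0`, then `c s + d t` can serve as the component changed last, and the addition is a new step of
growth applied to `t`. -/
lemma TamePair.elementary {f g p : A K} (h : TamePair f g) (hp : p ∈ algYZ K) :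
    TamePair (f + substHom g p) g := by
  rcases h with h | ⟨s, t, hst, a, b, c, d, h0, rfl, rfl⟩
  · by_cases hb : toLex (1, 0) < bideg p
    · exact (GrownPair.start h hp hb).tamePair
    · exact TamePair.elementary_of_bideg_le (Or.inl h) hp hb
  · by_cases hc : c = 0
    · subst hc
      have ha : a ≠ 0 := by rintro rfl; simp at h0
      have hd : d ≠ 0 := by rintro rfl; simp at h0
      -- `a⁻¹ p(d y, z)`: added to `s`, it contributes `p(d t, z)` after multiplication by `a`.
      have hp' : substHom (d • Y K) (a⁻¹ • p) ∈ algYZ K := substHom_mem_algYZ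
        (Subalgebra.smul_mem _ Y_mem_algYZ _) (Subalgebra.smul_mem _ hp _)
      have := (hst.elementary_fst hp').linear (a := a) (b := b) (c := 0) (d := d) (by simpa using h0)
      convert this using 1
      · rw [← substHom_smul, map_smul, zero_smul, zero_add, smul_add, smul_smul,
          mul_inv_cancel₀ ha, one_smul]
        module
      · module
    · have h1 := hst.affine (a := c) (b := 1) (c := d) hc one_ne_zero (Subalgebra.zero_mem _)
        (Subalgebra.zero_mem _)
      rw [one_smul, add_zero, add_zero] at h1
      -- Here `f = (a/c)(c s + d t) + (b - ad/c) t`; the coefficient of `t` is nonzero because it is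
      -- `-(ad - bc)/c`.
      have he : b - a * d / c ≠ 0 := by
        intro h
        apply h0
        field_simp at h
        linear_combination -h
      have := (h1.elementary_snd (Subalgebra.smul_mem _ hp (b - a * d / c)⁻¹)).linear
        (a := b - a * d / c) (b := a / c) (c := 0) (d := 1) (by simpa using he)
      convert this using 1
      · rw [map_smul, smul_add, smul_smul, mul_inv_cancel₀ he, one_smul]
        match_scalars <;> field_simp
        ring
      · module

/-- Replacing `(f, g)` by an affine image can be undone. -/
lemma TamePair.of_affine {f g r r' : A K} {a b c d : K} (h0 : a * d - b * c ≠ 0)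
    (hr : r ∈ algZ K) (hr' : r' ∈ algZ K)
    (h : TamePair (a • f + b • g + r) (c • f + d • g + r')) : TamePair f g := by
  obtain ⟨D, hD⟩ : ∃ D, (a * d - b * c) * D = 1 := ⟨_, mul_inv_cancel₀ h0⟩
  have h1 := h.translate (Subalgebra.neg_mem _ hr) (Subalgebra.neg_mem _ hr')
  have h2 := h1.linear (a := D * d) (b := -(D * b)) (c := -(D * c)) (d := D * a) (by
    have : D * d * (D * a) - -(D * b) * -(D * c) = D * ((a * d - b * c) * D) := by ring
    rw [this, hD, mul_one]
    exact right_ne_zero_of_mul_eq_one hD)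
  convert h2 using 1
  · match_scalars <;> first | ring1 | linear_combination -hD
  · match_scalars <;> first | ring1 | linear_combination -hD

lemma TamePair.of_elementary {f g p : A K} (hp : p ∈ algYZ K)
    (h : TamePair (f + substHom g p) g) : TamePair f g := by
  have := h.elementary (Subalgebra.neg_mem _ hp)
  rwa [map_neg, add_neg_cancel_right] at this

lemma affine_part_mem_algZ (c b : K) : c • Z K + algebraMap K (A K) b ∈ algZ K :=
  Subalgebra.add_mem _ (Subalgebra.smul_mem _ Z_mem_algZ _) (Subalgebra.algebraMap_mem _ _)

/-- Right multiplication by a generator is a linear change, a translation or an elementary addition,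
and tame pairs are closed under all of these and under undoing them. -/
lemma tamePair_of_mem_tameGroup {e : A K ≃ₐ[K] A K} (he : e ∈ tameGroup K) :
    e (Z K) = Z K ∧ TamePair (e (X K)) (e (Y K)) := by
  have hsub : ∀ (x : A K ≃ₐ[K] A K), x (Z K) = Z K → ∀ p ∈ algYZ K, x p = substHom (x (Y K)) p := by
    intro x hx p hp
    have := algHom_eq_zEnd (F := (x : A K →ₐ[K] A K)) hx
    have h := DFunLike.congr_fun this p
    rw [zEnd_of_mem_algYZ _ hp] at h
    exact h
  have hfix : ∀ (x : A K ≃ₐ[K] A K), x (Z K) = Z K → ∀ p ∈ algZ K, x p = p := by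
    intro x hx p hp
    rw [hsub x hx p (algZ_le_algYZ hp), substHom_of_mem_algZ _ hp]
  induction he using Subgroup.closure_induction_right with
  | one => exact ⟨rfl, Or.inl ⟨1, 0, 0, 1, by simp, by simp, by simp⟩⟩
  | mul_right x hx y hy ih =>
    obtain ⟨hZ, hT⟩ := ih
    rcases hy with ⟨hyZ, α, γ, β, hα, hX, hY⟩ | ⟨hyZ, a₁, a₂, p₁, p₂, ha₁, ha₂, hp₁, hp₂, hX, hY⟩
    · refine ⟨by rw [AlgEquiv.mul_apply, hyZ, hZ], ?_⟩
      rw [AlgEquiv.mul_apply, AlgEquiv.mul_apply, hX, hY, add_assoc, add_assoc _ (γ 1 • _)]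
      simp only [map_add x (_ + _), hfix x hZ _ (affine_part_mem_algZ _ _)]
      rw [map_add, map_add, map_smul, map_smul, map_smul, map_smul]
      refine (hT.linear ?_).translate (affine_part_mem_algZ _ _) (affine_part_mem_algZ _ _)
      rw [Matrix.det_fin_two, isUnit_iff_ne_zero] at hα
      convert hα using 1
      ring
    · refine ⟨by rw [AlgEquiv.mul_apply, hyZ, hZ], ?_⟩
      rw [AlgEquiv.mul_apply, AlgEquiv.mul_apply, hX, hY, map_add, map_add, map_smul, map_smul,
        hsub x hZ p₁ hp₁, hfix x hZ p₂ hp₂]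
      have := ((hT.linear (a := a₁) (b := 0) (c := 0) (d := 1) (by simpa using ha₁)))
      rw [zero_smul, zero_smul, one_smul, add_zero, zero_add] at this
      have := ((this.elementary hp₁).linear (a := 1) (b := 0) (c := 0) (d := a₂)
        (by simpa using ha₂)).translate (Subalgebra.zero_mem _) hp₂
      rwa [zero_smul, zero_smul, one_smul, add_zero, add_zero, zero_add] at this
  | mul_inv_cancel x hx y hy ih =>
    obtain ⟨hZ, hT⟩ := ih
    -- Instead of inverting the formulas for `y`, one writes `x = w y` and recovers the pair of `w`
    -- from that of `x`.
    have hinv : ∀ p, x p = (x * y⁻¹) (y p) := fun p => by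
      rw [AlgEquiv.mul_apply]; congr 1; exact (y.symm_apply_apply p).symm
    generalize x * y⁻¹ = w at hinv
    rw [hinv (X K), hinv (Y K)] at hT
    rw [hinv] at hZ
    rcases hy with ⟨hyZ, α, γ, β, hα, hX, hY⟩ | ⟨hyZ, a₁, a₂, p₁, p₂, ha₁, ha₂, hp₁, hp₂, hX, hY⟩
    · rw [hyZ] at hZ
      refine ⟨hZ, ?_⟩
      rw [hX, hY, add_assoc, add_assoc _ (γ 1 • _)] at hT
      simp only [map_add w (_ + _), hfix w hZ _ (affine_part_mem_algZ _ _)] at hT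
      rw [map_add, map_add, map_smul, map_smul, map_smul, map_smul] at hT
      refine TamePair.of_affine ?_ (affine_part_mem_algZ _ _) (affine_part_mem_algZ _ _) hT
      rw [Matrix.det_fin_two, isUnit_iff_ne_zero] at hα
      convert hα using 1
      ring
    · rw [hyZ] at hZ
      refine ⟨hZ, ?_⟩
      rw [hX, hY, map_add, map_add, map_smul, map_smul, hsub w hZ p₁ hp₁, hfix w hZ p₂ hp₂] at hT
      have h1 : TamePair (a₁ • w (X K) + substHom (w (Y K)) p₁) (w (Y K)) :=
        TamePair.of_affine (a := 1) (b := 0) (c := 0) (d := a₂) (by simpa using ha₂)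
          (Subalgebra.zero_mem _) hp₂ (by
            rwa [zero_smul, zero_smul, one_smul, add_zero, add_zero, zero_add])
      refine TamePair.of_affine (a := a₁) (b := 0) (c := 0) (d := 1) (by simpa using ha₁)
          (Subalgebra.zero_mem _) (Subalgebra.zero_mem _) ?_
      rw [zero_smul, zero_smul, one_smul, add_zero, add_zero, add_zero, zero_add]
      exact h1.of_elementary hp₁

lemma IsZTame.tamePair {φ : A K × A K} (h : IsZTame φ) : TamePair φ.1 φ.2 := by
  obtain ⟨e, he, h⟩ := h
  obtain ⟨-, hT⟩ := tamePair_of_mem_tameGroup he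
  have h' : ∀ p, e p = zEnd φ p := fun p => DFunLike.congr_fun h p
  rwa [h', h', zEnd_X, zEnd_Y] at hT

lemma bideg_lead_combination {s t : A K} {a b : K} (ha : a ≠ 0) (hs : s ≠ 0)
    (h : bideg t < bideg s) :
    bideg (a • s + b • t) = bideg s ∧ lead (a • s + b • t) = a • lead s := by
  obtain ⟨h1, h2⟩ := bideg_lead_smul ha s
  rw [← h1, ← h2]
  refine bideg_lead_add_of_lt (smul_ne_zero ha hs) ?_
  by_cases hb : b = 0
  · left; simp [hb]
  · right; rwa [h1, (bideg_lead_smul hb t).1]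

/-- A tame pair is not rejected. -/
lemma TamePair.not_rejected {f g : A K} (h : TamePair f g) : ¬ Pass (f, g) (Sum.inl false) := by
  rcases h with h | ⟨s, t, hst, a, b, c, d, h0, rfl, rfl⟩
  · intro h'
    simpa using h.pass.unique h'
  -- Outcomes are unique, so exhibiting a reduction excludes rejection.
  suffices h : ∃ φ, Pass (a • s + b • t, c • s + d • t) (Sum.inr φ) by
    obtain ⟨φ, hφ⟩ := h
    intro h'
    simpa using hφ.unique h'
  obtain ⟨h1, h2, h3, p, hp, h4⟩ := hst.properties
  have hs0 := ne_zero_of_notMem_algZ h1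
  have hs1 : toLex (1, 0) < bideg s := (one_zero_le_bideg.1 h2).trans_lt h3
  -- Rescaling the two leading components turns the expression `p` into `e' p(y/e, z)`.
  have hd1 : ∀ e : K, e ≠ 0 → ∀ e' : K, e' ≠ 0 → e' • lead s =
      substHom (e • lead t) (substHom (e⁻¹ • Y K) (e' • p)) := by
    intro e he e' _
    rw [← substHom_smul, smul_smul, inv_mul_cancel₀ he, one_smul, map_smul, h4]
  have hm : ∀ e e' : K, substHom (e⁻¹ • Y K) (e' • p) ∈ algYZ K := fun e e' =>
    substHom_mem_algYZ (Subalgebra.smul_mem _ Y_mem_algYZ _) (Subalgebra.smul_mem _ hp _)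
  -- The larger component `s` may enter only `g` (Step 3), only `f` (Step 2), or both (Step 2 with
  -- equal bidegrees).
  by_cases ha : a = 0
  · subst ha
    have hb : b ≠ 0 := by rintro rfl; simp at h0
    have hc : c ≠ 0 := by rintro rfl; simp at h0
    obtain ⟨h5, h6⟩ := bideg_lead_combination (b := d) hc hs0 h3
    obtain ⟨h7, h8⟩ := bideg_lead_smul hb t
    rw [zero_smul, zero_add]
    have hf : b • t ∉ algZ K := by rw [one_zero_le_bideg, h7]; exact one_zero_le_bideg.1 h2
    have hg : c • s + d • t ∉ algZ K := by rw [one_zero_le_bideg, h5]; exact hs1.le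
    refine ⟨_, .step_three_go ⟨not_someInZ.2 ⟨hf, hg⟩, ?_, ?_⟩ 1 _
      (expresses_of_substHom hg hf (hm b c) ?_)⟩
    · rwa [h5]
    · rwa [h5, h7]
    · rw [h6, h8, ← hd1 b hb c hc]
  · obtain ⟨h5, h6⟩ := bideg_lead_combination (b := b) ha hs0 h3
    have hf : a • s + b • t ∉ algZ K := by rw [one_zero_le_bideg, h5]; exact hs1.le
    by_cases hc : c = 0
    · subst hc
      have hd : d ≠ 0 := by rintro rfl; simp at h0
      obtain ⟨h7, h8⟩ := bideg_lead_smul hd t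
      rw [zero_smul, zero_add]
      have hg : d • t ∉ algZ K := by rw [one_zero_le_bideg, h7]; exact one_zero_le_bideg.1 h2
      refine ⟨_, .step_two_go ⟨not_someInZ.2 ⟨hf, hg⟩, ?_, ?_⟩ 1 _
        (expresses_of_substHom hf hg (hm d a) ?_)⟩
      · rwa [h5]
      · rw [h5, h7]; exact h3.le
      · rw [h6, h8, ← hd1 d hd a ha]
    · obtain ⟨h7, h8⟩ := bideg_lead_combination (b := d) hc hs0 h3
      have hg : c • s + d • t ∉ algZ K := by rw [one_zero_le_bideg, h7]; exact hs1.le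
      -- Both leading components are multiples of `lead s`, with ratio `a / c`; hence a reduction
      -- linear in `y`.
      refine ⟨_, .step_two_go ⟨not_someInZ.2 ⟨hf, hg⟩, ?_, ?_⟩ 1 ((a / c) • Y K)
        (expresses_of_substHom hf hg (Subalgebra.smul_mem _ Y_mem_algYZ _) ?_)⟩
      · rwa [h5]
      · rw [h5, h7]
      · rw [h6, h8, map_smul, substHom_Y, smul_smul, div_mul_cancel₀ _ hc]

theorem pass_false {φ : A K × A K} (h : Pass φ (Sum.inl false)) : ¬ IsZTame φ :=
  fun h' => h'.tamePair.not_rejected h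

end TamePairs


/-! ### Computability of list operations. -/

section ComputableLists

variable {α β σ τ : Type*} [Primcodable α] [Primcodable β] [Primcodable σ] [Primcodable τ]

/-- The fold is simulated by recursion on the number of processed entries, looking each entry up by
its index; up to the length of the list the lookup never fails. The other list operations are
reduced to folds. -/
lemma computable_foldl {f : α → List β} {g : α → σ} {h : α → σ → β → σ} (hf : Computable f)
    (hg : Computable g) (hh : Computable fun p : α × σ × β => h p.1 p.2.1 p.2.2) :
    Computable fun a => (f a).foldl (h a) (g a) := by
  have hstep : Computable₂ fun (a : α) (p : ℕ × σ) =>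
      (Option.casesOn (f a)[p.1]? p.2 fun b => h a p.2 b : σ) := by
    refine Computable.option_casesOn
      (Computable.list_getElem?.comp (hf.comp .fst) (Computable.fst.comp .snd))
      (Computable.snd.comp .snd) ?_
    exact hh.comp ((Computable.fst.comp .fst).pair
      (((Computable.snd.comp .snd).comp .fst).pair .snd))
  refine (Computable.nat_rec (Computable.list_length.comp hf) hg hstep).of_eq fun a => ?_
  have key : ∀ n ≤ (f a).length, Nat.rec (motive := fun _ => σ) (g a)
      (fun y IH => (Option.casesOn (f a)[y]? IH fun b => h a IH b : σ)) n =
        ((f a).take n).foldl (h a) (g a) := by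
    intro n
    induction n with
    | zero => intro _; simp
    | succ n ih =>
      intro hn
      have hlt : n < (f a).length := hn
      rw [List.take_add_one, List.foldl_append, ← ih hlt.le]
      change (Option.casesOn (f a)[n]? _ _ : σ) = _
      rw [List.getElem?_eq_getElem hlt]
      rfl
  have := key _ le_rfl
  rwa [List.take_length] at this

lemma computable_foldr {f : α → List β} {g : α → σ} {h : α → β → σ → σ} (hf : Computable f)
    (hg : Computable g) (hh : Computable fun p : α × β × σ => h p.1 p.2.1 p.2.2) :
    Computable fun a => (f a).foldr (h a) (g a) := by
  refine (computable_foldl (h := fun a s b => h a b s) (Computable.list_reverse.comp hf) hg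
    (hh.comp (Computable.fst.pair
      ((Computable.snd.comp .snd).pair (Computable.fst.comp .snd))))).of_eq fun a => ?_
  rw [List.foldl_reverse]

lemma computable_map {f : α → List β} {g : α → β → σ} (hf : Computable f)
    (hg : Computable fun p : α × β => g p.1 p.2) : Computable fun a => (f a).map (g a) := by
  refine (computable_foldr (h := fun a b s => g a b :: s) hf (Computable.const [])
    (Computable.list_cons.comp (hg.comp (Computable.fst.pair (Computable.fst.comp .snd)))
      (Computable.snd.comp .snd))).of_eq fun a => ?_
  induction f a <;> simp [*]

lemma computable_flatMap {f : α → List β} {g : α → β → List σ} (hf : Computable f)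
    (hg : Computable fun p : α × β => g p.1 p.2) : Computable fun a => (f a).flatMap (g a) := by
  refine (computable_foldr (h := fun a b s => g a b ++ s) hf (Computable.const [])
    (Computable.list_append.comp (hg.comp (Computable.fst.pair (Computable.fst.comp .snd)))
      (Computable.snd.comp .snd))).of_eq fun a => ?_
  induction f a <;> simp [*]

lemma computable_filter {f : α → List β} {g : α → β → Bool} (hf : Computable f)
    (hg : Computable fun p : α × β => g p.1 p.2) : Computable fun a => (f a).filter (g a) := by
  refine (computable_foldr (h := fun a b s => cond (g a b) (b :: s) s) hf (Computable.const [])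
    (Computable.cond (hg.comp (Computable.fst.pair (Computable.fst.comp .snd)))
      (Computable.list_cons.comp (Computable.fst.comp .snd) (Computable.snd.comp .snd))
      (Computable.snd.comp .snd))).of_eq fun a => ?_
  induction f a with
  | nil => rfl
  | cons b l ih => rw [List.foldr_cons, ih, List.filter_cons]; cases g a b <;> rfl

lemma computable_not {f : α → Bool} (hf : Computable f) : Computable fun a => !f a :=
  Primrec.not.to_comp.comp hf

lemma computable_and {f g : α → Bool} (hf : Computable f) (hg : Computable g) :
    Computable fun a => f a && g a :=
  Primrec.and.to_comp.comp hf hg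

lemma computable_or {f g : α → Bool} (hf : Computable f) (hg : Computable g) :
    Computable fun a => f a || g a :=
  Primrec.or.to_comp.comp hf hg

lemma computable_all {f : α → List β} {g : α → β → Bool} (hf : Computable f)
    (hg : Computable fun p : α × β => g p.1 p.2) : Computable fun a => (f a).all (g a) := by
  refine (computable_foldr (h := fun a b s => g a b && s) hf (Computable.const true)
    (computable_and (hg.comp (Computable.fst.pair (Computable.fst.comp .snd)))
      (Computable.snd.comp .snd))).of_eq fun a => ?_
  induction f a <;> simp [*]

lemma computable_decide_eq [DecidableEq β] {f g : α → β} (hf : Computable f)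
    (hg : Computable g) : Computable fun a => decide (f a = g a) :=
  Primrec.eq.decide.to_comp.comp hf hg

lemma computable_decide_lt {f g : α → ℕ} (hf : Computable f) (hg : Computable g) :
    Computable fun a => decide (f a < g a) :=
  Primrec.nat_lt.decide.to_comp.comp hf hg

end ComputableLists

/-! ### Arithmetic of polynomials on codes. -/

section Codes

/-- The number of letters `i` in a word. -/
lemma computable_count (i : Fin 3) : Computable fun w : List (Fin 3) => w.count i := by
  refine (Computable.list_length.comp (computable_filter (α := List (Fin 3))
    (g := fun _ j => decide (j = i)) Computable.id
    (computable_decide_eq .snd (.const i)))).of_eq fun w => ?_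
  rw [List.count_eq_length_filter]
  congr 1

/-- The bidegree of a word as a pair of numbers. -/
def wordPair (w : List (Fin 3)) : ℕ × ℕ := (w.count 0 + w.count 1, w.count 2)

lemma computable_wordPair : Computable wordPair :=
  (Primrec.nat_add.to_comp.comp (computable_count 0) (computable_count 1)).pair
    (computable_count 2)

lemma toLex_wordPair (w : List (Fin 3)) :
    toLex (wordPair w) = wordBideg (FreeMonoid.ofList w) := rfl

/-- The strict lexicographic order on pairs of numbers. -/
def ltPair (a b : ℕ × ℕ) : Bool :=
  decide (a.1 < b.1) || (decide (a.1 = b.1) && decide (a.2 < b.2))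

lemma ltPair_iff (a b : ℕ × ℕ) : ltPair a b = true ↔ toLex a < toLex b := by
  obtain ⟨a1, a2⟩ := a
  obtain ⟨b1, b2⟩ := b
  simp [ltPair, toLex_lt_iff]

lemma computable_ltPair {α : Type*} [Primcodable α] {f g : α → ℕ × ℕ} (hf : Computable f)
    (hg : Computable g) : Computable fun a => ltPair (f a) (g a) :=
  computable_or (computable_decide_lt (Computable.fst.comp hf) (Computable.fst.comp hg))
    (computable_and (computable_decide_eq (Computable.fst.comp hf) (Computable.fst.comp hg))
      (computable_decide_lt (Computable.snd.comp hf) (Computable.snd.comp hg)))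

/-- The larger one of two pairs in the lexicographic order. -/
def maxPair (a b : ℕ × ℕ) : ℕ × ℕ := cond (ltPair a b) b a

lemma toLex_maxPair (a b : ℕ × ℕ) : toLex (maxPair a b) = toLex a ⊔ toLex b := by
  rw [maxPair]
  cases h : ltPair a b
  · have : ¬ toLex a < toLex b := fun h' => by rw [← ltPair_iff, h] at h'; cases h'
    rw [cond_false, sup_eq_left.2 (not_lt.1 this)]
  · rw [cond_true, sup_eq_right.2 ((ltPair_iff _ _).1 h).le]

/-- All words in `y, z` of length at most `n`. -/
def wordsYZ (n : ℕ) : List (List (Fin 3)) :=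
  Nat.rec [[]] (fun _ l => [] :: (l.map (List.cons 1) ++ l.map (List.cons 2))) n

lemma computable_wordsYZ : Computable wordsYZ := by
  have hc : ∀ i : Fin 3, Computable fun a : ℕ × ℕ × List (List (Fin 3)) =>
      a.2.2.map (List.cons i) := fun i =>
    computable_map (g := fun _ w => i :: w) (Computable.snd.comp .snd)
      (Computable.list_cons.comp (.const i) .snd)
  exact Computable.nat_rec (h := fun _ p => [] :: (p.2.map (List.cons 1) ++ p.2.map (List.cons 2)))
    Computable.id (.const [[]]) (Computable.list_cons.comp (.const [])
      (Computable.list_append.comp (hc 1) (hc 2)))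

lemma mem_wordsYZ {w : List (Fin 3)} {n : ℕ} (h : w.length ≤ n) (h0 : ∀ i ∈ w, i ≠ 0) :
    w ∈ wordsYZ n := by
  induction n generalizing w with
  | zero => rw [List.length_eq_zero_iff.1 (Nat.le_zero.1 h)]; exact List.mem_singleton_self _
  | succ n ih =>
    change w ∈ [] :: ((wordsYZ n).map (List.cons 1) ++ (wordsYZ n).map (List.cons 2))
    cases w with
    | nil => simp
    | cons i w =>
      have hw := ih (w := w) (by simpa using h) fun j hj => h0 j (List.mem_cons_of_mem _ hj)
      have : i = 1 ∨ i = 2 := by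
        have := h0 i List.mem_cons_self
        omega
      rcases this with rfl | rfl <;> simp [hw]

lemma ne_zero_of_mem_wordsYZ {w : List (Fin 3)} {n : ℕ} (h : w ∈ wordsYZ n) : ∀ i ∈ w, i ≠ 0 := by
  induction n generalizing w with
  | zero => rw [List.mem_singleton.1 h]; simp
  | succ n ih =>
    change w ∈ [] :: ((wordsYZ n).map (List.cons 1) ++ (wordsYZ n).map (List.cons 2)) at h
    simp only [List.mem_cons, List.mem_append, List.mem_map] at h
    rcases h with rfl | ⟨v, hv, rfl⟩ | ⟨v, hv, rfl⟩
    · simp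
    · intro i hi
      rcases List.mem_cons.1 hi with rfl | hi
      · decide
      · exact ih hv i hi
    · intro i hi
      rcases List.mem_cons.1 hi with rfl | hi
      · decide
      · exact ih hv i hi

variable {K : Type*} [Field K] (C : Constructivization K)

namespace Constructivization

/-- Addition of names. -/
noncomputable def add : ℕ → ℕ → ℕ := C.add_computable.choose

lemma computable_add : Computable₂ C.add := C.add_computable.choose_spec.1

@[simp] lemma ν_add (m n : ℕ) : C.ν (C.add m n) = C.ν m + C.ν n :=
  C.add_computable.choose_spec.2 m n

/-- Multiplication of names. -/
noncomputable def mul : ℕ → ℕ → ℕ := C.mul_computable.choose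

lemma computable_mul : Computable₂ C.mul := C.mul_computable.choose_spec.1

@[simp] lemma ν_mul (m n : ℕ) : C.ν (C.mul m n) = C.ν m * C.ν n :=
  C.mul_computable.choose_spec.2 m n

/-- A name of an element. -/
noncomputable def name (a : K) : ℕ := (C.surjective a).choose

@[simp] lemma ν_name (a : K) : C.ν (C.name a) = a := (C.surjective a).choose_spec

open Classical in
/-- The equality test on names. -/
noncomputable def eqv (m n : ℕ) : Bool := decide (C.ν m = C.ν n)

@[simp] lemma eqv_iff (m n : ℕ) : C.eqv m n = true ↔ C.ν m = C.ν n := by simp [eqv]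

lemma computable_eqv {α : Type*} [Primcodable α] {f g : α → ℕ} (hf : Computable f)
    (hg : Computable g) : Computable fun a => C.eqv (f a) (g a) := by
  classical
  exact (C.eq_computable.decide.comp (hf.pair hg)).of_eq fun a => by simp [eqv]

end Constructivization

@[simp] lemma evalCode_nil : evalCode C [] = 0 := rfl

lemma map_ι_prod (w : List (Fin 3)) :
    (w.map (FreeAlgebra.ι K)).prod = ofWord K (FreeMonoid.ofList w) := by
  simp [ofWord, FreeMonoid.lift_apply]

@[simp] lemma evalCode_cons (m : List (Fin 3) × ℕ) (c : Code) :
    evalCode C (m :: c) = C.ν m.2 • ofWord K (FreeMonoid.ofList m.1) + evalCode C c := by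
  rw [← map_ι_prod]; rfl

@[simp] lemma evalCode_append (c d : Code) :
    evalCode C (c ++ d) = evalCode C c + evalCode C d := by
  simp [evalCode]

lemma evalCode_flatMap {β : Type*} (l : List β) (g : β → Code) :
    evalCode C (l.flatMap g) = (l.map fun b => evalCode C (g b)).sum := by
  induction l <;> simp [*]

/-- The name of the coefficient of a word. -/
noncomputable def coefCode (c : Code) (w : List (Fin 3)) : ℕ :=
  c.foldr (fun m s => cond (decide (m.1 = w)) (C.add m.2 s) s) (C.name 0)

-- A code may list a word several times, so the entries belonging to it are added up; only then can
-- a coefficient be compared with zero.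
@[simp] lemma ν_coefCode (c : Code) (w : List (Fin 3)) :
    C.ν (coefCode C c w) = coeffs (evalCode C c) (FreeMonoid.ofList w) := by
  classical
  induction c with
  | nil => simp [coefCode]
  | cons m c ih =>
    rw [coefCode, List.foldr_cons, ← coefCode, evalCode_cons, coeffs_add, coeffs_smul,
      coeffs_ofWord, Finsupp.add_apply, Finsupp.smul_apply, ← ih, Finsupp.single_apply]
    by_cases h : m.1 = w
    · simp [h]
    · simp [h]

lemma computable_coefCode {α : Type*} [Primcodable α] {f : α → Code} {g : α → List (Fin 3)}
    (hf : Computable f) (hg : Computable g) : Computable fun a => coefCode C (f a) (g a) :=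
  computable_foldr (h := fun a (m : List (Fin 3) × ℕ) s => cond (decide (m.1 = g a)) (C.add m.2 s) s) hf
    (.const (C.name 0)) (Computable.cond
      (computable_decide_eq (Computable.fst.comp (Computable.fst.comp .snd)) (hg.comp .fst))
      (C.computable_add.comp (Computable.snd.comp (Computable.fst.comp .snd))
        (Computable.snd.comp .snd))
      (Computable.snd.comp .snd))

/-- The words with nonzero coefficient. -/
noncomputable def suppCode (c : Code) : List (List (Fin 3)) :=
  (c.map Prod.fst).filter fun w => !C.eqv (coefCode C c w) (C.name 0)

lemma mem_suppCode {c : Code} {w : List (Fin 3)} :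
    w ∈ suppCode C c ↔ coeffs (evalCode C c) (FreeMonoid.ofList w) ≠ 0 := by
  have h1 : (!C.eqv (coefCode C c w) (C.name 0)) = true ↔
      coeffs (evalCode C c) (FreeMonoid.ofList w) ≠ 0 := by
    rw [Bool.not_eq_true', ← Bool.not_eq_true, C.eqv_iff, ν_coefCode, C.ν_name]
  rw [suppCode, List.mem_filter, h1, and_iff_right_iff_imp]
  intro h
  by_contra hw
  apply h
  rw [← ν_coefCode]
  clear h h1
  classical
  induction c with
  | nil => simp
  | cons m c ih =>
    simp only [List.map_cons, List.mem_cons, not_or] at hw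
    rw [ν_coefCode, evalCode_cons, coeffs_add, coeffs_smul, coeffs_ofWord, Finsupp.add_apply,
      Finsupp.smul_apply, ← ν_coefCode, ih hw.2, Finsupp.single_apply, if_neg]
    · simp
    · exact fun h => hw.1 (FreeMonoid.ofList.injective h).symm

lemma computable_suppCode : Computable (suppCode C) :=
  computable_filter (g := fun c w => !C.eqv (coefCode C c w) (C.name 0))
    (computable_map (g := fun _ (m : List (Fin 3) × ℕ) => m.1) Computable.id (Computable.fst.comp .snd))
    (computable_not (C.computable_eqv (computable_coefCode C .fst .snd) (.const _)))

/-- The test whether a code names an element of `K[z]`. -/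
noncomputable def inZCode (c : Code) : Bool :=
  (suppCode C c).all fun w => w.all fun i => decide (i = 2)

lemma inZCode_iff (c : Code) : inZCode C c = true ↔ evalCode C c ∈ algZ K := by
  rw [inZCode, List.all_eq_true, mem_algZ, mem_inWords]
  simp only [List.all_eq_true, decide_eq_true_eq, mem_suppCode]
  exact ⟨fun h w hw => h w.toList hw, fun h w hw => h _ hw⟩

lemma computable_inZCode : Computable (inZCode C) := by
  have h : Computable fun p : Code × List (Fin 3) => p.2.all fun i => decide (i = 2) :=
    computable_all (g := fun _ (i : Fin 3) => decide (i = 2)) .snd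
      (computable_decide_eq .snd (.const 2))
  exact computable_all (g := fun _ (w : List (Fin 3)) => w.all fun i => decide (i = 2))
    (computable_suppCode C) h

/-- The bidegree of the polynomial named by a code. -/
noncomputable def bidegCode (c : Code) : ℕ × ℕ :=
  (suppCode C c).foldr (fun w b => maxPair (wordPair w) b) (0, 0)

lemma toLex_bidegCode (c : Code) : toLex (bidegCode C c) = bideg (evalCode C c) := by
  classical
  have h : ∀ l : List (List (Fin 3)), toLex (l.foldr (fun w b => maxPair (wordPair w) b) (0, 0)) =
      (l.map FreeMonoid.ofList).toFinset.sup wordBideg := by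
    intro l
    induction l with
    | nil => rfl
    | cons w l ih =>
      rw [List.foldr_cons, toLex_maxPair, ih, List.map_cons, List.toFinset_cons,
        Finset.sup_insert, toLex_wordPair]
  rw [bidegCode, h, bideg]
  refine congrArg (fun s : Finset (FreeMonoid (Fin 3)) => s.sup wordBideg) (Finset.ext fun w => ?_)
  rw [List.mem_toFinset, List.mem_map, Finsupp.mem_support_iff]
  constructor
  · rintro ⟨v, hv, rfl⟩
    exact (mem_suppCode C).1 hv
  · intro hw
    exact ⟨w.toList, (mem_suppCode C).2 hw, rfl⟩

lemma computable_bidegCode : Computable (bidegCode C) :=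
  computable_foldr (h := fun _ w b => maxPair (wordPair w) b) (computable_suppCode C)
    (.const (0, 0)) (Computable.cond
      (computable_ltPair (computable_wordPair.comp (Computable.fst.comp .snd))
        (Computable.snd.comp .snd))
      (Computable.snd.comp .snd) (computable_wordPair.comp (Computable.fst.comp .snd)))

/-- A code of the leading component. -/
noncomputable def leadCode (c : Code) : Code :=
  c.filter fun m => decide (wordPair m.1 = bidegCode C c)

/-- The filter looks at words only. Entries that cancel each other may survive it, without effect on
the value. -/
lemma evalCode_leadCode (c : Code) : evalCode C (leadCode C c) = lead (evalCode C c) := by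
  classical
  refine ext_coeffs fun w => ?_
  rw [coeffs_lead_apply, ← toLex_bidegCode, leadCode]
  generalize bidegCode C c = b
  induction c with
  | nil => simp
  | cons m c ih =>
    have hw : ∀ b, wordPair m.1 = b ↔ wordBideg (FreeMonoid.ofList m.1) = toLex b :=
      fun b => by rw [← toLex_wordPair, toLex.injective.eq_iff]
    rw [List.filter_cons, evalCode_cons, coeffs_add, Finsupp.add_apply, coeffs_smul,
      coeffs_ofWord, Finsupp.smul_apply, Finsupp.single_apply]
    by_cases h1 : wordPair m.1 = b
    · rw [if_pos (by simpa using h1), evalCode_cons, coeffs_add, Finsupp.add_apply, coeffs_smul,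
        coeffs_ofWord, Finsupp.smul_apply, Finsupp.single_apply, ih]
      rw [hw] at h1
      by_cases h2 : FreeMonoid.ofList m.1 = w
      · subst h2; simp [h1]
      · simp [h2]
    · rw [if_neg (by simpa using h1), ih]
      rw [hw] at h1
      by_cases h2 : FreeMonoid.ofList m.1 = w
      · subst h2; simp [h1]
      · simp [h2]

lemma computable_leadCode : Computable (leadCode C) :=
  computable_filter (g := fun c (m : List (Fin 3) × ℕ) => decide (wordPair m.1 = bidegCode C c)) Computable.id
    (computable_decide_eq (computable_wordPair.comp (Computable.fst.comp .snd))
      ((computable_bidegCode C).comp .fst))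

/-- A code of a scalar multiple. -/
noncomputable def smulCode (n : ℕ) (c : Code) : Code := c.map fun m => (m.1, C.mul n m.2)

@[simp] lemma evalCode_smulCode (n : ℕ) (c : Code) :
    evalCode C (smulCode C n c) = C.ν n • evalCode C c := by
  induction c with
  | nil => simp [smulCode]
  | cons m c ih =>
    rw [smulCode, List.map_cons, ← smulCode, evalCode_cons, ih, evalCode_cons, smul_add,
      C.ν_mul, mul_smul]

lemma computable_smulCode {α : Type*} [Primcodable α] {f : α → ℕ} {g : α → Code}
    (hf : Computable f) (hg : Computable g) : Computable fun a => smulCode C (f a) (g a) :=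
  computable_map (g := fun a (m : List (Fin 3) × ℕ) => (m.1, C.mul (f a) m.2)) hg
    ((Computable.fst.comp .snd).pair
      (C.computable_mul.comp (hf.comp .fst) (Computable.snd.comp .snd)))

/-- A code of a product. -/
noncomputable def mulCode (c d : Code) : Code :=
  c.flatMap fun m => d.map fun m' => (m.1 ++ m'.1, C.mul m.2 m'.2)

@[simp] lemma evalCode_mulCode (c d : Code) :
    evalCode C (mulCode C c d) = evalCode C c * evalCode C d := by
  have h : ∀ m : List (Fin 3) × ℕ, evalCode C (d.map fun m' => (m.1 ++ m'.1, C.mul m.2 m'.2)) =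
      (C.ν m.2 • ofWord K (FreeMonoid.ofList m.1)) * evalCode C d := by
    intro m
    induction d with
    | nil => simp
    | cons m' d ih =>
      rw [List.map_cons, evalCode_cons, ih, evalCode_cons, mul_add, C.ν_mul, FreeMonoid.ofList_append,
        map_mul, smul_mul_smul_comm]
  rw [mulCode, evalCode_flatMap]
  simp_rw [h]
  induction c with
  | nil => simp
  | cons m c ih => rw [List.map_cons, List.sum_cons, ih, evalCode_cons, add_mul]

lemma computable_mulCode {α : Type*} [Primcodable α] {f g : α → Code}
    (hf : Computable f) (hg : Computable g) : Computable fun a => mulCode C (f a) (g a) :=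
  computable_flatMap (g := fun a (m : List (Fin 3) × ℕ) =>
      (g a).map fun m' => (m.1 ++ m'.1, C.mul m.2 m'.2)) hf
    (computable_map (g := fun (p : α × List (Fin 3) × ℕ) (m' : List (Fin 3) × ℕ) =>
      (p.2.1 ++ m'.1, C.mul p.2.2 m'.2)) (hg.comp .fst)
      ((Computable.list_append.comp (Computable.fst.comp (Computable.snd.comp .fst))
        (Computable.fst.comp .snd)).pair
        (C.computable_mul.comp (Computable.snd.comp (Computable.snd.comp .fst))
          (Computable.snd.comp .snd))))

/-- A code of the polynomial substituted for a letter. -/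
noncomputable def letterCode (v : Code) (i : Fin 3) : Code :=
  cond (decide (i = 0)) [] (cond (decide (i = 1)) v [([2], C.name 1)])

lemma evalCode_letterCode (v : Code) (i : Fin 3) :
    evalCode C (letterCode C v i) = substHom (evalCode C v) (FreeAlgebra.ι K i) := by
  by_cases h0 : i = 0
  · subst h0; exact (substHom_X _).symm
  by_cases h1 : i = 1
  · subst h1; exact (substHom_Y _).symm
  obtain rfl : i = 2 := by omega
  refine Eq.trans ?_ (substHom_Z _).symm
  have : letterCode C v 2 = [([2], C.name 1)] := rfl
  simp [this, Z]

/-- A code of `s(v, z)` for a word `s`. -/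
noncomputable def substWordCode (v : Code) (s : List (Fin 3)) : Code :=
  s.foldr (fun i r => mulCode C (letterCode C v i) r) [([], C.name 1)]

@[simp] lemma evalCode_substWordCode (v : Code) (s : List (Fin 3)) :
    evalCode C (substWordCode C v s) =
      substHom (evalCode C v) (ofWord K (FreeMonoid.ofList s)) := by
  induction s with
  | nil => simp [substWordCode]
  | cons i s ih =>
    rw [substWordCode, List.foldr_cons, ← substWordCode, evalCode_mulCode, ih,
      evalCode_letterCode, FreeMonoid.ofList_cons, map_mul, map_mul, ofWord_of]

lemma computable_substWordCode {α : Type*} [Primcodable α] {f : α → Code} {g : α → List (Fin 3)}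
    (hf : Computable f) (hg : Computable g) : Computable fun a => substWordCode C (f a) (g a) := by
  have hl : Computable fun p : α × Fin 3 × Code => letterCode C (f p.1) p.2.1 :=
    Computable.cond (computable_decide_eq (Computable.fst.comp .snd) (.const 0)) (.const [])
      (Computable.cond (computable_decide_eq (Computable.fst.comp .snd) (.const 1)) (hf.comp .fst)
        (.const _))
  exact computable_foldr (h := fun a i r => mulCode C (letterCode C (f a) i) r) hg (.const [([], C.name 1)])
    (computable_mulCode C hl (Computable.snd.comp .snd))

/-- A code of `q(v, z)`. -/
noncomputable def substCode (q v : Code) : Code :=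
  q.flatMap fun m => smulCode C m.2 (substWordCode C v m.1)

@[simp] lemma evalCode_substCode (q v : Code) :
    evalCode C (substCode C q v) = substHom (evalCode C v) (evalCode C q) := by
  rw [substCode, evalCode_flatMap]
  induction q with
  | nil => simp
  | cons m q ih =>
    rw [List.map_cons, List.sum_cons, ih, evalCode_cons, map_add, map_smul, evalCode_smulCode,
      evalCode_substWordCode]

lemma computable_substCode {α : Type*} [Primcodable α] {f g : α → Code}
    (hf : Computable f) (hg : Computable g) : Computable fun a => substCode C (f a) (g a) :=
  computable_flatMap (g := fun a (m : List (Fin 3) × ℕ) => smulCode C m.2 (substWordCode C (g a) m.1)) hf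
    (computable_smulCode C (Computable.snd.comp .snd)
      (computable_substWordCode C (hg.comp .fst) (Computable.fst.comp .snd)))

/-- A code of a difference. -/
noncomputable def subCode (c d : Code) : Code := c ++ smulCode C (C.name (-1)) d

@[simp] lemma evalCode_subCode (c d : Code) :
    evalCode C (subCode C c d) = evalCode C c - evalCode C d := by
  simp [subCode, sub_eq_add_neg]

lemma computable_subCode {α : Type*} [Primcodable α] {f g : α → Code}
    (hf : Computable f) (hg : Computable g) : Computable fun a => subCode C (f a) (g a) :=
  Computable.list_append.comp hf (computable_smulCode C (.const _) hg)

/-- The equality test for polynomials given by codes. -/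
noncomputable def eqCode (c d : Code) : Bool := decide (suppCode C (subCode C c d) = [])

lemma eqCode_iff (c d : Code) : eqCode C c d = true ↔ evalCode C c = evalCode C d := by
  rw [eqCode, decide_eq_true_eq, List.eq_nil_iff_forall_not_mem, ← sub_eq_zero,
    ← evalCode_subCode]
  simp only [mem_suppCode, not_not]
  constructor
  · intro h
    exact ext_coeffs fun w => by simpa using h w.toList
  · intro h w
    rw [h]; simp

lemma computable_eqCode {α : Type*} [Primcodable α] {f g : α → Code}
    (hf : Computable f) (hg : Computable g) : Computable fun a => eqCode C (f a) (g a) :=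
  computable_decide_eq ((computable_suppCode C).comp (computable_subCode C hf hg)) (.const [])

/-- The name of the value at `u` of the linear functional `∑ λ_w w^*` named by a code. -/
noncomputable def pairingCode (c u : Code) : ℕ :=
  c.foldr (fun m s => C.add (C.mul m.2 (coefCode C u m.1)) s) (C.name 0)

lemma ν_pairingCode (c u : Code) : C.ν (pairingCode C c u) =
    (c.map fun m => C.ν m.2 * coeffs (evalCode C u) (FreeMonoid.ofList m.1)).sum := by
  induction c with
  | nil => simp [pairingCode]
  | cons m c ih =>
    rw [pairingCode, List.foldr_cons, ← pairingCode, C.ν_add, ih, C.ν_mul, ν_coefCode,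
      List.map_cons, List.sum_cons]

lemma computable_pairingCode {α : Type*} [Primcodable α] {f g : α → Code}
    (hf : Computable f) (hg : Computable g) : Computable fun a => pairingCode C (f a) (g a) :=
  computable_foldr (h := fun a (m : List (Fin 3) × ℕ) s => C.add (C.mul m.2 (coefCode C (g a) m.1)) s) hf
    (.const _) (C.computable_add.comp
      (C.computable_mul.comp (Computable.snd.comp (Computable.fst.comp .snd))
        (computable_coefCode C (hg.comp .fst) (Computable.fst.comp (Computable.fst.comp .snd))))
      (Computable.snd.comp .snd))

end Codes


lemma computable₂_comp_fst {α β γ : Type*} [Primcodable α] [Primcodable β] [Primcodable γ]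
    {f : α → β → Bool} (hf : Computable fun p : α × β => f p.1 p.2) :
    Computable₂ fun (p : α × γ) (b : β) => f p.1 b := by
  exact hf.comp ((Computable.fst.comp .fst).pair .snd)

lemma computable_sum_cases {α β γ : Type*} [Primcodable α] [Primcodable β] [Primcodable γ]
    {f : α → β → Bool} {g : α → γ → Bool} (hf : Computable fun p : α × β => f p.1 p.2)
    (hg : Computable fun p : α × γ => g p.1 p.2) :
    Computable fun p : α × (β ⊕ γ) =>
      (Sum.casesOn p.2 (fun b => f p.1 b) (fun c => g p.1 c) : Bool) :=
  Computable.sumCasesOn (f := fun p : α × (β ⊕ γ) => p.2) (g := fun p b => f p.1 b)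
    (h := fun p c => g p.1 c) .snd (computable₂_comp_fst hf) (computable₂_comp_fst hg)

/-! ### Certificates, the effective pass, and the decision procedure. -/

section Decision

variable {K : Type*} [Field K] (C : Constructivization K)

/-- The second clause makes the code of an element of `K⟨y,z⟩` avoid the letter `x` entry by entry,
which is the form that `yesTest` checks. -/
lemma exists_code (p : A K) : ∃ c : Code, evalCode C c = p ∧
    ∀ m ∈ c, coeffs p (FreeMonoid.ofList m.1) ≠ 0 := by
  refine ⟨(coeffs p).support.toList.map fun w => (w.toList, C.name (coeffs p w)), ?_, ?_⟩
  · have h : ∀ l : List (FreeMonoid (Fin 3)),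
        evalCode C (l.map fun w => (w.toList, C.name (coeffs p w))) =
          (l.map fun w => coeffs p w • ofWord K w).sum := by
      intro l
      induction l with
      | nil => rfl
      | cons w l ih => rw [List.map_cons, evalCode_cons, ih]; simp
    rw [h, Finset.sum_map_toList]
    exact (eq_sum_coeffs p).symm
  · intro m hm
    obtain ⟨w, hw, rfl⟩ := List.mem_map.1 hm
    simpa using hw

/-- The test whether `q` certifies that `u = q(v, z)`. -/
noncomputable def yesTest (p : Code × Code) (q : Code) : Bool :=
  (q.all fun m => m.1.all fun i => !decide (i = 0)) && eqCode C (substCode C q p.2) p.1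

/-- The test whether the linear functional `c` certifies that `u` is not of the form `q(v, z)`. -/
noncomputable def noTest (p : Code × Code) (c : Code) : Bool :=
  ((wordsYZ ((bidegCode C p.1).1 + (bidegCode C p.1).2)).all fun s =>
    C.eqv (pairingCode C c (substWordCode C p.2 s)) (C.name 0)) &&
      !C.eqv (pairingCode C c p.1) (C.name 0)

/-- The test of a certificate. -/
noncomputable def certTest (p : Code × Code) (c : Code ⊕ Code) : Bool :=
  Sum.casesOn c (yesTest C p) (noTest C p)

lemma computable_noLetterX :
    Computable fun q : Code => q.all fun m => m.1.all fun i => !decide (i = 0) := by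
  have h : Computable fun m : List (Fin 3) × ℕ => m.1.all fun i => !decide (i = 0) :=
    computable_all (g := fun _ (i : Fin 3) => !decide (i = 0)) .fst
      (computable_not (computable_decide_eq .snd (.const 0)))
  exact computable_all (g := fun _ (m : List (Fin 3) × ℕ) => m.1.all fun i => !decide (i = 0))
      Computable.id (h.comp .snd)

lemma computable_yesTest : Computable fun p : (Code × Code) × Code => yesTest C p.1 p.2 := by
  have h1 : Computable fun p : (Code × Code) × Code =>
      p.2.all fun m => m.1.all fun i => !decide (i = 0) := computable_noLetterX.comp .snd
  have h2 : Computable fun p : (Code × Code) × Code => eqCode C (substCode C p.2 p.1.2) p.1.1 :=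
    computable_eqCode C (computable_substCode C .snd (Computable.snd.comp .fst))
      (Computable.fst.comp .fst)
  exact computable_and h1 h2

lemma computable_noTest : Computable fun p : (Code × Code) × Code => noTest C p.1 p.2 := by
  have hb : Computable fun p : (Code × Code) × Code => bidegCode C p.1.1 :=
    (computable_bidegCode C).comp (Computable.fst.comp .fst)
  have hw : Computable fun p : (Code × Code) × Code =>
      wordsYZ ((bidegCode C p.1.1).1 + (bidegCode C p.1.1).2) :=
    computable_wordsYZ.comp (Primrec.nat_add.to_comp.comp (Computable.fst.comp hb)
      (Computable.snd.comp hb))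
  have hs : Computable fun p : ((Code × Code) × Code) × List (Fin 3) =>
      C.eqv (pairingCode C p.1.2 (substWordCode C p.1.1.2 p.2)) (C.name 0) :=
    C.computable_eqv (computable_pairingCode C (Computable.snd.comp .fst)
      (computable_substWordCode C (Computable.snd.comp (Computable.fst.comp .fst)) .snd))
      (.const _)
  have h1 := computable_all (g := fun (p : (Code × Code) × Code) (s : List (Fin 3)) =>
      C.eqv (pairingCode C p.2 (substWordCode C p.1.2 s)) (C.name 0)) hw hs
  have h2 : Computable fun p : (Code × Code) × Code =>
      !C.eqv (pairingCode C p.2 p.1.1) (C.name 0) :=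
    computable_not (C.computable_eqv (computable_pairingCode C .snd
      (Computable.fst.comp .fst)) (.const _))
  exact computable_and h1 h2

lemma computable_certTest : Computable₂ (certTest C) :=
  computable_sum_cases (computable_yesTest C) (computable_noTest C)

lemma yesTest_iff (p : Code × Code) (q : Code) : yesTest C p q = true ↔
    (∀ m ∈ q, ∀ i ∈ m.1, i ≠ 0) ∧
      substHom (evalCode C p.2) (evalCode C q) = evalCode C p.1 := by
  simp [yesTest, eqCode_iff]

lemma evalCode_mem_algYZ {q : Code} (h : ∀ m ∈ q, ∀ i ∈ m.1, i ≠ 0) :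
    evalCode C q ∈ algYZ K := by
  induction q with
  | nil => exact Subalgebra.zero_mem _
  | cons m q ih =>
    rw [evalCode_cons]
    refine Subalgebra.add_mem _ (Subalgebra.smul_mem _ ?_ _)
      (ih fun m' hm' => h m' (List.mem_cons_of_mem _ hm'))
    rw [mem_algYZ]
    exact ofWord_mem_inWords (h m List.mem_cons_self)

lemma noTest_iff (p : Code × Code) (c : Code) : noTest C p c = true ↔
    (∀ s ∈ wordsYZ ((bidegCode C p.1).1 + (bidegCode C p.1).2),
      C.ν (pairingCode C c (substWordCode C p.2 s)) = 0) ∧ C.ν (pairingCode C c p.1) ≠ 0 := by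
  rw [noTest, Bool.and_eq_true, List.all_eq_true, Bool.not_eq_true', ← Bool.not_eq_true]
  simp only [C.eqv_iff, C.ν_name, ne_eq]

/-- If `u` lies outside the subspace of all `q(v,z)`, some linear functional separates it from that
subspace. The names of the values are chosen without any algorithm, which is harmless since only the
existence of a certificate matters. -/
lemma exists_cert (p : Code × Code) : ∃ c, certTest C p c = true := by
  classical
  by_cases h : evalCode C p.1 ∈ (algYZ K).toSubmodule.map (substHom (evalCode C p.2)).toLinearMap
  · obtain ⟨q, hq, hqu⟩ := h
    obtain ⟨c, rfl, hc⟩ := exists_code C q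
    refine ⟨Sum.inl c, (yesTest_iff C p c).2 ⟨fun m hm => ?_, hqu⟩⟩
    exact mem_inWords.1 (mem_algYZ.1 hq) _ (hc m hm)
  · obtain ⟨F, hFu, hF⟩ := Submodule.exists_le_ker_of_notMem h
    -- `W` contains every word whose coefficient the test inspects, so the functional restricted to
    -- `W` gives the same values there and has a finite code.
    let W : Finset (FreeMonoid (Fin 3)) := (coeffs (evalCode C p.1)).support ∪
      (wordsYZ ((bidegCode C p.1).1 + (bidegCode C p.1).2)).toFinset.biUnion fun s =>
        (coeffs (evalCode C (substWordCode C p.2 s))).support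
    let c : Code := W.toList.map fun w => (w.toList, C.name (F (ofWord K w)))
    have key : ∀ u : Code, (coeffs (evalCode C u)).support ⊆ W →
        C.ν (pairingCode C c u) = F (evalCode C u) := by
      intro u hu
      rw [ν_pairingCode, List.map_map, Finset.sum_map_toList]
      conv_rhs => rw [eq_sum_coeffs (evalCode C u), Finsupp.sum_of_support_subset _ hu _ (by simp),
        map_sum]
      refine Finset.sum_congr rfl fun w _ => ?_
      simp [mul_comm]
    refine ⟨Sum.inr c, (noTest_iff C p c).2 ⟨fun s hs => ?_, ?_⟩⟩
    · rw [key]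
      · rw [evalCode_substWordCode]
        refine LinearMap.mem_ker.1 (hF ⟨_, ?_, rfl⟩)
        change ofWord K (FreeMonoid.ofList s) ∈ algYZ K
        rw [mem_algYZ]
        exact ofWord_mem_inWords (ne_zero_of_mem_wordsYZ hs)
      · intro w hw
        exact Finset.mem_union_right _ (Finset.mem_biUnion.2 ⟨s, List.mem_toFinset.2 hs, hw⟩)
    · rw [key _ Finset.subset_union_left]
      exact hFu

/-- The search runs through all encodings until a certificate passes its computable test; it halts
because a certificate exists. -/
lemma exists_find : ∃ find : Code × Code → Code ⊕ Code, Computable find ∧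
    ∀ p, certTest C p (find p) = true := by
  let F : Code × Code → ℕ → Option (Code ⊕ Code) := fun p n =>
    (Encodable.decode n).bind fun c => cond (certTest C p c) (some c) none
  have hF : Computable₂ F := by
    refine Computable.option_bind (Computable.decode.comp .snd) ?_
    exact Computable.cond ((computable_certTest C).comp (Computable.fst.comp .fst) .snd)
      (Computable.option_some.comp .snd) (.const none)
  have hdom : ∀ p, (Nat.rfindOpt (F p)).Dom := by
    intro p
    obtain ⟨c, hc⟩ := exists_cert C p
    rw [Nat.rfindOpt_dom]
    refine ⟨Encodable.encode c, c, ?_⟩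
    change (Encodable.decode (Encodable.encode c)).bind _ = some c
    rw [Encodable.encodek, Option.bind_some, hc, cond_true]
  refine ⟨fun p => (Nat.rfindOpt (F p)).get (hdom p),
    (Partrec.rfindOpt hF).of_eq_tot fun p => Part.get_mem _, fun p => ?_⟩
  obtain ⟨n, hn⟩ := Nat.rfindOpt_spec (Part.get_mem (hdom p))
  change certTest C p ((Nat.rfindOpt (F p)).get (hdom p)) = true
  generalize (Nat.rfindOpt (F p)).get (hdom p) = c at hn ⊢
  simp only [F, Option.mem_def, Option.bind_eq_some_iff] at hn
  obtain ⟨c', -, hc'⟩ := hn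
  cases h : certTest C p c' with
  | false => simp [h] at hc'
  | true =>
    simp only [h, cond_true, Option.some.injEq] at hc'
    rw [← hc', h]

/-- A verified certificate for or against `u = q(v, z)`. -/
noncomputable def findCert : Code × Code → Code ⊕ Code := (exists_find C).choose

lemma computable_findCert : Computable (findCert C) := (exists_find C).choose_spec.1

lemma findCert_spec (p : Code × Code) : certTest C p (findCert C p) = true :=
  (exists_find C).choose_spec.2 p

/-- A negative certificate is sound for leading components. -/
lemma not_exists_of_noTest {c d l : Code} (hf : evalCode C c ∉ algZ K) (hg : evalCode C d ∉ algZ K)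
    (h : noTest C (leadCode C c, leadCode C d) l = true) {q : A K} (hq : q ∈ algYZ K) :
    lead (evalCode C c) ≠ substHom (lead (evalCode C d)) q := by
  intro he
  obtain ⟨-, hq1, hb, -⟩ := lead_eq_substHom hf hg hq he
  obtain ⟨h1, h2⟩ := (noTest_iff C _ _).1 h
  have hbc : toLex (bidegCode C (leadCode C c)) = bideg (evalCode C c) := by
    rw [toLex_bidegCode, evalCode_leadCode, bideg_lead (ne_zero_of_notMem_algZ hf)]
  let P : A K →ₗ[K] K :=
    { toFun := fun p => (l.map fun m => C.ν m.2 * coeffs p (FreeMonoid.ofList m.1)).sum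
      map_add' := fun p p' => by simp [mul_add, List.sum_map_add]
      map_smul' := fun a p => by simp [mul_left_comm _ a, List.sum_map_mul_left] }
  have hP : ∀ u, C.ν (pairingCode C l u) = P (evalCode C u) := fun u => ν_pairingCode C l u
  rw [hP, evalCode_leadCode, he] at h2
  apply h2
  -- An expression of a leading component is bihomogeneous, so all words of `q` have the same known
  -- bidegree and the finite list in `noTest` contains them.
  have hhom : q ∈ homB K (bideg q) := by
    have := lead_mem_homB q
    rwa [hq1] at this
  rw [eq_sum_coeffs q, Finsupp.sum, map_sum, map_sum]
  refine Finset.sum_eq_zero fun s hs => ?_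
  rw [Finsupp.mem_support_iff] at hs
  rw [map_smul, map_smul]
  have hs0 := mem_inWords.1 (mem_algYZ.1 hq) s hs
  have hsb : wordBideg s = bideg q := mem_inWords.1 hhom s hs
  have hlen : s.toList.length = xyDeg s + s.toList.count 2 := by
    clear hs hs0 hsb
    induction s using FreeMonoid.inductionOn' with
    | one => simp
    | of_mul i s ih =>
      simp only [FreeMonoid.toList_mul, FreeMonoid.toList_of, List.singleton_append,
        List.length_cons, ih, xyDeg, List.count_cons]
      fin_cases i <;> simp <;> ring
  have hmem : s.toList ∈ wordsYZ ((bidegCode C (leadCode C c)).1 +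
      (bidegCode C (leadCode C c)).2) := by
    refine mem_wordsYZ ?_ hs0
    have hb' : bidegCode C (leadCode C c) = ofLex (bideg (evalCode C c)) := by rw [← hbc]; rfl
    have h3 : xyDeg s = (ofLex (bideg q)).1 := by rw [← hsb]; rfl
    have h4 : s.toList.count 2 = (ofLex (bideg q)).2 := by rw [← hsb]; rfl
    rw [hlen, hb', hb, h3, h4]
    simp only [tau, ofLex_toLex]
    -- As `lead g` has positive degree in `x, y`, both degrees of `q` are bounded by those of `f`;
    -- their sum bounds the length of `s`.
    have := Nat.le_mul_of_pos_left (ofLex (bideg q)).1 (fst_bideg_pos hg)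
    omega
  have h5 := h1 _ hmem
  rw [hP, evalCode_substWordCode, evalCode_leadCode, FreeMonoid.ofList_toList] at h5
  rw [h5, smul_zero]

/-- One reduction of the first code by the second one, if it is possible. -/
noncomputable def reduceCode (c d : Code) : Option Code :=
  Sum.casesOn (findCert C (leadCode C c, leadCode C d))
    (fun q => some (subCode C c (substCode C q d))) fun _ => none

lemma computable_reduceCode {α : Type*} [Primcodable α] {f g : α → Code}
    (hf : Computable f) (hg : Computable g) : Computable fun a => reduceCode C (f a) (g a) :=
  Computable.sumCasesOn ((computable_findCert C).comp
      (((computable_leadCode C).comp hf).pair ((computable_leadCode C).comp hg)))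
    (Computable.option_some.comp (computable_subCode C (hf.comp .fst)
      (computable_substCode C .snd (hg.comp .fst))))
    (Computable.const none)

lemma reduceCode_eq_some {c d e : Code} (h : reduceCode C c d = some e) : ∃ q ∈ algYZ K,
    lead (evalCode C c) = substHom (lead (evalCode C d)) q ∧
      evalCode C e = evalCode C c - substHom (evalCode C d) q := by
  have hs := findCert_spec C (leadCode C c, leadCode C d)
  rw [reduceCode] at h
  cases hcert : findCert C (leadCode C c, leadCode C d) with
  | inl q =>
    rw [hcert] at h hs
    obtain ⟨h1, h2⟩ := (yesTest_iff C _ _).1 hs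
    rw [evalCode_leadCode, evalCode_leadCode] at h2
    refine ⟨evalCode C q, evalCode_mem_algYZ C h1, h2.symm, ?_⟩
    rw [← Option.some.inj h]
    simp
  | inr l => rw [hcert] at h; cases h

lemma reduceCode_eq_none {c d : Code} (hf : evalCode C c ∉ algZ K) (hg : evalCode C d ∉ algZ K)
    (h : reduceCode C c d = none) (β : K) (q : A K) :
    ¬ Expresses (lead (evalCode C c)) (lead (evalCode C d)) β q := by
  have hs := findCert_spec C (leadCode C c, leadCode C d)
  rw [reduceCode] at h
  intro he
  obtain ⟨q', hq', h1, -⟩ := he.exists_reduced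
  cases hcert : findCert C (leadCode C c, leadCode C d) with
  | inl q => rw [hcert] at h; cases h
  | inr l =>
    rw [hcert] at hs
    exact not_exists_of_noTest C hf hg hs hq' h1

/-- The test whether the linear parts in `x, y` are linearly independent. -/
noncomputable def indepCode (c d : Code) : Bool :=
  !C.eqv (C.mul (coefCode C c [0]) (coefCode C d [1])) (C.mul (coefCode C c [1]) (coefCode C d [0]))

/-- One pass of the procedure on codes. -/
noncomputable def passCode (c : Code × Code) : Bool ⊕ (Code × Code) :=
  cond (inZCode C c.1 || inZCode C c.2) (Sum.inl false)
    (cond (decide (bidegCode C c.1 = (1, 0)) && decide (bidegCode C c.2 = (1, 0)))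
      (Sum.inl (indepCode C c.1 c.2))
      (cond (ltPair (bidegCode C c.1) (bidegCode C c.2))
        (Option.casesOn (reduceCode C c.2 c.1) (Sum.inl false) fun e => Sum.inr (c.1, e))
        (Option.casesOn (reduceCode C c.1 c.2) (Sum.inl false) fun e => Sum.inr (e, c.2))))

lemma computable_passCode : Computable (passCode C) := by
  have hc : ∀ i : Fin 3, Computable fun c : Code × Code => coefCode C c.1 [i] :=
    fun i => computable_coefCode C .fst (.const [i])
  have hd : ∀ i : Fin 3, Computable fun c : Code × Code => coefCode C c.2 [i] :=
    fun i => computable_coefCode C .snd (.const [i])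
  have hb1 : Computable fun c : Code × Code => bidegCode C c.1 := (computable_bidegCode C).comp .fst
  have hb2 : Computable fun c : Code × Code => bidegCode C c.2 := (computable_bidegCode C).comp .snd
  refine Computable.cond (computable_or ((computable_inZCode C).comp .fst)
    ((computable_inZCode C).comp .snd)) (.const _) (Computable.cond
      (computable_and (computable_decide_eq hb1 (.const _)) (computable_decide_eq hb2 (.const _)))
      (Computable.sumInl.comp (computable_not (C.computable_eqv
        (C.computable_mul.comp (hc 0) (hd 1)) (C.computable_mul.comp (hc 1) (hd 0)))))
      (Computable.cond (computable_ltPair hb1 hb2) ?_ ?_))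
  · exact Computable.option_casesOn (computable_reduceCode C .snd .fst) (.const (Sum.inl false))
      (Computable.sumInr.comp ((Computable.fst.comp .fst).pair .snd))
  · exact Computable.option_casesOn (computable_reduceCode C .fst .snd) (.const (Sum.inl false))
      (Computable.sumInr.comp (Computable.snd.pair (Computable.snd.comp .fst)))

lemma indepCode_iff {c d : Code} (hc : bideg (evalCode C c) = toLex (1, 0))
    (hd : bideg (evalCode C d) = toLex (1, 0)) : indepCode C c d = true ↔
      LinearIndependent K ![lead (evalCode C c), lead (evalCode C d)] := by
  have key : ∀ {p : A K}, bideg p = toLex (1, 0) →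
      lead p = coeffs p (FreeMonoid.of 0) • X K + coeffs p (FreeMonoid.of 1) • Y K := by
    intro p hp
    obtain ⟨a, b, h1, -⟩ := exists_linear_of_bideg hp
    have h0 : coeffs (lead p) (FreeMonoid.of 0) = coeffs p (FreeMonoid.of 0) := by
      rw [coeffs_lead_apply, hp, if_pos (by decide)]
    have h0' : coeffs (lead p) (FreeMonoid.of 1) = coeffs p (FreeMonoid.of 1) := by
      rw [coeffs_lead_apply, hp, if_pos (by decide)]
    rw [← h0, ← h0', h1, coeffs_linear_zero, coeffs_linear_one]
  rw [key hc, key hd, linearIndependent_linear, indepCode, Bool.not_eq_true', ← Bool.not_eq_true,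
    C.eqv_iff, C.ν_mul, C.ν_mul, ν_coefCode, ν_coefCode, ν_coefCode, ν_coefCode, ne_eq, sub_eq_zero]
  rfl

lemma pass_passCode (c : Code × Code) :
    Pass (evalPair C c) (Sum.map id (evalPair C) (passCode C c)) := by
  obtain ⟨c, d⟩ := c
  have hb : ∀ (c : Code) (n : ℕ × ℕ), bidegCode C c = n ↔ bideg (evalCode C c) = toLex n :=
    fun c n => by rw [← toLex_bidegCode, toLex.injective.eq_iff]
  rw [passCode]
  cases h0 : (inZCode C c || inZCode C d) with
  | true =>
    rw [Bool.or_eq_true, inZCode_iff, inZCode_iff] at h0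
    exact .step_zero h0
  | false =>
    rw [← Bool.not_eq_true, Bool.or_eq_true, inZCode_iff, inZCode_iff] at h0
    have h0' : ¬ SomeInZ (evalPair C (c, d)) := h0
    obtain ⟨hf, hg⟩ := not_or.1 h0
    rw [cond_false]
    cases h1 : (decide (bidegCode C c = (1, 0)) && decide (bidegCode C d = (1, 0))) with
    | true =>
      rw [Bool.and_eq_true, decide_eq_true_eq, decide_eq_true_eq, hb, hb] at h1
      rw [cond_true]
      have hi := indepCode_iff C h1.1 h1.2
      have hB : BothLinear (evalPair C (c, d)) := ⟨h0', h1⟩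
      dsimp only
      cases h2 : indepCode C c d with
      | true => exact .step_one_yes hB (hi.1 h2)
      | false => exact .step_one_no hB (by rw [← Bool.not_eq_true, hi] at h2; exact h2)
    | false =>
      rw [← Bool.not_eq_true, Bool.and_eq_true, decide_eq_true_eq, decide_eq_true_eq, hb, hb] at h1
      rw [cond_false]
      -- With Steps 0 and 1 excluded, comparing the two bidegrees separates Step 3 from Step 2.
      have hnl : ¬ BothLinear (evalPair C (c, d)) := fun h => h1 h.2
      have htri := (trichotomy h0').resolve_left hnl
      dsimp only
      cases h2 : ltPair (bidegCode C c) (bidegCode C d) with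
      | true =>
        rw [ltPair_iff, toLex_bidegCode, toLex_bidegCode] at h2
        have hS := htri.resolve_left fun h => h.2.2.not_gt h2
        rw [cond_true]
        cases h3 : reduceCode C d c with
        | none => exact .step_three_no hS (reduceCode_eq_none C hg hf h3)
        | some e =>
          obtain ⟨q, hq, h4, h5⟩ := reduceCode_eq_some C h3
          have := Pass.step_three_go hS 1 q (expresses_of_substHom hg hf hq h4)
          rw [inv_one, one_smul, subst_eq] at this
          change Pass _ (Sum.inr (evalCode C c, evalCode C e))
          rw [h5]
          exact this
      | false =>
        rw [← Bool.not_eq_true, ltPair_iff, toLex_bidegCode, toLex_bidegCode] at h2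
        have hF := htri.resolve_right fun h => h2 h.2.2
        rw [cond_false]
        cases h3 : reduceCode C c d with
        | none => exact .step_two_no hF (reduceCode_eq_none C hf hg h3)
        | some e =>
          obtain ⟨q, hq, h4, h5⟩ := reduceCode_eq_some C h3
          have := Pass.step_two_go hF 1 q (expresses_of_substHom hf hg hq h4)
          rw [inv_one, one_smul, subst_eq] at this
          change Pass _ (Sum.inr (evalCode C e, evalCode C d))
          rw [h5]
          exact this

/-- Well-founded induction along the pass relation pulled back through `evalPair`. Membership in
`PFun.fix` serves computability, while `run` records a finite number of passes. -/
lemma exists_answer (c : Code × Code) : ∃ b : Bool,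
    b ∈ PFun.fix (passCode C : Code × Code →. Bool ⊕ (Code × Code)) c ∧ (∃ n, run (passCode C) n c = Sum.inl b) ∧
      (b = true ↔ IsZTame (evalPair C c)) := by
  have hwf : WellFounded fun c' c : Code × Code => Pass (evalPair C c) (Sum.inr (evalPair C c')) :=
    InvImage.wf (evalPair C) (pass_wellFounded (K := K))
  induction c using hwf.induction with
  | _ c ih =>
    have hp := pass_passCode C c
    cases h : passCode C c with
    | inl b =>
      rw [h] at hp
      refine ⟨b, PFun.fix_stop (by rw [PFun.coe_val, h]; exact Part.mem_some _), ⟨1, by rw [run, h]⟩, ?_⟩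
      cases b with
      | true => exact iff_of_true rfl (pass_true hp).1
      | false => exact iff_of_false (by simp) (pass_false hp)
    | inr c' =>
      rw [h] at hp
      obtain ⟨b, h1, ⟨n, h2⟩, h3⟩ := ih c' hp
      refine ⟨b, ?_, ⟨n + 1, by rw [run, h]; exact h2⟩, h3.trans (isZTame_iff_of_pass hp).symm⟩
      rw [PFun.fix_fwd_eq (a' := c') (by rw [PFun.coe_val, h]; exact Part.mem_some _)]
      exact h1

/-- The iteration of a computable pass is partial recursive; since it halts on every input, the
answer is a total computable function. -/
theorem exists_algorithm : ∃ (pass : Code × Code → Bool ⊕ (Code × Code))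
      (answer : Code × Code → Bool),
        Computable pass ∧ Computable answer ∧
        (∀ c, Pass (evalPair C c) (Sum.map id (evalPair C) (pass c))) ∧
        ∀ c, (∃ n, run pass n c = Sum.inl (answer c)) ∧
          (answer c = true ↔ IsZTame (evalPair C c)) := by
  choose answer h1 h2 using exists_answer C
  exact ⟨passCode C, answer, computable_passCode C,
    (Partrec.fix (computable_passCode C).partrec).of_eq_tot h1, pass_passCode C, h2⟩

end Decision

end ZTame

open ZTame in
theorem mainTheorem3 (K : Type*) [Field K] :
    -- every `z`-endomorphism has exactly one outcome of a pass
    (∀ φ : A K × A K, ∃! o : Bool ⊕ (A K × A K), Pass φ o) ∧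
    -- the procedure stops
    (WellFounded fun φ' φ : A K × A K => Pass φ (Sum.inr φ')) ∧
    -- the answers are correct and reductions preserve `z`-tameness
    (∀ φ : A K × A K, Pass φ (Sum.inl true) → IsZTame φ ∧ IsLinearTimesTranslation φ) ∧
    (∀ φ : A K × A K, Pass φ (Sum.inl false) → ¬ IsZTame φ) ∧
    (∀ φ φ' : A K × A K, Pass φ (Sum.inr φ') → (IsZTame φ ↔ IsZTame φ')) ∧
    -- a rejection in the first two steps even shows that `φ` is not an automorphism
    (∀ φ : A K × A K,
      SomeInZ φ ∨ (BothLinear φ ∧ ¬ LinearIndependent K ![lead φ.1, lead φ.2]) →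
        ¬ Function.Bijective (zEnd φ)) ∧
    -- `H_n` is a free `K[t_0,…,t_n]`-module on the `2^n` words of length `n` in `x` and `y`
    (∀ n : ℕ, Function.Injective
        (ofCoords : ((Fin n → Fin 2) → MvPolynomial (Fin (n + 1)) K) → A K) ∧
      Set.range (ofCoords : ((Fin n → Fin 2) → MvPolynomial (Fin (n + 1)) K) → A K) = H K n) ∧
    -- `ω ↦ ω ∗ y^d` parametrizes the `q` that come into question
    (∀ d : ℕ, Set.range (ofY : MvPolynomial (Fin (d + 1)) K → A K)
      = {q | q ∈ algYZ K ∧ q ∈ H K d}) ∧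
    -- `u = q(v/β,z)` in terms of coordinates
    (∀ (k d : ℕ) (Θ : (Fin k → Fin 2) → MvPolynomial (Fin (k + 1)) K)
        (Λ : (Fin (k * d) → Fin 2) → MvPolynomial (Fin (k * d + 1)) K)
        (ω : MvPolynomial (Fin (d + 1)) K) (β : K), β ≠ 0 →
      (ofCoords Λ = subst (ofY ω) (β⁻¹ • ofCoords Θ) ↔
        ∀ J, Λ J = MvPolynomial.C (β⁻¹ ^ d) * spread k ω * blockProd Θ J)) ∧
    -- one coordinate of `u` determines, by division of polynomials, the only possible `ω / β^d`,
    -- and the remaining coordinates then decide whether `u` has the desired form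
    (∀ (k d : ℕ) (Θ : (Fin k → Fin 2) → MvPolynomial (Fin (k + 1)) K)
        (Λ : (Fin (k * d) → Fin 2) → MvPolynomial (Fin (k * d + 1)) K)
        (J₀ : Fin (k * d) → Fin 2), 0 < k → 0 < d →
        (∀ j : Fin d, Θ (fun i => J₀ (blockPos j i)) ≠ 0) →
      (∀ ω ω' : MvPolynomial (Fin (d + 1)) K,
        Λ J₀ = spread k ω * blockProd Θ J₀ → Λ J₀ = spread k ω' * blockProd Θ J₀ → ω = ω') ∧
      ((∃ (β : K) (q : A K), β ≠ 0 ∧ q ∈ algYZ K ∧ q ∈ H K d ∧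
          ofCoords Λ = subst q (β⁻¹ • ofCoords Θ)) →
        ∃ ω : MvPolynomial (Fin (d + 1)) K, Λ J₀ = spread k ω * blockProd Θ J₀) ∧
      (∀ ω : MvPolynomial (Fin (d + 1)) K, Λ J₀ = spread k ω * blockProd Θ J₀ →
        ((∃ (β : K) (q : A K), β ≠ 0 ∧ q ∈ algYZ K ∧ q ∈ H K d ∧
            ofCoords Λ = subst q (β⁻¹ • ofCoords Θ)) ↔
          ∀ J, Λ J = spread k ω * blockProd Θ J))) ∧
    -- over a constructive field the procedure is effective and decides `z`-tameness
    (∀ C : Constructivization K,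
      ∃ (pass : Code × Code → Bool ⊕ (Code × Code)) (answer : Code × Code → Bool),
        Computable pass ∧ Computable answer ∧
        (∀ c, Pass (evalPair C c) (Sum.map id (evalPair C) (pass c))) ∧
        ∀ c, (∃ n, run pass n c = Sum.inl (answer c)) ∧
          (answer c = true ↔ IsZTame (evalPair C c))) := by
  refine ⟨existsUnique_pass, pass_wellFounded, fun φ => pass_true, fun φ => pass_false,
    fun φ φ' => isZTame_iff_of_pass, fun φ => not_bijective_of_rejected,
    fun n => ⟨ofCoords_injective n, range_ofCoords n⟩, range_ofY,
    fun k d Θ Λ ω β _ => ofCoords_eq_subst_iff k d Θ Λ ω β, ?_, exists_algorithm⟩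
  intro k d Θ Λ J₀ hk _ hJ
  refine ⟨fun ω ω' h h' => omega_unique hk hJ (h.symm.trans h'), fun h => ?_, fun ω hω => ?_⟩
  · obtain ⟨ω, h⟩ := exists_spread_of_subst.1 h
    exact ⟨ω, h J₀⟩
  · rw [exists_spread_of_subst]
    constructor
    · rintro ⟨ω', h⟩
      -- Any coefficient that works for all `J` works for `J₀`, hence equals the `ω` found there.
      rwa [omega_unique hk hJ (hω.symm.trans (h J₀))]
    · exact fun h => ⟨ω, h⟩
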